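/- For a multiset $s$ of positive integers (a partition, possibly empty), let $l(s)$ be its number of parts, $|s|$ the sum of its parts, and $|\operatorname{Aut} s|=\prod_{i\ge 1}a_i!$, where $a_i$ is the number of parts of $s$ equal to $i$. Write $\cup$ for the union of partitions with multiplicities added. Let $d\ge 1$ and let $\alpha,\beta$ be partitions of $d$. For $g\ge 0$ put $r=r^g_{\alpha,\beta}=-2+2g+l(\alpha)+l(\beta)$. The double Hurwitz number $H^g_{\alpha,\beta}$ counts connected genus $g$ branched covers of $\mathbb{CP}^1$ with branching $\alpha$ and $\beta$ over $0$ and $\infty$, these preimages being labelled, and simple branching over $r$ other fixed points; in monodromy form, $$H^g_{\alpha,\beta}=\frac{|\operatorname{Aut}\alpha|\,|\operatorname{Aut}\beta|}{d!}\,N,$$ where $N$ is the number of tuples $(\sigma,\tau_1,\dots,\tau_r,\gamma)$ of permutations of $\{1,\dots,d\}$ such that $\sigma$ has cycle type $\beta$, $\gamma$ has cycle type $\alpha$, every $\tau_i$ is a transposition, $\tau_r\cdots\tau_1\sigma=\gamma$, and the group generated by $\sigma,\tau_1,\dots,\tau_r$ acts transitively on $\{1,\dots,d\}$. 1) If $\alpha=(\alpha_1,\alpha_2)$,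 then, with $r=r^0_{\alpha,\beta}=l(\beta)$, $$H^0_{(\alpha_1,\alpha_2),\beta}=\frac{|\operatorname{Aut}\beta|\,r!}{d}\sum\frac{l(\rho)!\prod_{j\ge1}\rho_j}{|\operatorname{Aut}\rho|\,|\operatorname{Aut}\gamma_1|\,|\operatorname{Aut}\gamma_2|}(\alpha_1-|\gamma_1|)(\alpha_2-|\gamma_2|)\,\alpha_1^{l(\gamma_1)-1}\alpha_2^{l(\gamma_2)-1},$$ where the sum is over all triples of partitions $(\rho,\gamma_1,\gamma_2)$ with $\rho\cup\gamma_1\cup\gamma_2=\beta$ and $|\gamma_j|<\alpha_j$ for $j=1,2$. 2) If $\alpha=(\alpha_1,\alpha_2,\alpha_3)$, then, with $r=r^0_{\alpha,\beta}=l(\beta)+1$, $$H^0_{(\alpha_1,\alpha_2,\alpha_3),\beta}=|\operatorname{Aut}\beta|\,r!\sum\frac{l(\rho)!\prod_{j\ge1}\rho_j}{|\operatorname{Aut}\rho|}\prod_{j=1}^{3}\frac{(\alpha_j-|\gamma_j|)\,\alpha_j^{l(\gamma_j)-1}}{|\operatorname{Aut}\gamma_j|},$$ where the sum is over all quadruples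 of partitions $(\rho,\gamma_1,\gamma_2,\gamma_3)$ with $\rho\cup\gamma_1\cup\gamma_2\cup\gamma_3=\beta$ and $|\gamma_j|<\alpha_j$ for $j=1,2,3$. The partitions $\gamma_j$ may be empty. -/

import Mathlib

/-- `|Aut s|` for a partition given by its multiset `s` of parts: the order of the group of
permutations of the positions that fix the list of parts, which is `∏ᵢ aᵢ!` if `s` has `aᵢ` parts
equal to `i`. -/
def autOrder (s : Multiset ℕ) : ℕ :=
  ∏ i ∈ s.toFinset, (s.count i).factorial

/-- The number `r = -2 + 2g + l(α) + l(β)` of simple branch points (Riemann–Hurwitz). The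
subtraction is a true one as soon as `d ≥ 1`. -/
def simpleBranchCount (g : ℕ) {d : ℕ} (α β : Nat.Partition d) : ℕ :=
  2 * g + Multiset.card α.parts + Multiset.card β.parts - 2

/-- The tuples `(σ, τ₁, …, τᵣ, γ)` of permutations of `{1, …, d}` with `σ` of cycle type `β`, `γ` of
cycle type `α` (fixed points counted as parts `1`), all `τᵢ` transpositions, `τᵣ ⋯ τ₁ σ = γ`, and
`⟨σ, τ₁, …, τᵣ⟩` transitive. They are the monodromy data of connected degree `d` covers of the
sphere with profiles `α`, `β` over two points, simply branched over `r` other given points, with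
the sheets over a base point labelled. -/
def transitiveFactorizations {d : ℕ} (r : ℕ) (α β : Nat.Partition d) :
    Set (Equiv.Perm (Fin d) × (Fin r → Equiv.Perm (Fin d)) × Equiv.Perm (Fin d)) :=
  {p | p.1.partition.parts = β.parts ∧
    p.2.2.partition.parts = α.parts ∧
    (∀ i, (p.2.1 i).IsSwap) ∧
    (List.ofFn p.2.1).reverse.prod * p.1 = p.2.2 ∧
    MulAction.IsPretransitive (Subgroup.closure (insert p.1 (Set.range p.2.1))) (Fin d)}

/-- The genus `g` double Hurwitz number `H^g_{α,β}`: the number of connected genus `g` covers with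
branching `α`, `β` over two points and simple branching over `r` others, each weighted by the inverse
of the order of its automorphism group, the points over the two special points being labelled (hence
the factor `|Aut α| |Aut β|`). It is given here through monodromy, which labels the `d` sheets (hence
the factor `1 / d!`). -/
noncomputable def doubleHurwitz (g : ℕ) {d : ℕ} (α β : Nat.Partition d) : ℚ :=
  (autOrder α.parts : ℚ) * autOrder β.parts / d.factorial *
    Nat.card (transitiveFactorizations (simpleBranchCount g α β) α β)

/-- The tuples `(ρ, γ₁, …, γₘ)` of partitions (written as multisets of parts) with
`ρ ∪ γ₁ ∪ … ∪ γₘ = β` and `|γⱼ| < αⱼ` for all `j`. -/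
def decompositions {m : ℕ} (α : Fin m → ℕ) (β : Multiset ℕ) :
    Finset (Multiset ℕ × (Fin m → Multiset ℕ)) :=
  (Finset.Iic β ×ˢ Fintype.piFinset fun _ => Finset.Iic β).filter fun p =>
    p.1 + ∑ j, p.2 j = β ∧ ∀ j, (p.2 j).sum < α j

/-!
Both formulas come from the cut-and-join recursion in genus zero, solved by Lagrange inversion.

**Cut and join.** Fix the permutation `γ` of cycle type `α`. A monodromy sequence is then a word of
transpositions multiplied onto `γ`, and `transCount` is the number of transitive words of length `r`
that lead to a permutation of cycle type `β`, divided by `r!`. Dropping the transposition next to `γ`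
leaves a word that is still transitive or has exactly two orbits; in the second case the word is a
shuffle of two transitive words on the orbits, and the division by `r!` turns the shuffles into a
product (`wordSum_shuffle`). This is the recursion `transCount_succ`, in all genera. The first
transposition cuts a cycle of `γ` or joins two of them. The Riemann-Hurwitz inequality
`transCount_eq_zero` leaves only words of minimal length on each orbit, which have the form
`l(α) + l(β) - 2`. Hence a cut occurs only with two orbits, one for each of the new cycles, and a
join only with a transitive rest. So the generating series over `β`, in variables `q_i` that mark
the parts, satisfy a closed system for `l(α) = 1, 2, 3`, and the word length is the number of parts
of `β` up to a constant, that is, the Euler derivation `countDer` in the `q_i`.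

**Solution.** With `P(w) = ∑ q_i w^i`, `Q = w P'` and `U = 1 / (1 - Q)`, let `z(x)` be the inverse of
`x = w exp(-P(w))`. The map `lagrange` is the substitution of `z(x_i)` for `w_i`, defined by Lagrange's
formula for the coefficients; it is a ring homomorphism (`lagrange_mul`), and its behaviour under
derivatives in `x_i` and in the `q_i` is `euler_lagrange` and `coeffDer_lagrange`. The generating
series over the lengths of the cycles of `γ`, divided by the product of these lengths when there is
more than one cycle, are:

* for one part, `P(z(x))`, with recursion `countDer_onePart`;
* for two parts, the series whose derivative along the total degree is `∑ U_{a+b} z₀^a z₁^b`. It is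
  `log ((z₀ - z₁) / (x₀ - x₁)) - P(z₀) - P(z₁)` (`derivation_twoPartSeries`), from which the recursion
  `coeffDer_twoPartSeries` follows;
* for three parts, `∑ U_{a+b+c} z₀^a z₁^b z₂^c`. Its recursion `coeffDer_threePartSeries` is a
  partial fractions identity (`partial_fractions`).

Since both sides start alike, `minimalCounts` identifies the series with the numbers of words.

**Reading off coefficients.** The coefficient of `q^ρ` in `U_{|ρ|}` is `l(ρ)! ∏ ρ_j / |Aut ρ|`
(`joinWeight`), and each factor `(1 - Q) E^a` with `E = exp P` in Lagrange's formula contributes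
`(a - |γ|) a^{l(γ) - 1} / |Aut γ|` (`treeWeight`). Undoing the derivative along the total degree is
what divides by `d = α₁ + α₂` in the formula for two parts. Finally there are
`d! / (∏ α_i |Aut α|)` choices of `γ` (`card_filter_partition`), which cancels the normalization of
the Hurwitz number up to the product of the parts.
-/

/-! ### Derivations of rings of power series -/

open MvPowerSeries in
/-- The Euler derivation of a ring of power series attached to an additive weight `w` on exponents:
it multiplies the coefficient of a monomial of exponent `n` by `w n`. -/
noncomputable def weightDer {σ R : Type*} [CommRing R] [Algebra ℚ R] (w : (σ →₀ ℕ) →+ ℕ) :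
    Derivation ℚ (MvPowerSeries σ R) (MvPowerSeries σ R) :=
  Derivation.mk'
    { toFun := fun F n => (w n : R) * coeff n F
      map_add' := fun F G => by
        ext n; change (_ : R) * _ = (_ : R) * _ + (_ : R) * _; simp [mul_add]
      map_smul' := fun c F => by
        ext n
        change (w n : R) * (c • coeff n F) = c • ((w n : R) * coeff n F)
        rw [mul_smul_comm] }
    fun F G => by
      classical
      ext n
      change (w n : R) * coeff n (F * G) = coeff n (F * _ + G * _)
      rw [mul_comm G, map_add, coeff_mul, coeff_mul, coeff_mul, ← Finset.sum_add_distrib,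
        Finset.mul_sum]
      refine Finset.sum_congr rfl fun p hp => ?_
      rw [← Finset.HasAntidiagonal.mem_antidiagonal.1 hp, map_add]
      change _ = _ * ((_ : R) * _) + ((_ : R) * _) * _
      push_cast
      ring

theorem coeff_weightDer {σ R : Type*} [CommRing R] [Algebra ℚ R] (w : (σ →₀ ℕ) →+ ℕ)
    (F : MvPowerSeries σ R) (n : σ →₀ ℕ) :
    MvPowerSeries.coeff n (weightDer w F) = (w n : R) * MvPowerSeries.coeff n F := rfl

open MvPowerSeries in
/-- A derivation of the coefficient ring, applied to each coefficient of a power series. -/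
noncomputable def coeffDer {σ R : Type*} [CommRing R] [Algebra ℚ R] (D : Derivation ℚ R R) :
    Derivation ℚ (MvPowerSeries σ R) (MvPowerSeries σ R) :=
  Derivation.mk'
    { toFun := fun F n => D (coeff n F)
      map_add' := fun F G => by ext n; change D _ = D _ + D _; simp
      map_smul' := fun c F => by
        ext n
        change D (c • coeff n F) = c • D (coeff n F)
        rw [D.map_smul] }
    fun F G => by
      classical
      ext n
      change D (coeff n (F * G)) = coeff n (F * _ + G * _)
      rw [mul_comm G, map_add, coeff_mul, coeff_mul, coeff_mul, ← Finset.sum_add_distrib, map_sum]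
      refine Finset.sum_congr rfl fun p hp => ?_
      rw [Derivation.leibniz]
      change _ = _ * D _ + D _ * _
      simp only [smul_eq_mul]
      ring

theorem coeff_coeffDer {σ R : Type*} [CommRing R] [Algebra ℚ R] (D : Derivation ℚ R R)
    (F : MvPowerSeries σ R) (n : σ →₀ ℕ) :
    MvPowerSeries.coeff n (coeffDer D F) = D (MvPowerSeries.coeff n F) := rfl

/-- A one-variable power series, seen as a power series in the `i`-th of several variables. -/
noncomputable def inVar {σ R : Type*} [CommRing R] (i : σ) :
    PowerSeries R →+* MvPowerSeries σ R :=
  (MvPowerSeries.rename (σ := Unit) (R := R) (fun _ => i)).toRingHom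

open Classical in
theorem coeff_inVar {σ R : Type*} [CommRing R] (i : σ) (u : PowerSeries R) (n : σ →₀ ℕ) :
    MvPowerSeries.coeff n (inVar i u) =
      if n = Finsupp.single i (n i) then PowerSeries.coeff (n i) u else 0 := by
  let e : Unit ↪ σ := ⟨fun _ => i, fun _ _ _ => rfl⟩
  have he : inVar i u = MvPowerSeries.rename e u := rfl
  have hs : ∀ k : ℕ, Finsupp.embDomain e (Finsupp.single () k) = Finsupp.single i k := fun k => by
    rw [Finsupp.embDomain_single]; rfl
  rw [he]
  split_ifs with h
  · rw [h, ← hs, MvPowerSeries.coeff_embDomain_rename]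
    simp [PowerSeries.coeff, hs]
  · refine MvPowerSeries.coeff_rename_eq_zero _ _ ?_
    rintro ⟨y, hy⟩
    apply h
    rw [← hy, ← Finsupp.embDomain_eq_mapDomain]
    obtain ⟨k, rfl⟩ : ∃ k, y = Finsupp.single () k := ⟨y (), by ext; simp⟩
    rw [hs]; simp

theorem coeff_single_inVar {σ R : Type*} [CommRing R] (i : σ) (u : PowerSeries R) (k : ℕ) :
    MvPowerSeries.coeff (Finsupp.single i k) (inVar i u) = PowerSeries.coeff k u := by
  classical
  rw [coeff_inVar]; simp

theorem coeff_inVar_of_ne {σ R : Type*} [CommRing R] {i j : σ} (hij : j ≠ i) (u : PowerSeries R)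
    {n : σ →₀ ℕ} (hn : n j ≠ 0) : MvPowerSeries.coeff n (inVar i u) = 0 := by
  classical
  rw [coeff_inVar, if_neg]
  intro h
  rw [h] at hn
  simp [hij.symm] at hn

/-- The Euler operator `x_i ∂/∂x_i`. -/
noncomputable def euler {σ : Type*} (R : Type*) [CommRing R] [Algebra ℚ R] (i : σ) :
    Derivation ℚ (MvPowerSeries σ R) (MvPowerSeries σ R) :=
  weightDer (Finsupp.applyAddHom i)

theorem coeff_euler {σ R : Type*} [CommRing R] [Algebra ℚ R] (i : σ) (F : MvPowerSeries σ R) (n : σ →₀ ℕ) :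
    MvPowerSeries.coeff n (euler R i F) = (n i : R) * MvPowerSeries.coeff n F := rfl

theorem euler_inVar_of_ne {σ R : Type*} [CommRing R] [Algebra ℚ R] {i j : σ} (hij : j ≠ i) (u : PowerSeries R) :
    euler R j (inVar i u) = 0 := by
  ext n
  rw [coeff_euler]
  by_cases h : n j = 0
  · simp [h]
  · rw [coeff_inVar_of_ne hij u h]; simp

theorem euler_inVar_self {σ R : Type*} [CommRing R] [Algebra ℚ R] (i : σ) {u v : PowerSeries R}
    (h : ∀ k, PowerSeries.coeff k v = k * PowerSeries.coeff k u) :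
    euler R i (inVar i u) = inVar i v := by
  classical
  ext n
  rw [coeff_euler, coeff_inVar, coeff_inVar]
  split_ifs
  · rw [h]
  · simp

theorem coeffDer_inVar {σ R : Type*} [CommRing R] [Algebra ℚ R] (D : Derivation ℚ R R) (i : σ)
    {u v : PowerSeries R} (h : ∀ k, PowerSeries.coeff k v = D (PowerSeries.coeff k u)) :
    coeffDer D (inVar i u) = inVar i v := by
  classical
  ext n
  rw [coeff_coeffDer, coeff_inVar, coeff_inVar]
  split_ifs
  · rw [h]
  · simp

theorem inVar_X {σ R : Type*} [CommRing R] (i : σ) :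
    inVar i (PowerSeries.X : PowerSeries R) = MvPowerSeries.X i :=
  MvPowerSeries.rename_X _ _

theorem euler_X_self {σ R : Type*} [CommRing R] [Algebra ℚ R] (i : σ) :
    euler R i (MvPowerSeries.X i) = MvPowerSeries.X i := by
  rw [← inVar_X]
  refine euler_inVar_self i fun k => ?_
  rw [PowerSeries.coeff_X]
  split_ifs with h <;> simp [h]

theorem euler_X_of_ne {σ R : Type*} [CommRing R] [Algebra ℚ R] {i j : σ} (hij : j ≠ i) :
    euler R j (MvPowerSeries.X i) = 0 := by
  rw [← inVar_X, euler_inVar_of_ne hij]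

theorem coeffDer_X {σ R : Type*} [CommRing R] [Algebra ℚ R] (D : Derivation ℚ R R) (i : σ) :
    coeffDer D (MvPowerSeries.X i : MvPowerSeries σ R) = 0 := by
  rw [← inVar_X, ← map_zero (inVar i)]
  refine coeffDer_inVar D i fun k => ?_
  rw [PowerSeries.coeff_X]
  split_ifs <;> simp

/-! ### Generating series over partitions -/

/-- The coefficient ring: power series in variables `q_i`, where the monomial `q^β` records a
multiset `β` of parts. -/
abbrev PartRing : Type := MvPowerSeries ℕ ℚ

/-- The sum of the parts of the multiset with `β i` parts equal to `i`. -/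
noncomputable def partSum : (ℕ →₀ ℕ) →+ ℕ := Finsupp.weight fun i : ℕ => i

/-- The number of parts, as an additive weight. -/
noncomputable def partCount : (ℕ →₀ ℕ) →+ ℕ :=
  { toFun := Finsupp.degree, map_zero' := by simp, map_add' := fun a b => by simp }

/-- `∏ i, (β i)!`, the order of the automorphism group of the multiset encoded by `β`. -/
noncomputable def multFactorial (β : ℕ →₀ ℕ) : ℕ := β.prod fun _ c => c.factorial

/-- The product of the parts of the multiset encoded by `β`. -/
noncomputable def partProd (β : ℕ →₀ ℕ) : ℕ := β.prod fun i c => i ^ c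

theorem partCount_eq_sum (β : ℕ →₀ ℕ) : partCount β = ∑ i ∈ β.support, β i := rfl

theorem partSum_eq_sum (β : ℕ →₀ ℕ) : partSum β = ∑ i ∈ β.support, β i * i := by
  simp [partSum, Finsupp.weight_apply, Finsupp.sum]

@[simp] theorem partSum_single (i c : ℕ) : partSum (Finsupp.single i c) = c * i := by
  simp [partSum, Finsupp.weight_apply]

@[simp] theorem partCount_single (i c : ℕ) : partCount (Finsupp.single i c) = c := by
  simp [partCount]

theorem partCount_eq_zero {β : ℕ →₀ ℕ} : partCount β = 0 ↔ β = 0 :=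
  Finsupp.degree_eq_zero_iff β

theorem sub_single_add {β : ℕ →₀ ℕ} {i : ℕ} (hi : i ∈ β.support) :
    β - Finsupp.single i 1 + Finsupp.single i 1 = β :=
  tsub_add_cancel_of_le (Finsupp.single_le_iff.2 (Nat.one_le_iff_ne_zero.2
    (Finsupp.mem_support_iff.1 hi)))

theorem partSum_sub_single {β : ℕ →₀ ℕ} {i : ℕ} (hi : i ∈ β.support) :
    partSum (β - Finsupp.single i 1) + i = partSum β := by
  conv_rhs => rw [← sub_single_add hi, map_add]
  simp

theorem partCount_sub_single {β : ℕ →₀ ℕ} {i : ℕ} (hi : i ∈ β.support) :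
    partCount (β - Finsupp.single i 1) + 1 = partCount β := by
  conv_rhs => rw [← sub_single_add hi, map_add]
  simp

theorem multFactorial_sub_single {β : ℕ →₀ ℕ} {i : ℕ} (hi : i ∈ β.support) :
    β i * multFactorial (β - Finsupp.single i 1) = multFactorial β := by
  unfold multFactorial
  rw [← Finsupp.mul_prod_erase' β i _ (fun _ => rfl),
    ← Finsupp.mul_prod_erase' (β - Finsupp.single i 1) i _ (fun _ => rfl)]
  have h1 : (β - Finsupp.single i 1).erase i = β.erase i := by
    ext j
    by_cases h : j = i
    · simp [h]
    · simp [Finsupp.erase_ne h, h]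
  rw [h1, ← mul_assoc]
  congr 1
  have : β i ≠ 0 := Finsupp.mem_support_iff.1 hi
  simp only [Finsupp.coe_tsub, Pi.sub_apply, Finsupp.single_eq_same]
  exact Nat.mul_factorial_pred this

theorem partProd_sub_single {β : ℕ →₀ ℕ} {i : ℕ} (hi : i ∈ β.support) :
    i * partProd (β - Finsupp.single i 1) = partProd β := by
  unfold partProd
  conv_rhs => rw [← sub_single_add hi]
  rw [Finsupp.prod_add_index' (by simp) (fun _ _ _ => pow_add _ _ _)]
  simp [mul_comm]

theorem multFactorial_ne_zero (β : ℕ →₀ ℕ) : (multFactorial β : ℚ) ≠ 0 := by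
  unfold multFactorial Finsupp.prod
  exact_mod_cast (Finset.prod_pos fun i _ => Nat.factorial_pos _).ne'

/-- `∑ s(β) q^β w^|β|`, summed over the multisets `β` of positive parts. -/
noncomputable def gradedSeries (s : (ℕ →₀ ℕ) → ℚ) : PowerSeries PartRing :=
  PowerSeries.mk fun k => show PartRing from
    fun β : ℕ →₀ ℕ => if partSum β = k ∧ β 0 = 0 then s β else 0

/-- `∑_{i ≥ 1} c(i) q_i w^i`. -/
noncomputable def linearSeries (c : ℕ → ℚ) : PowerSeries PartRing :=
  PowerSeries.mk fun k => if k = 0 then 0 else MvPowerSeries.monomial (Finsupp.single k 1) (c k)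

theorem coeff_gradedSeries (s : (ℕ →₀ ℕ) → ℚ) (k : ℕ) (β : ℕ →₀ ℕ) :
    MvPowerSeries.coeff β (PowerSeries.coeff k (gradedSeries s)) =
      if partSum β = k ∧ β 0 = 0 then s β else 0 := by
  change MvPowerSeries.coeff β (PowerSeries.coeff k (PowerSeries.mk _)) = _
  rw [PowerSeries.coeff_mk]
  rfl

theorem coeff_linearSeries_mul (c : ℕ → ℚ) (F : PowerSeries PartRing) (k : ℕ) (β : ℕ →₀ ℕ) :
    MvPowerSeries.coeff β (PowerSeries.coeff k (linearSeries c * F)) =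
      ∑ i ∈ Finset.range (k + 1), if i ≠ 0 ∧ i ∈ β.support then
        c i * MvPowerSeries.coeff (β - Finsupp.single i 1) (PowerSeries.coeff (k - i) F) else 0 := by
  rw [PowerSeries.coeff_mul, map_sum, Finset.Nat.sum_antidiagonal_eq_sum_range_succ_mk]
  refine Finset.sum_congr rfl fun i _ => ?_
  rw [linearSeries, PowerSeries.coeff_mk]
  by_cases h0 : i = 0
  · simp [h0]
  · rw [if_neg h0, MvPowerSeries.coeff_monomial_mul]
    simp [h0, Finsupp.single_le_iff, Nat.one_le_iff_ne_zero]

theorem linearSeries_mul_gradedSeries (c : ℕ → ℚ) (s : (ℕ →₀ ℕ) → ℚ) :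
    linearSeries c * gradedSeries s =
      gradedSeries fun β => ∑ i ∈ β.support, c i * s (β - Finsupp.single i 1) := by
  refine PowerSeries.ext fun k => MvPowerSeries.ext fun β => ?_
  rw [coeff_linearSeries_mul, coeff_gradedSeries]
  simp only [coeff_gradedSeries]
  have key : ∀ i ∈ Finset.range (k + 1), (if i ≠ 0 ∧ i ∈ β.support then
      c i * (if partSum (β - Finsupp.single i 1) = k - i ∧ (β - Finsupp.single i 1 : ℕ →₀ ℕ) 0 = 0 then
        s (β - Finsupp.single i 1) else 0) else 0) =
      if partSum β = k ∧ β 0 = 0 then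
        (if i ∈ β.support then c i * s (β - Finsupp.single i 1) else 0) else 0 := by
    intro i hi
    rw [Finset.mem_range] at hi
    by_cases hs : i ∈ β.support
    · have h1 := partSum_sub_single hs
      by_cases h0 : i = 0
      · subst h0
        simp [Finsupp.mem_support_iff.1 hs]
      · have h2 : (β - Finsupp.single i 1 : ℕ →₀ ℕ) 0 = β 0 := by simp [h0]
        have h3 : partSum (β - Finsupp.single i 1) = k - i ↔ partSum β = k := by omega
        simp only [h2, h3, ne_eq, h0, not_false_eq_true, hs, and_self, if_true, mul_ite, mul_zero]
    · simp [hs]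
  rw [Finset.sum_congr rfl key]
  split_ifs with h
  · rw [← Finset.sum_filter]
    refine Finset.sum_congr ?_ fun _ _ => rfl
    ext i
    simp only [Finset.mem_filter, Finset.mem_range, and_iff_right_iff_imp]
    intro hi
    have := partSum_sub_single hi
    omega
  · simp

/-- The Euler derivation of the coefficient ring, which counts parts. -/
noncomputable def countDer : Derivation ℚ PartRing PartRing := weightDer partCount

/-- `P(w) = ∑ q_i w^i`. -/
noncomputable def serP : PowerSeries PartRing := linearSeries fun _ => 1

/-- `Q(w) = w P'(w) = ∑ i q_i w^i`. -/
noncomputable def serQ : PowerSeries PartRing := linearSeries fun i => i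

/-- `E(w) = exp P(w)`, given by its coefficients. -/
noncomputable def serE : PowerSeries PartRing := gradedSeries fun β => 1 / multFactorial β

/-- `U(w) = 1 / (1 - Q(w))`, given by its coefficients. -/
noncomputable def serU : PowerSeries PartRing :=
  gradedSeries fun β => (partCount β).factorial * partProd β / multFactorial β

theorem coeff_serQ (k : ℕ) :
    PowerSeries.coeff k serQ = k * PowerSeries.coeff k serP := by
  unfold serQ serP linearSeries
  rw [PowerSeries.coeff_mk, PowerSeries.coeff_mk]
  split_ifs with h
  · simp
  · ext β
    rw [← nsmul_eq_mul, map_nsmul, MvPowerSeries.coeff_monomial, MvPowerSeries.coeff_monomial]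
    split_ifs <;> simp

theorem countDer_coeff_linearSeries (c : ℕ → ℚ) (k : ℕ) :
    countDer (PowerSeries.coeff k (linearSeries c)) = PowerSeries.coeff k (linearSeries c) := by
  unfold linearSeries
  rw [PowerSeries.coeff_mk]
  split_ifs with h
  · simp
  · ext β
    rw [countDer, coeff_weightDer, MvPowerSeries.coeff_monomial]
    split_ifs with h
    · simp [h]
    · simp

theorem one_div_multFactorial_sub_single {β : ℕ →₀ ℕ} {i : ℕ} (hi : i ∈ β.support) :
    (1 : ℚ) / multFactorial (β - Finsupp.single i 1) = β i / multFactorial β := by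
  have h := multFactorial_sub_single hi
  have h1 := multFactorial_ne_zero β
  have h2 := multFactorial_ne_zero (β - Finsupp.single i 1)
  field_simp
  rw [← h]
  push_cast
  ring

theorem coeff_serQ_mul_serE (k : ℕ) :
    PowerSeries.coeff k (serQ * serE) = k * PowerSeries.coeff k serE := by
  ext β
  rw [serQ, serE, linearSeries_mul_gradedSeries, coeff_gradedSeries, ← nsmul_eq_mul, map_nsmul,
    coeff_gradedSeries]
  split_ifs with h
  · rw [Finset.sum_congr rfl fun i hi => by rw [one_div_multFactorial_sub_single hi], ← h.1,
      partSum_eq_sum, nsmul_eq_mul, Nat.cast_sum, Finset.sum_mul]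
    refine Finset.sum_congr rfl fun i _ => ?_
    push_cast
    ring
  · simp

theorem countDer_coeff_gradedSeries_pow (a : ℕ) (k : ℕ) :
    countDer (PowerSeries.coeff k (gradedSeries fun β => (a : ℚ) ^ partCount β / multFactorial β)) =
      a * PowerSeries.coeff k
        (serP * gradedSeries fun β => (a : ℚ) ^ partCount β / multFactorial β) := by
  ext β
  rw [serP, linearSeries_mul_gradedSeries, ← nsmul_eq_mul, map_nsmul, coeff_gradedSeries, countDer,
    coeff_weightDer, coeff_gradedSeries]
  split_ifs with h
  · rw [Finset.sum_congr rfl fun i hi => show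
      1 * ((a : ℚ) ^ partCount (β - Finsupp.single i 1) / multFactorial (β - Finsupp.single i 1)) =
        β i * ((a : ℚ) ^ (partCount β - 1) / multFactorial β) by
      rw [div_eq_mul_one_div _ (multFactorial (β - Finsupp.single i 1) : ℚ),
        one_div_multFactorial_sub_single hi, ← partCount_sub_single hi]
      simp only [Nat.add_sub_cancel]
      ring, ← Finset.sum_mul, ← Nat.cast_sum, ← partCount_eq_sum, nsmul_eq_mul]
    cases hc : partCount β with
    | zero => simp
    | succ c => simp only [Nat.add_sub_cancel]; ring
  · simp

theorem countDer_coeff_serE (k : ℕ) :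
    countDer (PowerSeries.coeff k serE) = PowerSeries.coeff k (serP * serE) := by
  have := countDer_coeff_gradedSeries_pow 1 k
  simpa [serE] using this

theorem serU_mul_one_sub_serQ : serU * (1 - serQ) = 1 := by
  have h : serU = 1 + serQ * serU := by
    refine PowerSeries.ext fun k => MvPowerSeries.ext fun β => ?_
    rw [map_add, map_add, serQ, serU, linearSeries_mul_gradedSeries, coeff_gradedSeries,
      coeff_gradedSeries, PowerSeries.coeff_one]
    by_cases hβ : β = 0
    · subst hβ
      by_cases hk : k = 0 <;> simp [hk, multFactorial, partProd, eq_comm]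
    · have h1 : MvPowerSeries.coeff β (if k = 0 then (1 : PartRing) else 0) = 0 := by
        split_ifs
        · rw [MvPowerSeries.coeff_one, if_neg hβ]
        · simp
      rw [h1, zero_add]
      split_ifs with h
      · rw [Finset.sum_congr rfl fun (i : ℕ) hi => show (i : ℚ) *
          ((partCount (β - Finsupp.single i 1)).factorial * partProd (β - Finsupp.single i 1) /
            multFactorial (β - Finsupp.single i 1)) =
          β i * ((partCount β - 1).factorial * partProd β / multFactorial β) by
          rw [div_eq_mul_one_div _ (multFactorial (β - Finsupp.single i 1) : ℚ),
            one_div_multFactorial_sub_single hi, ← partCount_sub_single hi,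
            ← partProd_sub_single hi]
          simp only [Nat.add_sub_cancel]
          push_cast
          ring, ← Finset.sum_mul, ← Nat.cast_sum, ← partCount_eq_sum,
          ← Nat.mul_factorial_pred (mt partCount_eq_zero.1 hβ)]
        push_cast
        ring
      · rfl
  rw [mul_sub, mul_one, mul_comm serU serQ]
  linear_combination h

/-- The equation `N Y = a P Y` determines the series `Y` from its terms of degree zero in the
variables `q_i`. -/
theorem eq_zero_of_countDer_eq {a : ℕ} {Y : PowerSeries PartRing}
    (hY : ∀ k, countDer (PowerSeries.coeff k Y) = a * PowerSeries.coeff k (serP * Y))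
    (h0 : ∀ k, MvPowerSeries.coeff 0 (PowerSeries.coeff k Y) = 0) : Y = 0 := by
  suffices h : ∀ c k (β : ℕ →₀ ℕ), partCount β = c →
      MvPowerSeries.coeff β (PowerSeries.coeff k Y) = 0 from
    PowerSeries.ext fun k => MvPowerSeries.ext fun β => by simpa using h _ k β rfl
  intro c
  induction c with
  | zero =>
    intro k β hβ
    rw [partCount_eq_zero.1 hβ, h0]
  | succ c ih =>
    intro k β hβ
    have h1 := congrArg (MvPowerSeries.coeff β) (hY k)
    rw [countDer, coeff_weightDer, ← nsmul_eq_mul (a : ℕ), map_nsmul, serP,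
      coeff_linearSeries_mul, Finset.sum_eq_zero, smul_zero, hβ] at h1
    · have h2 : ((c + 1 : ℕ) : ℚ) ≠ 0 := by positivity
      exact (mul_eq_zero.1 h1).resolve_left h2
    · intro i _
      split_ifs with hi
      · rw [ih, mul_zero]
        have := partCount_sub_single hi.2
        omega
      · rfl

/-- `E^a = exp (a P)`, since both sides satisfy `N Y = a P Y`. -/
theorem serE_pow (a : ℕ) :
    serE ^ a = gradedSeries fun β => (a : ℚ) ^ partCount β / multFactorial β := by
  rw [← sub_eq_zero]
  refine eq_zero_of_countDer_eq (a := a) (fun k => ?_) fun k => ?_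
  · have h1 : countDer (PowerSeries.coeff k (serE ^ a)) =
        a * PowerSeries.coeff k (serP * serE ^ a) := by
      have hD : coeffDer (σ := Unit) countDer serE = serP * serE := by
        refine PowerSeries.ext fun k => ?_
        rw [← countDer_coeff_serE]
        rfl
      have h2 := Derivation.leibniz_pow (coeffDer (σ := Unit) countDer) serE a
      rw [hD] at h2
      have h3 := congrArg (PowerSeries.coeff k) h2
      change countDer (PowerSeries.coeff k (serE ^ a)) = _ at h3
      rw [h3, map_nsmul, nsmul_eq_mul]
      cases a with
      | zero => simp
      | succ a =>
        congr 2
        change serE ^ a * (serP * serE) = _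
        rw [pow_succ]
        ring
    rw [map_sub, map_sub, h1, countDer_coeff_gradedSeries_pow, mul_sub, map_sub, mul_sub]
  · rw [map_sub, map_sub, coeff_gradedSeries]
    have h1 : PowerSeries.map (MvPowerSeries.constantCoeff (σ := ℕ) (R := ℚ)) serE = 1 := by
      refine PowerSeries.ext fun k => ?_
      rw [PowerSeries.coeff_map, ← MvPowerSeries.coeff_zero_eq_constantCoeff_apply, serE,
        coeff_gradedSeries, PowerSeries.coeff_one]
      simp [multFactorial, eq_comm]
    have h2 := congrArg (PowerSeries.coeff k) (congrArg (· ^ a) h1)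
    simp only [← map_pow] at h2
    rw [PowerSeries.coeff_map, ← MvPowerSeries.coeff_zero_eq_constantCoeff_apply] at h2
    rw [h2, one_pow, PowerSeries.coeff_one]
    simp [multFactorial, partCount, eq_comm]

theorem coeff_zero_serE : PowerSeries.coeff 0 serE = 1 := by
  ext β
  rw [serE, coeff_gradedSeries, MvPowerSeries.coeff_one]
  have : (partSum β = 0 ∧ β 0 = 0) ↔ β = 0 := by
    constructor
    · rintro ⟨h1, h2⟩
      ext i
      by_contra h
      have hi : i ∈ β.support := Finsupp.mem_support_iff.2 h
      have h3 := partSum_sub_single hi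
      have : i = 0 := by omega
      exact h (this ▸ h2)
    · rintro rfl; simp
  simp only [this]
  split_ifs with h
  · simp [h, multFactorial]
  · rfl

theorem coeff_zero_serP : PowerSeries.coeff 0 serP = 0 := by
  rw [serP, linearSeries, PowerSeries.coeff_mk, if_pos rfl]

theorem coeff_zero_serQ : PowerSeries.coeff 0 serQ = 0 := by
  rw [serQ, linearSeries, PowerSeries.coeff_mk, if_pos rfl]

theorem constantCoeff_serP : PowerSeries.constantCoeff serP = 0 := by
  rw [← PowerSeries.coeff_zero_eq_constantCoeff_apply, coeff_zero_serP]

theorem constantCoeff_serQ : PowerSeries.constantCoeff serQ = 0 := by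
  rw [← PowerSeries.coeff_zero_eq_constantCoeff_apply, coeff_zero_serQ]

theorem constantCoeff_serE : PowerSeries.constantCoeff serE = 1 := by
  rw [← PowerSeries.coeff_zero_eq_constantCoeff_apply, coeff_zero_serE]

/-! ### The Lagrange transform in several variables -/

instance : CharZero PartRing := algebraRat.charZero _

section Lagrange

variable {σ : Type*}

theorem inVar_serU_mul (i : σ) : inVar i serU * (1 - inVar i serQ) = 1 := by
  rw [← map_one (inVar i), ← map_sub, ← map_mul, serU_mul_one_sub_serQ]

theorem euler_inVar_serE (i : σ) :
    euler PartRing i (inVar i serE) = inVar i serQ * inVar i serE := by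
  rw [← map_mul]
  exact euler_inVar_self i coeff_serQ_mul_serE

theorem coeffDer_inVar_serE (i : σ) :
    coeffDer countDer (inVar i serE) = inVar i serP * inVar i serE := by
  rw [← map_mul]
  exact coeffDer_inVar _ i fun k => (countDer_coeff_serE k).symm

theorem coeffDer_inVar_serP (i : σ) : coeffDer countDer (inVar i serP) = inVar i serP :=
  coeffDer_inVar _ i fun k => (countDer_coeff_linearSeries _ k).symm

theorem coeffDer_inVar_serQ (i : σ) : coeffDer countDer (inVar i serQ) = inVar i serQ :=
  coeffDer_inVar _ i fun k => (countDer_coeff_linearSeries _ k).symm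

theorem euler_inVar_serP (i : σ) : euler PartRing i (inVar i serP) = inVar i serQ :=
  euler_inVar_self i coeff_serQ

theorem coeffDer_inVar_serU (i : σ) :
    coeffDer countDer (inVar i serU) = inVar i serQ * inVar i serU ^ 2 := by
  have h := congrArg (coeffDer countDer) (inVar_serU_mul i)
  rw [Derivation.leibniz, map_sub, Derivation.map_one_eq_zero, coeffDer_inVar_serQ] at h
  simp only [smul_eq_mul] at h
  linear_combination inVar i serU * h - coeffDer countDer (inVar i serU) * inVar_serU_mul i

theorem derivation_pow_of_eq {A : Type*} [CommRing A] [Algebra ℚ A] (D : Derivation ℚ A A) {e q : A}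
    (h : D e = q * e) (k : ℕ) : D (e ^ k) = k * q * e ^ k := by
  induction k with
  | zero => simp
  | succ k ih =>
    rw [pow_succ, Derivation.leibniz, ih, h, smul_eq_mul, smul_eq_mul]
    push_cast
    ring

theorem derivation_prod {A ι : Type*} [CommRing A] [Algebra ℚ A] [DecidableEq ι]
    (D : Derivation ℚ A A) (s : Finset ι) (f : ι → A) :
    D (∏ i ∈ s, f i) = ∑ i ∈ s, (∏ j ∈ s.erase i, f j) * D (f i) := by
  induction s using Finset.induction_on with
  | empty => simp
  | insert a s ha ih =>
    rw [Finset.prod_insert ha, Derivation.leibniz, ih, Finset.sum_insert ha,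
      Finset.erase_insert ha, smul_eq_mul, smul_eq_mul, add_comm, Finset.mul_sum]
    congr 1
    refine Finset.sum_congr rfl fun i hi => ?_
    have hia : a ≠ i := fun h => ha (h ▸ hi)
    rw [Finset.erase_insert_of_ne hia, Finset.prod_insert (fun h => ha (Finset.mem_of_mem_erase h)),
      mul_assoc]

theorem derivation_prod_eq_zero {A ι : Type*} [CommRing A] [Algebra ℚ A] (D : Derivation ℚ A A)
    (s : Finset ι) (f : ι → A) (h : ∀ i ∈ s, D (f i) = 0) : D (∏ i ∈ s, f i) = 0 := by
  classical
  rw [derivation_prod, Finset.sum_eq_zero]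
  intro i hi
  rw [h i hi, mul_zero]

theorem coeff_natCast_mul (k : ℕ) (F : MvPowerSeries σ PartRing) (n : σ →₀ ℕ) :
    MvPowerSeries.coeff n ((k : MvPowerSeries σ PartRing) * F) = k * MvPowerSeries.coeff n F := by
  rw [← nsmul_eq_mul, map_nsmul, nsmul_eq_mul]

theorem constantCoeff_inVar (i : σ) (u : PowerSeries PartRing) :
    MvPowerSeries.constantCoeff (inVar i u) = PowerSeries.coeff 0 u := by
  rw [← MvPowerSeries.coeff_zero_eq_constantCoeff_apply, ← coeff_single_inVar i u 0]
  simp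

variable [Fintype σ]

/-- The kernel `∏ᵢ (1 - Q(wᵢ)) E(wᵢ)^{nᵢ}` of the Lagrange transform. -/
noncomputable def lagrangeKernel (n : σ →₀ ℕ) : MvPowerSeries σ PartRing :=
  ∏ i, inVar i ((1 - serQ) * serE ^ n i)

/-- The coefficients of the Lagrange transform. -/
noncomputable def lagrangeFun (G : MvPowerSeries σ PartRing) : MvPowerSeries σ PartRing :=
  fun n : σ →₀ ℕ => MvPowerSeries.coeff n (G * lagrangeKernel n)

theorem coeff_lagrangeFun (G : MvPowerSeries σ PartRing) (n : σ →₀ ℕ) :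
    MvPowerSeries.coeff n (lagrangeFun G) = MvPowerSeries.coeff n (G * lagrangeKernel n) := by
  rw [MvPowerSeries.coeff_apply, lagrangeFun]

/-- The substitution `G(w) ↦ G(z(x))` in each variable, where `z(x)` is the compositional inverse of
`x = w exp(-P(w))`. The definition is the formula of the Lagrange inversion theorem for the
coefficients; that it is a ring homomorphism is `lagrange_mul`. -/
noncomputable def lagrange : MvPowerSeries σ PartRing →ₗ[PartRing] MvPowerSeries σ PartRing where
  toFun := lagrangeFun
  map_add' F G := by
    ext1 n
    rw [map_add, coeff_lagrangeFun, coeff_lagrangeFun, coeff_lagrangeFun, add_mul, map_add]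
  map_smul' c F := by
    ext1 n
    rw [RingHom.id_apply, MvPowerSeries.coeff_smul, coeff_lagrangeFun, coeff_lagrangeFun,
      smul_mul_assoc, MvPowerSeries.coeff_smul]

theorem coeff_lagrange (G : MvPowerSeries σ PartRing) (n : σ →₀ ℕ) :
    MvPowerSeries.coeff n (lagrange G) = MvPowerSeries.coeff n (G * lagrangeKernel n) :=
  coeff_lagrangeFun G n

open Classical in
/-- The kernel with the factor `1 - Q(wᵢ)` left out. It satisfies
`wᵢ ∂/∂wᵢ K = nᵢ Q(wᵢ) K`, which makes an Euler derivative under the transform computable. -/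
noncomputable def lagrangeCofactor (i : σ) (n : σ →₀ ℕ) : MvPowerSeries σ PartRing :=
  inVar i serE ^ n i * ∏ j ∈ Finset.univ.erase i, inVar j ((1 - serQ) * serE ^ n j)

theorem lagrangeKernel_eq (i : σ) (n : σ →₀ ℕ) :
    lagrangeKernel n = (1 - inVar i serQ) * lagrangeCofactor i n := by
  classical
  rw [lagrangeKernel, ← Finset.mul_prod_erase _ _ (Finset.mem_univ i), lagrangeCofactor,
    map_mul, map_sub, map_one, map_pow, mul_assoc]

theorem inVar_serU_mul_lagrangeKernel (i : σ) (n : σ →₀ ℕ) :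
    inVar i serU * lagrangeKernel n = lagrangeCofactor i n := by
  rw [lagrangeKernel_eq i, ← mul_assoc, inVar_serU_mul, one_mul]

theorem euler_lagrangeCofactor (i : σ) (n : σ →₀ ℕ) :
    euler PartRing i (lagrangeCofactor i n) = n i * inVar i serQ * lagrangeCofactor i n := by
  classical
  rw [lagrangeCofactor, Derivation.leibniz,
    derivation_pow_of_eq _ (euler_inVar_serE i), derivation_prod_eq_zero]
  · simp only [smul_eq_mul]; ring
  · intro j hj
    exact euler_inVar_of_ne (Finset.ne_of_mem_erase hj).symm _

/-- The chain rule for the substitution: `x d/dx = U(w) w d/dw`. -/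
theorem euler_lagrange (i : σ) (G : MvPowerSeries σ PartRing) :
    euler PartRing i (lagrange G) = lagrange (inVar i serU * euler PartRing i G) := by
  ext1 n
  rw [coeff_euler, coeff_lagrange, coeff_lagrange]
  have h1 : inVar i serU * euler PartRing i G * lagrangeKernel n =
      euler PartRing i G * lagrangeCofactor i n := by
    rw [← inVar_serU_mul_lagrangeKernel i n]; ring
  have h2 : MvPowerSeries.coeff n (euler PartRing i (G * lagrangeCofactor i n)) =
      n i * MvPowerSeries.coeff n (G * lagrangeCofactor i n) := coeff_euler _ _ _
  rw [Derivation.leibniz, euler_lagrangeCofactor, smul_eq_mul, smul_eq_mul,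
    show G * (n i * inVar i serQ * lagrangeCofactor i n) + lagrangeCofactor i n *
      euler PartRing i G = ((n i : ℕ) : MvPowerSeries σ PartRing) * (G * inVar i serQ * lagrangeCofactor i n) +
      euler PartRing i G * lagrangeCofactor i n by ring, map_add, coeff_natCast_mul] at h2
  rw [h1, lagrangeKernel_eq i, show G * ((1 - inVar i serQ) * lagrangeCofactor i n) =
    G * lagrangeCofactor i n - G * inVar i serQ * lagrangeCofactor i n by ring, map_sub]
  linear_combination -h2

theorem coeff_zero_lagrange (G : MvPowerSeries σ PartRing) :
    MvPowerSeries.coeff 0 (lagrange G) = MvPowerSeries.coeff 0 G := by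
  rw [coeff_lagrange, MvPowerSeries.coeff_zero_eq_constantCoeff_apply, map_mul, lagrangeKernel,
    map_prod, Finset.prod_eq_one, mul_one, MvPowerSeries.coeff_zero_eq_constantCoeff_apply]
  intro i _
  rw [constantCoeff_inVar, Finsupp.coe_zero, Pi.zero_apply, pow_zero, mul_one, map_sub,
    coeff_zero_serQ]
  simp

theorem lagrange_one : lagrange (1 : MvPowerSeries σ PartRing) = 1 := by
  classical
  ext1 n
  by_cases hn : n = 0
  · rw [hn, coeff_zero_lagrange]
  · obtain ⟨i, hi⟩ : ∃ i, n i ≠ 0 := by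
      by_contra! h
      exact hn (Finsupp.ext h)
    have h := congrArg (MvPowerSeries.coeff n) (euler_lagrange i (1 : MvPowerSeries σ PartRing))
    rw [Derivation.map_one_eq_zero, mul_zero, map_zero, map_zero, coeff_euler] at h
    rw [MvPowerSeries.coeff_one, if_neg hn]
    exact (mul_eq_zero.1 h).resolve_left (Nat.cast_ne_zero.2 hi)

theorem lagrangeKernel_single_add (i : σ) (n : σ →₀ ℕ) :
    lagrangeKernel (Finsupp.single i 1 + n) = inVar i serE * lagrangeKernel n := by
  classical
  rw [lagrangeKernel, lagrangeKernel, ← Finset.mul_prod_erase _ _ (Finset.mem_univ i),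
    ← Finset.mul_prod_erase _ (fun j => inVar j ((1 - serQ) * serE ^ n j)) (Finset.mem_univ i)]
  rw [Finset.prod_congr rfl fun j hj => show inVar j ((1 - serQ) *
    serE ^ (Finsupp.single i 1 + n : σ →₀ ℕ) j) = inVar j ((1 - serQ) * serE ^ n j) by
      simp [Finset.ne_of_mem_erase hj]]
  rw [← mul_assoc, ← map_mul]
  congr 2
  simp [pow_add]
  ring

theorem lagrange_X_mul (i : σ) (H : MvPowerSeries σ PartRing) :
    lagrange (MvPowerSeries.X i * H) = MvPowerSeries.X i * lagrange (inVar i serE * H) := by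
  classical
  ext1 n
  rw [coeff_lagrange, mul_assoc, MvPowerSeries.X_def, MvPowerSeries.coeff_monomial_mul,
    MvPowerSeries.coeff_monomial_mul]
  split_ifs with h
  · obtain ⟨m, rfl⟩ := exists_add_of_le h
    rw [add_tsub_cancel_left, coeff_lagrange, lagrangeKernel_single_add]
    congr 2
    ring
  · rfl

theorem exists_eq_C_add_sum_X_mul (F : MvPowerSeries σ PartRing) :
    ∃ G : σ → MvPowerSeries σ PartRing,
      F = MvPowerSeries.C (MvPowerSeries.coeff 0 F) + ∑ i, MvPowerSeries.X i * G i := by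
  classical
  let H : σ → MvPowerSeries σ PartRing := fun i => fun n : σ →₀ ℕ =>
    if ∃ h : n.support.Nonempty, h.choose = i then MvPowerSeries.coeff n F else 0
  have hH : ∀ i n, MvPowerSeries.coeff n (H i) =
    if ∃ h : n.support.Nonempty, h.choose = i then MvPowerSeries.coeff n F else 0 :=
    fun _ _ => rfl
  have hd : ∀ i, MvPowerSeries.X i ∣ H i := fun i => by
    rw [MvPowerSeries.X_dvd_iff]
    intro n hn
    rw [hH, if_neg]
    rintro ⟨h, rfl⟩
    exact Finsupp.mem_support_iff.1 h.choose_spec hn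
  choose G hG using hd
  refine ⟨G, ?_⟩
  simp only [← hG]
  ext1 n
  rw [map_add, map_sum, MvPowerSeries.coeff_C]
  simp only [hH]
  by_cases hn : n = 0
  · subst hn
    simp
  · have h : n.support.Nonempty := Finsupp.support_nonempty_iff.2 hn
    rw [if_neg hn, zero_add, Finset.sum_eq_single h.choose]
    · rw [if_pos ⟨h, rfl⟩]
    · intro i _ hi
      rw [if_neg]
      rintro ⟨_, h'⟩
      exact hi h'.symm
    · simp

theorem lagrange_C (c : PartRing) :
    lagrange (MvPowerSeries.C c : MvPowerSeries σ PartRing) = MvPowerSeries.C c := by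
  rw [← mul_one (MvPowerSeries.C c), ← MvPowerSeries.smul_eq_C_mul, map_smul, lagrange_one]

/-- Since `x = w / E(w)` is sent to the variable `x`, the transform commutes with multiplication by
`x`; writing a factor as a constant plus a multiple of `x`, induction on the order of the
coefficient gives multiplicativity. -/
theorem lagrange_mul (G H : MvPowerSeries σ PartRing) :
    lagrange (G * H) = lagrange G * lagrange H := by
  classical
  suffices h : ∀ d (n : σ →₀ ℕ), n.degree = d → ∀ G H : MvPowerSeries σ PartRing,
      MvPowerSeries.coeff n (lagrange (G * H)) = MvPowerSeries.coeff n (lagrange G * lagrange H) by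
    ext1 n
    exact h _ n rfl G H
  intro d
  induction d with
  | zero =>
    intro n hn G H
    rw [(Finsupp.degree_eq_zero_iff n).1 hn, coeff_zero_lagrange]
    simp only [MvPowerSeries.coeff_zero_eq_constantCoeff_apply, map_mul]
    simp only [← MvPowerSeries.coeff_zero_eq_constantCoeff_apply, coeff_zero_lagrange]
  | succ d ih =>
    intro n hn G H
    obtain ⟨G', hG⟩ := exists_eq_C_add_sum_X_mul G
    have hX : ∀ i, MvPowerSeries.coeff n (lagrange (MvPowerSeries.X i * G' i * H)) =
        MvPowerSeries.coeff n (lagrange (MvPowerSeries.X i * G' i) * lagrange H) := fun i => by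
      rw [mul_assoc, lagrange_X_mul, lagrange_X_mul, ← mul_assoc, mul_assoc (MvPowerSeries.X i),
        MvPowerSeries.X_def, MvPowerSeries.coeff_monomial_mul, MvPowerSeries.coeff_monomial_mul]
      split_ifs with h
      · obtain ⟨m, rfl⟩ := exists_add_of_le h
        rw [add_tsub_cancel_left, ih m]
        rw [map_add, Finsupp.degree_single] at hn
        omega
      · rfl
    rw [hG, add_mul, map_add, map_add, map_add lagrange (MvPowerSeries.C _), add_mul, map_add,
      Finset.sum_mul, map_sum, map_sum, map_sum, Finset.sum_mul, map_sum]
    congr 1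
    · rw [lagrange_C, ← MvPowerSeries.smul_eq_C_mul, ← MvPowerSeries.smul_eq_C_mul, map_smul]
    · exact Finset.sum_congr rfl fun i _ => hX i

/-- The chain rule for the Euler derivation `N` in the variables `q_i`. It reads
`N (G(z)) = (N G)(z) + ∑ P(zᵢ) xᵢ ∂/∂xᵢ G(z)`, because `N z = P(z) x dz/dx`. -/
theorem coeffDer_lagrange (G : MvPowerSeries σ PartRing) :
    coeffDer countDer (lagrange G) =
      lagrange (coeffDer countDer G + ∑ i, inVar i serP * inVar i serU * euler PartRing i G) := by
  classical
  have hker : ∀ n : σ →₀ ℕ, coeffDer countDer (lagrangeKernel n) =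
      ∑ i, (n i * inVar i serP * lagrangeKernel n - inVar i serQ * lagrangeCofactor i n) := by
    intro n
    have hfac : ∀ i : σ, coeffDer countDer (inVar i ((1 - serQ) * serE ^ n i)) =
        (n i * inVar i serP * (1 - inVar i serQ) - inVar i serQ) * inVar i serE ^ n i := by
      intro i
      rw [map_mul, map_pow, map_sub, map_one, Derivation.leibniz, map_sub,
        Derivation.map_one_eq_zero, coeffDer_inVar_serQ,
        derivation_pow_of_eq _ (coeffDer_inVar_serE i)]
      simp only [smul_eq_mul]
      ring
    rw [lagrangeKernel, derivation_prod]
    refine Finset.sum_congr rfl fun i _ => ?_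
    rw [hfac, ← lagrangeKernel, lagrangeKernel_eq i n, lagrangeCofactor]
    ring
  ext1 n
  rw [map_add, map_add, map_sum, map_sum, coeff_coeffDer, coeff_lagrange, ← coeff_coeffDer,
    Derivation.leibniz, hker, smul_eq_mul, smul_eq_mul, map_add, add_comm, mul_comm _ (coeffDer _ _),
    coeff_lagrange, Finset.mul_sum, map_sum]
  congr 1
  refine Finset.sum_congr rfl fun i _ => ?_
  -- The chain rule for `P(wᵢ) G` expresses `nᵢ P(wᵢ) G` under the transform.
  have h := congrArg (MvPowerSeries.coeff n) (euler_lagrange i (inVar i serP * G))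
  rw [coeff_euler, coeff_lagrange, coeff_lagrange, Derivation.leibniz, euler_inVar_serP,
    smul_eq_mul, smul_eq_mul, show inVar i serU * (inVar i serP * euler PartRing i G +
      G * inVar i serQ) * lagrangeKernel n = inVar i serP * inVar i serU * euler PartRing i G *
      lagrangeKernel n + G * inVar i serQ * (inVar i serU * lagrangeKernel n) by ring,
    inVar_serU_mul_lagrangeKernel, map_add] at h
  rw [coeff_lagrange, mul_sub, map_sub, show G * (n i * inVar i serP * lagrangeKernel n) =
    ((n i : ℕ) : MvPowerSeries σ PartRing) * (inVar i serP * G * lagrangeKernel n) by ring, coeff_natCast_mul, ← mul_assoc G]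
  linear_combination h

end Lagrange

/-! ### The Lagrange transform of series in one variable -/

section Coefficients

theorem coeff_inVar_mul {σ R : Type*} [CommRing R] [DecidableEq σ] (i : σ)
    (u : PowerSeries R) (F : MvPowerSeries σ R) (n : σ →₀ ℕ) :
    MvPowerSeries.coeff n (inVar i u * F) = ∑ p ∈ Finset.HasAntidiagonal.antidiagonal (n i),
      PowerSeries.coeff p.1 u * MvPowerSeries.coeff (n.update i p.2) F := by
  classical
  rw [MvPowerSeries.coeff_mul]
  symm
  refine Finset.sum_of_injOn
    (fun p => ((Finsupp.single i p.1, n.update i p.2) : (σ →₀ ℕ) × (σ →₀ ℕ))) ?_ ?_ ?_ ?_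
  · rintro ⟨a, b⟩ _ ⟨c, d⟩ _ h
    simp only [Prod.mk.injEq] at h
    have h1 := DFunLike.congr_fun h.1 i
    have h2 := DFunLike.congr_fun h.2 i
    simp at h1 h2
    rw [h1, h2]
  · rintro ⟨a, b⟩ h
    rw [Finset.mem_coe, Finset.HasAntidiagonal.mem_antidiagonal] at h ⊢
    ext j
    by_cases hj : j = i
    · subst hj; simpa using h
    · simp [hj]
  · rintro ⟨p, q⟩ h hn
    rw [Finset.HasAntidiagonal.mem_antidiagonal] at h
    rw [coeff_inVar, if_neg, zero_mul]
    intro hp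
    apply hn
    refine ⟨(p i, q i), ?_, ?_⟩
    · rw [Finset.mem_coe, Finset.HasAntidiagonal.mem_antidiagonal, ← h]
      rfl
    · simp only [Prod.mk.injEq]
      refine ⟨hp.symm, ?_⟩
      ext j
      by_cases hj : j = i
      · subst hj; simp
      · rw [← h, hp]
        simp [hj]
  · rintro ⟨a, b⟩ _
    rw [coeff_single_inVar]

theorem coeff_inVar_mul_of_eq_zero {σ R : Type*} [CommRing R] (i : σ)
    (u : PowerSeries R) (F : MvPowerSeries σ R) {n : σ →₀ ℕ} (hn : n i = 0) :
    MvPowerSeries.coeff n (inVar i u * F) = PowerSeries.coeff 0 u * MvPowerSeries.coeff n F := by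
  classical
  have h : n.update i 0 = n := by
    rw [← hn]; simp
  rw [coeff_inVar_mul, hn]
  simp [h]

end Coefficients

/-- The Lagrange transform of a series in one variable. -/
noncomputable def lagrangeSeries (g : PowerSeries PartRing) : PowerSeries PartRing :=
  PowerSeries.mk fun k => PowerSeries.coeff k (g * ((1 - serQ) * serE ^ k))

theorem coeff_lagrangeSeries (g : PowerSeries PartRing) (k : ℕ) :
    PowerSeries.coeff k (lagrangeSeries g) =
      PowerSeries.coeff k (g * ((1 - serQ) * serE ^ k)) := by
  rw [lagrangeSeries, PowerSeries.coeff_mk]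

theorem lagrange_inVar {σ : Type*} [Fintype σ] (i : σ) (g : PowerSeries PartRing) :
    lagrange (inVar i g) = inVar i (lagrangeSeries g) := by
  classical
  ext1 n
  by_cases hn : n = Finsupp.single i (n i)
  · rw [coeff_inVar, if_pos hn, coeff_lagrangeSeries, coeff_lagrange, lagrangeKernel,
      ← Finset.mul_prod_erase _ _ (Finset.mem_univ i), ← mul_assoc, ← map_mul, mul_comm]
    have h : ∀ s ⊆ Finset.univ.erase i, ∀ F : MvPowerSeries σ PartRing,
        MvPowerSeries.coeff n ((∏ j ∈ s, inVar j ((1 - serQ) * serE ^ n j)) * F) =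
          MvPowerSeries.coeff n F := by
      intro s
      induction s using Finset.induction_on with
      | empty => simp
      | insert a s ha ih =>
        intro hs F
        have hna : n a = 0 := by
          rw [hn]
          simp [Finset.ne_of_mem_erase (hs (Finset.mem_insert_self a s))]
        rw [Finset.prod_insert ha, mul_assoc, coeff_inVar_mul_of_eq_zero _ _ _ hna,
          ih ((Finset.subset_insert a s).trans hs), hna, pow_zero, mul_one, map_sub,
          coeff_zero_serQ]
        simp
    rw [h _ subset_rfl, coeff_inVar, if_pos hn]
  · rw [coeff_inVar, if_neg hn]
    obtain ⟨j, hj, hnj⟩ : ∃ j, j ≠ i ∧ n j ≠ 0 := by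
      by_contra! h
      apply hn
      ext j
      by_cases hj : j = i
      · subst hj; simp
      · simp [hj, h j hj]
    have h := congrArg (MvPowerSeries.coeff n) (euler_lagrange j (inVar i g))
    rw [euler_inVar_of_ne hj, mul_zero, map_zero, map_zero, coeff_euler] at h
    exact (mul_eq_zero.1 h).resolve_left (Nat.cast_ne_zero.2 hnj)

/-- The inverse series `z(x)` of `x = w exp(-P(w))`. -/
noncomputable def serZ : PowerSeries PartRing := lagrangeSeries PowerSeries.X

/-- The series `P(z(x))`. -/
noncomputable def serF : PowerSeries PartRing := lagrangeSeries serP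

/-- The series `U(z(x))`. -/
noncomputable def serV : PowerSeries PartRing := lagrangeSeries serU

section Transforms

theorem inVar_serU_mul_serQ {σ : Type*} (i : σ) :
    (inVar i serU * inVar i serQ : MvPowerSeries σ PartRing) = inVar i serU - 1 := by
  linear_combination -inVar_serU_mul i

variable {σ : Type*} [Fintype σ]

theorem lagrange_X (i : σ) : lagrange (MvPowerSeries.X i) = inVar i serZ := by
  rw [← inVar_X, lagrange_inVar, serZ]

theorem euler_serZ (i : σ) :
    euler PartRing i (inVar i serZ) = inVar i serZ * inVar i serV := by
  rw [← lagrange_X, euler_lagrange, euler_X_self, lagrange_mul, lagrange_inVar, mul_comm, serV]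

theorem euler_serF (i : σ) :
    euler PartRing i (inVar i serF) = inVar i serV - 1 := by
  rw [serF, ← lagrange_inVar, euler_lagrange, euler_inVar_serP, inVar_serU_mul_serQ, map_sub,
    lagrange_one, lagrange_inVar, serV]

theorem coeffDer_serZ (i : σ) :
    coeffDer countDer (inVar i serZ) = inVar i serF * inVar i serV * inVar i serZ := by
  classical
  rw [← lagrange_X, coeffDer_lagrange, coeffDer_X, zero_add, Finset.sum_eq_single i]
  · rw [euler_X_self, lagrange_mul, lagrange_mul, lagrange_inVar, lagrange_inVar, serF, serV]
  · intro j _ hj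
    rw [euler_X_of_ne hj, mul_zero]
  · simp

theorem coeffDer_serF (i : σ) :
    coeffDer countDer (inVar i serF) = inVar i serF * inVar i serV := by
  classical
  rw [serF, ← lagrange_inVar, coeffDer_lagrange, coeffDer_inVar_serP, Finset.sum_eq_single i]
  · rw [euler_inVar_serP, mul_assoc, inVar_serU_mul_serQ, serV, ← lagrange_inVar, ← lagrange_mul]
    congr 1
    ring
  · intro j _ hj
    rw [euler_inVar_of_ne hj, mul_zero]
  · simp

end Transforms

theorem coeff_one_serZ : PowerSeries.coeff 1 serZ = 1 := by
  rw [serZ, coeff_lagrangeSeries, show 1 = 0 + 1 from rfl, PowerSeries.coeff_succ_X_mul]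
  simp [constantCoeff_serQ, constantCoeff_serE]

theorem coeff_zero_serF : PowerSeries.coeff 0 serF = 0 := by
  rw [serF, coeff_lagrangeSeries]
  simp [constantCoeff_serP]

theorem coeff_zero_serU : PowerSeries.coeff 0 serU = 1 := by
  have h := congrArg (PowerSeries.coeff 0) serU_mul_one_sub_serQ
  simpa [constantCoeff_serQ] using h

/-- The coefficient of `x^a` in `P(z(x))`, by Lagrange inversion. -/
theorem coeff_serF (a : ℕ) :
    (a : PartRing) * PowerSeries.coeff a serF =
      PowerSeries.coeff a (serE ^ a) - if a = 0 then 1 else 0 := by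
  have h := congrArg (MvPowerSeries.coeff (Finsupp.single () a)) (euler_serF ())
  rw [coeff_euler, map_sub (MvPowerSeries.coeff _), coeff_single_inVar, coeff_single_inVar,
    MvPowerSeries.coeff_one, serV, coeff_lagrangeSeries, ← mul_assoc, serU_mul_one_sub_serQ,
    one_mul] at h
  simpa using h

/-! ### The generating series for two parts -/

section Join

variable {σ R : Type*} [CommRing R]

/-- `∑ φ(a + b, c) xᵢ^a xⱼ^b x_k^c`, summed over `a, b ≥ 1` and `c ≥ 0`. -/
noncomputable def joinSeries (i j k : Fin 3) (φ : ℕ → ℕ → R) : MvPowerSeries (Fin 3) R :=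
  fun n : Fin 3 →₀ ℕ => if n i ≠ 0 ∧ n j ≠ 0 then φ (n i + n j) (n k) else 0

/-- `∑ φ(a, c) xᵢ^a x_k^c`, summed over `a ≥ 1` and `c ≥ 0`, as a series without the variable `xⱼ`. -/
noncomputable def headSeries (i j k : Fin 3) (φ : ℕ → ℕ → R) : MvPowerSeries (Fin 3) R :=
  fun n : Fin 3 →₀ ℕ => if n i ≠ 0 ∧ n j = 0 then φ (n i) (n k) else 0

theorem coeff_joinSeries (i j k : Fin 3) (φ : ℕ → ℕ → R) (n : Fin 3 →₀ ℕ) :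
    MvPowerSeries.coeff n (joinSeries i j k φ) =
      if n i ≠ 0 ∧ n j ≠ 0 then φ (n i + n j) (n k) else 0 := by
  rw [MvPowerSeries.coeff_apply, joinSeries]

theorem coeff_headSeries (i j k : Fin 3) (φ : ℕ → ℕ → R) (n : Fin 3 →₀ ℕ) :
    MvPowerSeries.coeff n (headSeries i j k φ) =
      if n i ≠ 0 ∧ n j = 0 then φ (n i) (n k) else 0 := by
  rw [MvPowerSeries.coeff_apply, headSeries]

theorem coeff_X_mul_eq (i : σ) (F : MvPowerSeries σ R) (n : σ →₀ ℕ) :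
    MvPowerSeries.coeff n (MvPowerSeries.X i * F) =
      if n i ≠ 0 then MvPowerSeries.coeff (n - Finsupp.single i 1) F else 0 := by
  classical
  rw [MvPowerSeries.X_def, MvPowerSeries.coeff_monomial_mul]
  simp [Finsupp.single_le_iff, Nat.one_le_iff_ne_zero]

/-- The geometric sum `(x - y) ∑_{a + b = n; a, b ≥ 1} x^a y^b = x^n y - x y^n`. -/
theorem sub_mul_joinSeries {i j k : Fin 3} (hij : i ≠ j) (hik : i ≠ k) (hjk : j ≠ k)
    (φ : ℕ → ℕ → R) :
    (MvPowerSeries.X i - MvPowerSeries.X j) * joinSeries i j k φ =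
      MvPowerSeries.X j * headSeries i j k φ - MvPowerSeries.X i * headSeries j i k φ := by
  ext n
  rw [sub_mul, map_sub, map_sub]
  simp only [coeff_X_mul_eq, coeff_joinSeries, coeff_headSeries, Finsupp.coe_tsub, Pi.sub_apply,
    Finsupp.single_eq_same, Finsupp.single_eq_of_ne hij, Finsupp.single_eq_of_ne hij.symm,
    Finsupp.single_eq_of_ne hik.symm, Finsupp.single_eq_of_ne hjk.symm, Nat.sub_zero]
  rcases Nat.eq_zero_or_pos (n i) with hi | hi
  · simp [hi]
  · rcases Nat.eq_zero_or_pos (n j) with hj | hj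
    · simp [hj]
    · obtain ⟨a, ha⟩ := Nat.exists_eq_succ_of_ne_zero hi.ne'
      obtain ⟨b, hb⟩ := Nat.exists_eq_succ_of_ne_zero hj.ne'
      rw [ha, hb]
      rcases Nat.eq_zero_or_pos a with rfl | ha0 <;> rcases Nat.eq_zero_or_pos b with rfl | hb0
      · simp
      · simp [hb0.ne', add_comm]
      · simp [ha0.ne']
      · simp only [ne_eq, Nat.succ_ne_zero, not_false_eq_true, Nat.succ_sub_one, ha0.ne', hb0.ne',
          and_self, if_true, if_false, and_false]
        rw [show a.succ + b = a + b.succ by omega]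
        simp

/-- The divided difference `(g(xᵢ) - g(xⱼ)) / (xᵢ - xⱼ)`. -/
noncomputable def divDiff (i j k : Fin 3) (g : PowerSeries R) : MvPowerSeries (Fin 3) R :=
  fun n : Fin 3 →₀ ℕ => if n k = 0 then PowerSeries.coeff (n i + n j + 1) g else 0

theorem coeff_divDiff (i j k : Fin 3) (g : PowerSeries R) (n : Fin 3 →₀ ℕ) :
    MvPowerSeries.coeff n (divDiff i j k g) =
      if n k = 0 then PowerSeries.coeff (n i + n j + 1) g else 0 := by
  rw [MvPowerSeries.coeff_apply, divDiff]

theorem forall_fin_three {i j k : Fin 3} (hij : i ≠ j) (hik : i ≠ k) (hjk : j ≠ k) (l : Fin 3) :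
    l = i ∨ l = j ∨ l = k := by
  revert i j k l; decide

theorem eq_single_iff {i j k : Fin 3} (hij : i ≠ j) (hik : i ≠ k) (hjk : j ≠ k) (n : Fin 3 →₀ ℕ) :
    n = Finsupp.single i (n i) ↔ n j = 0 ∧ n k = 0 := by
  constructor
  · intro h
    rw [h]
    simp [hij.symm, hik.symm]
  · rintro ⟨h1, h2⟩
    ext l
    rcases forall_fin_three hij hik hjk l with rfl | rfl | rfl
    · simp
    · simp [h1, hij.symm]
    · simp [h2, hik.symm]

theorem sub_mul_divDiff {i j k : Fin 3} (hij : i ≠ j) (hik : i ≠ k) (hjk : j ≠ k)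
    (g : PowerSeries R) :
    (MvPowerSeries.X i - MvPowerSeries.X j) * divDiff i j k g = inVar i g - inVar j g := by
  classical
  ext n
  rw [sub_mul, map_sub, map_sub, coeff_inVar, coeff_inVar]
  simp only [eq_single_iff hij hik hjk, eq_single_iff hij.symm hjk hik, coeff_X_mul_eq,
    coeff_divDiff, Finsupp.coe_tsub, Pi.sub_apply,
    Finsupp.single_eq_same, Finsupp.single_eq_of_ne hij, Finsupp.single_eq_of_ne hij.symm,
    Finsupp.single_eq_of_ne hik.symm, Finsupp.single_eq_of_ne hjk.symm, Nat.sub_zero]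
  by_cases hk : n k = 0
  · rcases Nat.eq_zero_or_pos (n i) with hi | hi <;> rcases Nat.eq_zero_or_pos (n j) with hj | hj
    · simp [hi, hj, hk]
    · simp [hi, hj.ne', hk, Nat.sub_add_cancel hj]
    · simp [hi.ne', hj, hk, Nat.sub_add_cancel hi]
    · have h1 : n i - 1 + n j + 1 = n i + n j := by omega
      have h2 : n i + (n j - 1) + 1 = n i + n j := by omega
      simp [hi.ne', hj.ne', hk, h1, h2]
  · simp [hk]

end Join

/-- The series `∑ U_{a+b} wᵢ^a wⱼ^b`, summed over `a, b ≥ 1`. -/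
noncomputable def twoPoint (i j k : Fin 3) : MvPowerSeries (Fin 3) PartRing :=
  joinSeries i j k fun m l => if l = 0 then PowerSeries.coeff m serU else 0

theorem headSeries_inVar {i j k : Fin 3} (hij : i ≠ j) (hik : i ≠ k) (hjk : j ≠ k)
    (g : PowerSeries PartRing) :
    headSeries i j k (fun m l => if l = 0 then PowerSeries.coeff m g else 0) =
      inVar i g - MvPowerSeries.C (PowerSeries.coeff 0 g) := by
  classical
  ext1 n
  rw [coeff_headSeries, map_sub, coeff_inVar, MvPowerSeries.coeff_C]
  have h0 : n = 0 ↔ n i = 0 ∧ n j = 0 ∧ n k = 0 := by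
    constructor
    · rintro rfl; simp
    · rintro ⟨h1, h2, h3⟩
      ext l
      rcases forall_fin_three hij hik hjk l with rfl | rfl | rfl <;> simp [*]
  simp only [h0, eq_single_iff hij hik hjk]
  by_cases hi : n i = 0 <;> by_cases hj : n j = 0 <;> by_cases hk : n k = 0 <;> simp [hi, hj, hk]

theorem sub_mul_twoPoint {i j k : Fin 3} (hij : i ≠ j) (hik : i ≠ k) (hjk : j ≠ k) :
    (MvPowerSeries.X i - MvPowerSeries.X j) * twoPoint i j k =
      MvPowerSeries.X j * (inVar i serU - 1) - MvPowerSeries.X i * (inVar j serU - 1) := by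
  rw [twoPoint, sub_mul_joinSeries hij hik hjk, headSeries_inVar hij hik hjk,
    headSeries_inVar hij.symm hjk hik, coeff_zero_serU, map_one]

/-- The total degree, as an Euler derivation. -/
noncomputable def eulerTotal : Derivation ℚ (MvPowerSeries (Fin 3) PartRing)
    (MvPowerSeries (Fin 3) PartRing) :=
  euler PartRing 0 + euler PartRing 1 + euler PartRing 2

theorem coeff_eulerTotal (F : MvPowerSeries (Fin 3) PartRing) (n : Fin 3 →₀ ℕ) :
    MvPowerSeries.coeff n (eulerTotal F) =
      ((n 0 + n 1 + n 2 : ℕ) : PartRing) * MvPowerSeries.coeff n F := by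
  rw [eulerTotal, Derivation.add_apply, Derivation.add_apply, map_add, map_add, coeff_euler,
    coeff_euler, coeff_euler]
  push_cast
  ring

theorem eq_of_eulerTotal_eq {F G : MvPowerSeries (Fin 3) PartRing}
    (h : eulerTotal F = eulerTotal G) (h0 : MvPowerSeries.coeff 0 F = MvPowerSeries.coeff 0 G) :
    F = G := by
  ext1 n
  by_cases hn : n 0 + n 1 + n 2 = 0
  · have : n = 0 := by
      ext l
      fin_cases l <;> simp <;> omega
    rw [this, h0]
  · have h1 := congrArg (MvPowerSeries.coeff n) h
    rw [coeff_eulerTotal, coeff_eulerTotal] at h1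
    exact mul_left_cancel₀ (Nat.cast_ne_zero.2 hn) h1

/-- The generating series for two parts: the antiderivative of `∑ U_{a+b} zᵢ^a zⱼ^b` for the total
Euler derivation, with constant term zero. -/
noncomputable def twoPartSeries (i j k : Fin 3) : MvPowerSeries (Fin 3) PartRing :=
  fun n : Fin 3 →₀ ℕ => ((n 0 + n 1 + n 2 : ℕ) : ℚ)⁻¹ •
    MvPowerSeries.coeff n (lagrange (twoPoint i j k))

theorem coeff_twoPartSeries (i j k : Fin 3) (n : Fin 3 →₀ ℕ) :
    MvPowerSeries.coeff n (twoPartSeries i j k) = ((n 0 + n 1 + n 2 : ℕ) : ℚ)⁻¹ •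
      MvPowerSeries.coeff n (lagrange (twoPoint i j k)) := by
  rw [MvPowerSeries.coeff_apply, twoPartSeries]

theorem eulerTotal_twoPartSeries (i j k : Fin 3) :
    eulerTotal (twoPartSeries i j k) = lagrange (twoPoint i j k) := by
  ext1 n
  rw [coeff_eulerTotal, coeff_twoPartSeries]
  by_cases hn : n 0 + n 1 + n 2 = 0
  · have : n = 0 := by
      ext l
      fin_cases l <;> simp <;> omega
    rw [this, coeff_zero_lagrange, twoPoint, coeff_joinSeries]
    simp
  · rw [← nsmul_eq_mul, ← Nat.cast_smul_eq_nsmul ℚ, smul_smul,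
      mul_inv_cancel₀ (Nat.cast_ne_zero.2 hn), one_smul]

section TwoPart

variable {i j k : Fin 3}

/-- The unit `(zᵢ - zⱼ) / (xᵢ - xⱼ)`. -/
noncomputable def zQuotient (i j k : Fin 3) : MvPowerSeries (Fin 3) PartRing := divDiff i j k serZ

theorem coeff_zero_zQuotient : MvPowerSeries.coeff 0 (zQuotient i j k) = 1 := by
  rw [zQuotient, coeff_divDiff]
  simp [coeff_one_serZ]

theorem exists_zQuotient_mul_eq_one (i j k : Fin 3) : ∃ s, zQuotient i j k * s = 1 := by
  have h : IsUnit (zQuotient i j k) := by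
    rw [MvPowerSeries.isUnit_iff_constantCoeff,
      ← MvPowerSeries.coeff_zero_eq_constantCoeff_apply, coeff_zero_zQuotient]
    exact isUnit_one
  exact h.exists_right_inv

theorem sub_mul_zQuotient (hij : i ≠ j) (hik : i ≠ k) (hjk : j ≠ k) :
    (MvPowerSeries.X i - MvPowerSeries.X j) * zQuotient i j k = inVar i serZ - inVar j serZ :=
  sub_mul_divDiff hij hik hjk serZ

theorem X_sub_X_ne_zero (hij : i ≠ j) :
    (MvPowerSeries.X i - MvPowerSeries.X j : MvPowerSeries (Fin 3) PartRing) ≠ 0 := by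
  rw [sub_ne_zero]
  intro h
  exact hij (MvPowerSeries.X_inj.1 h)

theorem serZ_sub_serZ_ne_zero (hij : i ≠ j) (hik : i ≠ k) (hjk : j ≠ k) :
    (inVar i serZ - inVar j serZ : MvPowerSeries (Fin 3) PartRing) ≠ 0 := by
  rw [← sub_mul_zQuotient hij hik hjk]
  refine mul_ne_zero (X_sub_X_ne_zero hij) fun h => ?_
  have := coeff_zero_zQuotient (i := i) (j := j) (k := k)
  rw [h, map_zero] at this
  exact zero_ne_one this

theorem serZ_sub_mul_lagrange_twoPoint (hij : i ≠ j) (hik : i ≠ k) (hjk : j ≠ k) :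
    (inVar i serZ - inVar j serZ) * lagrange (twoPoint i j k) =
      inVar j serZ * (inVar i serV - 1) - inVar i serZ * (inVar j serV - 1) := by
  have h := congrArg lagrange (sub_mul_twoPoint hij hik hjk)
  rwa [lagrange_mul, map_sub, map_sub, lagrange_mul, lagrange_mul, map_sub, map_sub, lagrange_X,
    lagrange_X, lagrange_one, lagrange_inVar, lagrange_inVar] at h

theorem eulerTotal_X (i : Fin 3) : eulerTotal (MvPowerSeries.X i) = MvPowerSeries.X i := by
  rw [eulerTotal, Derivation.add_apply, Derivation.add_apply]
  fin_cases i <;> simp [euler_X_self, euler_X_of_ne]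

theorem eulerTotal_inVar (i : Fin 3) (g : PowerSeries PartRing) :
    eulerTotal (inVar i g) = euler PartRing i (inVar i g) := by
  rw [eulerTotal, Derivation.add_apply, Derivation.add_apply]
  fin_cases i <;> simp [euler_inVar_of_ne]

/-- The total Euler derivation of `log ((zᵢ - zⱼ)/(xᵢ - xⱼ)) - P(zᵢ) - P(zⱼ)`. -/
theorem lagrange_twoPoint_eq (hij : i ≠ j) (hik : i ≠ k) (hjk : j ≠ k)
    {s : MvPowerSeries (Fin 3) PartRing} (hs : zQuotient i j k * s = 1) :
    lagrange (twoPoint i j k) = s * eulerTotal (zQuotient i j k) -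
      eulerTotal (inVar i serF) - eulerTotal (inVar j serF) := by
  have h1 := sub_mul_zQuotient hij hik hjk
  have h2 := congrArg eulerTotal h1
  rw [Derivation.leibniz, map_sub, map_sub, eulerTotal_X, eulerTotal_X, eulerTotal_inVar,
    eulerTotal_inVar, euler_serZ, euler_serZ, smul_eq_mul, smul_eq_mul] at h2
  rw [eulerTotal_inVar, eulerTotal_inVar, euler_serF, euler_serF]
  apply mul_left_cancel₀ (serZ_sub_serZ_ne_zero hij hik hjk)
  rw [serZ_sub_mul_lagrange_twoPoint hij hik hjk]
  linear_combination -h2 + (eulerTotal (zQuotient i j k) * s + 1) * h1 -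
    (MvPowerSeries.X i - MvPowerSeries.X j) * eulerTotal (zQuotient i j k) * hs

/-- `twoPartSeries` is `log ((zᵢ - zⱼ)/(xᵢ - xⱼ)) - P(zᵢ) - P(zⱼ)`; the logarithm enters only through
its derivatives. Both sides have the same total Euler derivative by `lagrange_twoPoint_eq`, because
logarithmic derivatives for commuting derivations are closed. -/
theorem derivation_twoPartSeries (hij : i ≠ j) (hik : i ≠ k) (hjk : j ≠ k)
    {s : MvPowerSeries (Fin 3) PartRing} (hs : zQuotient i j k * s = 1)
    (D : Derivation ℚ (MvPowerSeries (Fin 3) PartRing) (MvPowerSeries (Fin 3) PartRing))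
    (hD : ∀ F, eulerTotal (D F) = D (eulerTotal F))
    (h0 : ∀ F, MvPowerSeries.coeff 0 F ∈ Set.range (Nat.cast : ℕ → PartRing) →
      MvPowerSeries.coeff 0 (D F) = 0) :
    D (twoPartSeries i j k) = s * D (zQuotient i j k) - D (inVar i serF) - D (inVar j serF) := by
  refine eq_of_eulerTotal_eq ?_ ?_
  · have hs' : ∀ D' : Derivation ℚ (MvPowerSeries (Fin 3) PartRing)
        (MvPowerSeries (Fin 3) PartRing), D' s = -s ^ 2 * D' (zQuotient i j k) := fun D' => by
      have h := D'.leibniz_of_mul_eq_one (a := s) (b := zQuotient i j k) (by rw [mul_comm, hs])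
      rw [h, smul_eq_mul]
    rw [hD, eulerTotal_twoPartSeries, lagrange_twoPoint_eq hij hik hjk hs, map_sub, map_sub,
      map_sub, map_sub, ← hD, ← hD, Derivation.leibniz, Derivation.leibniz, ← hD, hs', hs']
    simp only [smul_eq_mul]
    ring
  · have hf : ∀ l : Fin 3, MvPowerSeries.coeff 0 (D (inVar l serF)) = 0 := fun l =>
      h0 _ ⟨0, by
        rw [MvPowerSeries.coeff_zero_eq_constantCoeff_apply, constantCoeff_inVar, coeff_zero_serF,
          Nat.cast_zero]⟩
    rw [map_sub, map_sub, hf, hf, MvPowerSeries.coeff_zero_eq_constantCoeff_apply (s * _), map_mul,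
      ← MvPowerSeries.coeff_zero_eq_constantCoeff_apply (D (zQuotient i j k)),
      h0 (zQuotient i j k) ⟨1, by rw [coeff_zero_zQuotient, Nat.cast_one]⟩, mul_zero, sub_zero,
      sub_zero]
    refine h0 _ ⟨0, ?_⟩
    rw [coeff_twoPartSeries]
    simp

theorem eulerTotal_euler (l : Fin 3) (F : MvPowerSeries (Fin 3) PartRing) :
    eulerTotal (euler PartRing l F) = euler PartRing l (eulerTotal F) := by
  ext1 n
  rw [coeff_eulerTotal, coeff_euler, coeff_euler, coeff_eulerTotal]
  ring

theorem eulerTotal_coeffDer (F : MvPowerSeries (Fin 3) PartRing) :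
    eulerTotal (coeffDer countDer F) = coeffDer countDer (eulerTotal F) := by
  ext1 n
  rw [coeff_eulerTotal, coeff_coeffDer, coeff_coeffDer, coeff_eulerTotal, ← nsmul_eq_mul,
    ← nsmul_eq_mul, map_nsmul]

/-- `xᵢ ∂/∂xᵢ` of the two-part series is `vᵢ zⱼ/(zᵢ - zⱼ) - xⱼ/(xᵢ - xⱼ)` with `vᵢ = U(zᵢ)`; denominators
are cleared because they are not units. -/
theorem euler_twoPartSeries (hij : i ≠ j) (hik : i ≠ k) (hjk : j ≠ k) :
    (MvPowerSeries.X i - MvPowerSeries.X j) * (inVar i serZ - inVar j serZ) *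
      euler PartRing i (twoPartSeries i j k) =
    inVar i serV * inVar j serZ * (MvPowerSeries.X i - MvPowerSeries.X j) -
      MvPowerSeries.X j * (inVar i serZ - inVar j serZ) := by
  obtain ⟨s, hs⟩ := exists_zQuotient_mul_eq_one i j k
  have h1 := sub_mul_zQuotient hij hik hjk
  have h2 := congrArg (euler PartRing i) h1
  rw [Derivation.leibniz, map_sub, map_sub, euler_X_self, euler_X_of_ne hij,
    euler_inVar_of_ne hij, euler_serZ, smul_eq_mul, smul_eq_mul] at h2
  rw [derivation_twoPartSeries hij hik hjk hs _ (eulerTotal_euler i)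
    (fun F _ => by rw [coeff_euler]; simp), euler_inVar_of_ne hij, euler_serF]
  linear_combination (MvPowerSeries.X i - MvPowerSeries.X j) * h2 - MvPowerSeries.X i * h1 -
    (MvPowerSeries.X i - MvPowerSeries.X j) * s * euler PartRing i (zQuotient i j k) * h1 +
    (MvPowerSeries.X i - MvPowerSeries.X j) ^ 2 * euler PartRing i (zQuotient i j k) * hs

theorem twoPartSeries_comm (i j k : Fin 3) : twoPartSeries i j k = twoPartSeries j i k := by
  have h : twoPoint i j k = twoPoint j i k := by
    ext1 n
    rw [twoPoint, twoPoint, coeff_joinSeries, coeff_joinSeries, add_comm]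
    simp only [and_comm]
  ext1 n
  rw [coeff_twoPartSeries, coeff_twoPartSeries, h]

/-- The cut-and-join recursion for two parts. -/
theorem coeffDer_twoPartSeries (hij : i ≠ j) (hik : i ≠ k) (hjk : j ≠ k) :
    coeffDer countDer (twoPartSeries i j k) =
      joinSeries i j k (fun m l => if l = 0 then PowerSeries.coeff m serF else 0) +
        inVar i serF * euler PartRing i (twoPartSeries i j k) +
        inVar j serF * euler PartRing j (twoPartSeries i j k) := by
  obtain ⟨s, hs⟩ := exists_zQuotient_mul_eq_one i j k
  have h1 := sub_mul_zQuotient hij hik hjk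
  have h2 := congrArg (coeffDer countDer) h1
  rw [Derivation.leibniz, map_sub, map_sub, coeffDer_X, coeffDer_X, coeffDer_serZ, coeffDer_serZ,
    smul_eq_mul, smul_eq_mul] at h2
  have h3 := euler_twoPartSeries hij hik hjk
  have h4 := euler_twoPartSeries hij.symm hjk hik
  rw [twoPartSeries_comm j i k] at h4
  have h5 := sub_mul_joinSeries hij hik hjk
    (fun m l => if l = 0 then PowerSeries.coeff m serF else 0)
  rw [headSeries_inVar hij hik hjk, headSeries_inVar hij.symm hjk hik, coeff_zero_serF, map_zero,
    sub_zero, sub_zero] at h5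
  apply mul_left_cancel₀ (mul_ne_zero (X_sub_X_ne_zero hij) (serZ_sub_serZ_ne_zero hij hik hjk))
  rw [derivation_twoPartSeries hij hik hjk hs _ eulerTotal_coeffDer (fun F ⟨c, hc⟩ => by
    rw [coeff_coeffDer, ← hc, Derivation.map_natCast]), coeffDer_serF, coeffDer_serF]
  linear_combination (inVar i serZ - inVar j serZ) * s * h2 -
    s * (inVar i serF * inVar i serV * inVar i serZ - inVar j serF * inVar j serV * inVar j serZ) * h1
    + (MvPowerSeries.X i - MvPowerSeries.X j) *
      (inVar i serF * inVar i serV * inVar i serZ - inVar j serF * inVar j serV * inVar j serZ) * hs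
    - (inVar i serZ - inVar j serZ) * h5 - inVar i serF * h3 - inVar j serF * h4

end TwoPart

/-! ### The generating series for three parts -/

/-- The series `∑ U_{a+b+c} w₀^a w₁^b w₂^c`, summed over `a, b, c ≥ 1`. -/
noncomputable def threePoint : MvPowerSeries (Fin 3) PartRing :=
  joinSeries 0 1 2 fun m l => if l = 0 then 0 else PowerSeries.coeff (m + l) serU

theorem coeff_threePoint (n : Fin 3 →₀ ℕ) : MvPowerSeries.coeff n threePoint =
    if n 0 ≠ 0 ∧ n 1 ≠ 0 ∧ n 2 ≠ 0 then PowerSeries.coeff (n 0 + n 1 + n 2) serU else 0 := by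
  rw [threePoint, coeff_joinSeries]
  by_cases h0 : n 0 = 0 <;> by_cases h1 : n 1 = 0 <;> by_cases h2 : n 2 = 0 <;> simp [h0, h1, h2]

theorem sub_mul_threePoint :
    (MvPowerSeries.X 0 - MvPowerSeries.X 1) * threePoint =
      MvPowerSeries.X 1 * twoPoint 0 2 1 - MvPowerSeries.X 0 * twoPoint 1 2 0 := by
  rw [threePoint, sub_mul_joinSeries (by decide) (by decide) (by decide)]
  have h : ∀ i j : Fin 3, headSeries i j 2
      (fun m l => if l = 0 then (0 : PartRing) else PowerSeries.coeff (m + l) serU) =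
      twoPoint i 2 j := by
    intro i j
    ext1 n
    rw [coeff_headSeries, twoPoint, coeff_joinSeries]
    by_cases h0 : n i = 0 <;> by_cases h1 : n j = 0 <;> by_cases h2 : n 2 = 0 <;>
      simp [h0, h1, h2]
  rw [h, h]

/-- The generating series for three parts, `∑ U_{a+b+c} z₀^a z₁^b z₂^c`. -/
noncomputable def threePartSeries : MvPowerSeries (Fin 3) PartRing := lagrange threePoint

/-- The operator `N + 1` on series in the `wᵢ`, followed by the transform. -/
noncomputable def liftCount (F : MvPowerSeries (Fin 3) PartRing) :
    MvPowerSeries (Fin 3) PartRing :=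
  lagrange (coeffDer countDer F + F)

theorem serZ_sub_mul_liftCount_twoPoint {i j k : Fin 3} (hij : i ≠ j) (hik : i ≠ k) (hjk : j ≠ k) :
    (inVar i serZ - inVar j serZ) * liftCount (twoPoint i j k) =
      inVar j serZ * (inVar i serV ^ 2 - 1) - inVar i serZ * (inVar j serV ^ 2 - 1) := by
  have h := sub_mul_twoPoint hij hik hjk
  have h1 := congrArg (coeffDer countDer) h
  rw [Derivation.leibniz, map_sub, map_sub, Derivation.leibniz, Derivation.leibniz, coeffDer_X,
    coeffDer_X, map_sub, map_sub, Derivation.map_one_eq_zero, coeffDer_inVar_serU,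
    coeffDer_inVar_serU] at h1
  simp only [smul_eq_mul] at h1
  have h2 : (MvPowerSeries.X i - MvPowerSeries.X j) *
      (coeffDer countDer (twoPoint i j k) + twoPoint i j k) =
      MvPowerSeries.X j * (inVar i serU * inVar i serU - 1) -
        MvPowerSeries.X i * (inVar j serU * inVar j serU - 1) := by
    linear_combination h1 + h + MvPowerSeries.X j * inVar i serU * inVar_serU_mul_serQ i -
      MvPowerSeries.X i * inVar j serU * inVar_serU_mul_serQ j
  have h3 := congrArg lagrange h2
  simp only [map_sub, lagrange_mul, lagrange_X, lagrange_one, lagrange_inVar] at h3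
  rw [liftCount]
  simp only [serV]
  linear_combination h3

theorem serZ_sub_mul_liftCount_threePoint :
    (inVar 0 serZ - inVar 1 serZ) * liftCount threePoint =
      inVar 1 serZ * liftCount (twoPoint 0 2 1) - inVar 0 serZ * liftCount (twoPoint 1 2 0) := by
  have h := sub_mul_threePoint
  have h1 := congrArg (coeffDer countDer) h
  rw [Derivation.leibniz, map_sub, map_sub, Derivation.leibniz, Derivation.leibniz, coeffDer_X,
    coeffDer_X] at h1
  simp only [smul_eq_mul] at h1
  have h2 : (MvPowerSeries.X 0 - MvPowerSeries.X 1) *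
      (coeffDer countDer threePoint + threePoint) =
      MvPowerSeries.X 1 * (coeffDer countDer (twoPoint 0 2 1) + twoPoint 0 2 1) -
        MvPowerSeries.X 0 * (coeffDer countDer (twoPoint 1 2 0) + twoPoint 1 2 0) := by
    linear_combination h1 + h
  have h3 := congrArg lagrange h2
  simp only [map_sub, lagrange_mul, lagrange_X] at h3
  exact h3

/-- The partial fractions identity behind the recursion for three parts: with
`Gᵢⱼ = vᵢ zⱼ/(zᵢ - zⱼ) - xⱼ/(xᵢ - xⱼ)`, the mixed terms of the products `Gᵢⱼ Gᵢₖ` cancel against the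
divided differences, and `∑ᵢ xⱼ xₖ / ((xᵢ - xⱼ)(xᵢ - xₖ)) = 1`. Here `x, y, z` stand for the `xᵢ`,
`a, b, c` for the `zᵢ` and `u, v, w` for the `vᵢ = U(zᵢ)`; `J` and `K` are the joins and the series
`liftCount` of two points, and `T` is that of three points. -/
theorem partial_fractions {K : Type*} [Field K]
    (x y z a b c u v w G01 G02 G10 G12 G20 G21 J01 J02 J12 K02 K12 T : K)
    (hxy : x - y ≠ 0) (hxz : x - z ≠ 0) (hyz : y - z ≠ 0)
    (hab : a - b ≠ 0) (hac : a - c ≠ 0) (hbc : b - c ≠ 0)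
    (h01 : (x - y) * (a - b) * G01 = u * b * (x - y) - y * (a - b))
    (h02 : (x - z) * (a - c) * G02 = u * c * (x - z) - z * (a - c))
    (h10 : (x - y) * (a - b) * G10 = x * (a - b) - v * a * (x - y))
    (h12 : (y - z) * (b - c) * G12 = v * c * (y - z) - z * (b - c))
    (h20 : (x - z) * (a - c) * G20 = x * (a - c) - w * a * (x - z))
    (h21 : (y - z) * (b - c) * G21 = y * (b - c) - w * b * (y - z))
    (j01 : (x - y) * J01 = y * G02 - x * G12)
    (j02 : (x - z) * J02 = z * G01 - x * G21)
    (j12 : (y - z) * J12 = z * G10 - y * G20)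
    (k02 : (a - c) * K02 = c * (u ^ 2 - 1) - a * (w ^ 2 - 1))
    (k12 : (b - c) * K12 = c * (v ^ 2 - 1) - b * (w ^ 2 - 1))
    (t : (a - b) * T = b * K02 - a * K12) :
    T = J01 + J02 + J12 + G01 * G02 + G10 * G12 + G20 * G21 := by
  have e01 : G01 = u * b / (a - b) - y / (x - y) := by
    field_simp; linear_combination h01
  have e02 : G02 = u * c / (a - c) - z / (x - z) := by
    field_simp; linear_combination h02
  have e10 : G10 = x / (x - y) - v * a / (a - b) := by
    field_simp; linear_combination h10
  have e12 : G12 = v * c / (b - c) - z / (y - z) := by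
    field_simp; linear_combination h12
  have e20 : G20 = x / (x - z) - w * a / (a - c) := by
    field_simp; linear_combination h20
  have e21 : G21 = y / (y - z) - w * b / (b - c) := by
    field_simp; linear_combination h21
  have f01 : J01 = (y * G02 - x * G12) / (x - y) := by
    field_simp; linear_combination j01
  have f02 : J02 = (z * G01 - x * G21) / (x - z) := by
    field_simp; linear_combination j02
  have f12 : J12 = (z * G10 - y * G20) / (y - z) := by
    field_simp; linear_combination j12
  have g02 : K02 = (c * (u ^ 2 - 1) - a * (w ^ 2 - 1)) / (a - c) := by
    field_simp; linear_combination k02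
  have g12 : K12 = (c * (v ^ 2 - 1) - b * (w ^ 2 - 1)) / (b - c) := by
    field_simp; linear_combination k12
  have g : T = (b * K02 - a * K12) / (a - b) := by
    field_simp; linear_combination t
  have hT : T = u ^ 2 * (b / (a - b)) * (c / (a - c)) - v ^ 2 * (a / (a - b)) * (c / (b - c)) +
      w ^ 2 * (a / (a - c)) * (b / (b - c)) - 1 := by
    rw [g, g02, g12]; field_simp; ring
  have hJ : y / (x - y) * (z / (x - z)) - x / (x - y) * (z / (y - z)) +
      x / (x - z) * (y / (y - z)) = 1 := by
    field_simp; ring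
  rw [hT, f01, f02, f12, e01, e02, e10, e12, e20, e21]
  simp only [div_eq_mul_inv] at hJ ⊢
  linear_combination hJ

/-- The cut-and-join recursion for three parts. The series `J01`, `J02`, `J12` are the joins, given by
the divided differences that characterize them. -/
theorem coeffDer_threePartSeries {J01 J02 J12 : MvPowerSeries (Fin 3) PartRing}
    (j01 : (MvPowerSeries.X 0 - MvPowerSeries.X 1) * J01 =
      MvPowerSeries.X 1 * euler PartRing 0 (twoPartSeries 0 2 1) -
      MvPowerSeries.X 0 * euler PartRing 1 (twoPartSeries 1 2 0))
    (j02 : (MvPowerSeries.X 0 - MvPowerSeries.X 2) * J02 =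
      MvPowerSeries.X 2 * euler PartRing 0 (twoPartSeries 0 1 2) -
      MvPowerSeries.X 0 * euler PartRing 2 (twoPartSeries 1 2 0))
    (j12 : (MvPowerSeries.X 1 - MvPowerSeries.X 2) * J12 =
      MvPowerSeries.X 2 * euler PartRing 1 (twoPartSeries 0 1 2) -
      MvPowerSeries.X 1 * euler PartRing 2 (twoPartSeries 0 2 1)) :
    coeffDer countDer threePartSeries + threePartSeries = J01 + J02 + J12 +
      ∑ i, inVar i serF * euler PartRing i threePartSeries +
      euler PartRing 0 (twoPartSeries 0 1 2) * euler PartRing 0 (twoPartSeries 0 2 1) +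
      euler PartRing 1 (twoPartSeries 0 1 2) * euler PartRing 1 (twoPartSeries 1 2 0) +
      euler PartRing 2 (twoPartSeries 0 2 1) * euler PartRing 2 (twoPartSeries 1 2 0) := by
  have hN : coeffDer countDer threePartSeries + threePartSeries = liftCount threePoint +
      ∑ i, inVar i serF * euler PartRing i threePartSeries := by
    rw [threePartSeries, coeffDer_lagrange, liftCount, map_add, map_add, map_sum]
    simp only [euler_lagrange, lagrange_mul, lagrange_inVar, serF, mul_assoc]
    ring
  -- The transport terms of the chain rule are the cuts after which one of the new cycles is an orbit
  -- of its own; the other cuts and the joins remain.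
  suffices h : liftCount threePoint = J01 + J02 + J12 +
      euler PartRing 0 (twoPartSeries 0 1 2) * euler PartRing 0 (twoPartSeries 0 2 1) +
      euler PartRing 1 (twoPartSeries 0 1 2) * euler PartRing 1 (twoPartSeries 1 2 0) +
      euler PartRing 2 (twoPartSeries 0 2 1) * euler PartRing 2 (twoPartSeries 1 2 0) by
    rw [hN, h]; ring
  let φ := algebraMap (MvPowerSeries (Fin 3) PartRing)
    (FractionRing (MvPowerSeries (Fin 3) PartRing))
  have hφ : Function.Injective φ := IsFractionRing.injective _ _
  have hne : ∀ {F : MvPowerSeries (Fin 3) PartRing}, F ≠ 0 → φ F ≠ 0 := fun h =>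
    (map_ne_zero_iff φ hφ).2 h
  have h01 := euler_twoPartSeries (i := 0) (j := 1) (k := 2) (by decide) (by decide) (by decide)
  have h02 := euler_twoPartSeries (i := 0) (j := 2) (k := 1) (by decide) (by decide) (by decide)
  have h12 := euler_twoPartSeries (i := 1) (j := 2) (k := 0) (by decide) (by decide) (by decide)
  have h10 := euler_twoPartSeries (i := 1) (j := 0) (k := 2) (by decide) (by decide) (by decide)
  have h20 := euler_twoPartSeries (i := 2) (j := 0) (k := 1) (by decide) (by decide) (by decide)
  have h21 := euler_twoPartSeries (i := 2) (j := 1) (k := 0) (by decide) (by decide) (by decide)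
  rw [twoPartSeries_comm 1 0 2] at h10
  rw [twoPartSeries_comm 2 0 1] at h20
  rw [twoPartSeries_comm 2 1 0] at h21
  have k02 := serZ_sub_mul_liftCount_twoPoint (i := 0) (j := 2) (k := 1) (by decide) (by decide)
    (by decide)
  have k12 := serZ_sub_mul_liftCount_twoPoint (i := 1) (j := 2) (k := 0) (by decide) (by decide)
    (by decide)
  have t := serZ_sub_mul_liftCount_threePoint
  have x01 := hne (X_sub_X_ne_zero (i := 0) (j := 1) (by decide))
  have x02 := hne (X_sub_X_ne_zero (i := 0) (j := 2) (by decide))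
  have x12 := hne (X_sub_X_ne_zero (i := 1) (j := 2) (by decide))
  have z01 := hne (serZ_sub_serZ_ne_zero (i := 0) (j := 1) (k := 2) (by decide) (by decide)
    (by decide))
  have z02 := hne (serZ_sub_serZ_ne_zero (i := 0) (j := 2) (k := 1) (by decide) (by decide)
    (by decide))
  have z12 := hne (serZ_sub_serZ_ne_zero (i := 1) (j := 2) (k := 0) (by decide) (by decide)
    (by decide))
  apply hφ
  simp only [map_sub] at x01 x02 x12 z01 z02 z12
  replace h01 := congrArg φ h01
  replace h02 := congrArg φ h02
  replace h12 := congrArg φ h12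
  replace h10 := congrArg φ h10
  replace h20 := congrArg φ h20
  replace h21 := congrArg φ h21
  replace k02 := congrArg φ k02
  replace k12 := congrArg φ k12
  replace t := congrArg φ t
  replace j01 := congrArg φ j01
  replace j02 := congrArg φ j02
  replace j12 := congrArg φ j12
  simp only [map_sub, map_mul, map_pow, map_one] at h01 h02 h12 h10 h20 h21 k02 k12 t j01 j02 j12
  simp only [map_add, map_mul]
  refine partial_fractions (φ (MvPowerSeries.X 0)) (φ (MvPowerSeries.X 1)) (φ (MvPowerSeries.X 2))
    (φ (inVar 0 serZ)) (φ (inVar 1 serZ)) (φ (inVar 2 serZ)) (φ (inVar 0 serV)) (φ (inVar 1 serV))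
    (φ (inVar 2 serV)) _ _ _ _ _ _ _ _ _ _ _ _ x01 x02 x12 z01 z02 z12 h01 h02 ?_ h12 ?_ ?_
    j01 j02 j12 k02 k12 t
  · linear_combination h10
  · linear_combination h20
  · linear_combination h21

/-! ### The recursions for the coefficients -/

/-- The coefficient `[w^p] (1 - Q(w)) E(w)^a` of Lagrange inversion, which is the coefficient of `x^a`
in `z(x)^(a - p)`. -/
noncomputable def invCoeff (a p : ℕ) : PartRing := PowerSeries.coeff p ((1 - serQ) * serE ^ a)

theorem invCoeff_zero_zero : invCoeff 0 0 = 1 := by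
  simp [invCoeff, constantCoeff_serQ]

/-- The coefficient of `x^a x'^b` in `∑ U_{m+n} z(x)^m z(x')^n`, summed over `m, n ≥ 1`. -/
noncomputable def twoPointCoeff (a b : ℕ) : PartRing :=
  ∑ p ∈ Finset.HasAntidiagonal.antidiagonal a, ∑ q ∈ Finset.HasAntidiagonal.antidiagonal b,
    invCoeff a p.1 * (invCoeff b q.1 *
      if p.2 ≠ 0 ∧ q.2 ≠ 0 then PowerSeries.coeff (p.2 + q.2) serU else 0)

/-- The coefficient of `x^a x'^b` in the generating series for two parts. -/
noncomputable def twoCoeff (a b : ℕ) : PartRing := ((a + b : ℕ) : ℚ)⁻¹ • twoPointCoeff a b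

/-- The coefficient of `x^a x'^b x''^c` in the generating series for three parts. -/
noncomputable def threeCoeff (a b c : ℕ) : PartRing :=
  ∑ p ∈ Finset.HasAntidiagonal.antidiagonal a, ∑ q ∈ Finset.HasAntidiagonal.antidiagonal b,
    ∑ r ∈ Finset.HasAntidiagonal.antidiagonal c,
      invCoeff a p.1 * (invCoeff b q.1 * (invCoeff c r.1 *
        if p.2 ≠ 0 ∧ q.2 ≠ 0 ∧ r.2 ≠ 0 then PowerSeries.coeff (p.2 + q.2 + r.2) serU else 0))

theorem univ_fin_three {i j k : Fin 3} (hij : i ≠ j) (hik : i ≠ k) (hjk : j ≠ k) :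
    (Finset.univ : Finset (Fin 3)) = {i, j, k} := by
  ext l
  simpa using forall_fin_three hij hik hjk l

theorem coeff_lagrange_fin_three {i j k : Fin 3} (hij : i ≠ j) (hik : i ≠ k) (hjk : j ≠ k)
    (G : MvPowerSeries (Fin 3) PartRing) (n : Fin 3 →₀ ℕ) :
    MvPowerSeries.coeff n (lagrange G) =
      ∑ p ∈ Finset.HasAntidiagonal.antidiagonal (n i),
        ∑ q ∈ Finset.HasAntidiagonal.antidiagonal (n j),
          ∑ r ∈ Finset.HasAntidiagonal.antidiagonal (n k),
            invCoeff (n i) p.1 * (invCoeff (n j) q.1 * (invCoeff (n k) r.1 *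
              MvPowerSeries.coeff (((n.update i p.2).update j q.2).update k r.2) G)) := by
  rw [coeff_lagrange, lagrangeKernel, univ_fin_three hij hik hjk,
    Finset.prod_insert (by simp [hij, hik]), Finset.prod_insert (by simp [hjk]),
    Finset.prod_singleton, mul_comm, mul_assoc, mul_assoc, coeff_inVar_mul]
  refine Finset.sum_congr rfl fun p _ => ?_
  rw [coeff_inVar_mul, Finset.mul_sum]
  refine Finset.sum_congr (by simp [hij.symm]) fun q _ => ?_
  rw [coeff_inVar_mul, Finset.mul_sum, Finset.mul_sum]
  refine Finset.sum_congr (by simp [hik.symm, hjk.symm]) fun r _ => ?_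
  rw [invCoeff, invCoeff, invCoeff]

theorem coeff_lagrange_twoPoint {i j k : Fin 3} (hij : i ≠ j) (hik : i ≠ k) (hjk : j ≠ k)
    (n : Fin 3 →₀ ℕ) :
    MvPowerSeries.coeff n (lagrange (twoPoint i j k)) =
      if n k = 0 then twoPointCoeff (n i) (n j) else 0 := by
  split_ifs with hk
  · rw [coeff_lagrange_fin_three hij hik hjk, hk, twoPointCoeff]
    refine Finset.sum_congr rfl fun p _ => Finset.sum_congr rfl fun q _ => ?_
    rw [Finset.Nat.antidiagonal_zero, Finset.sum_singleton, invCoeff_zero_zero, one_mul, twoPoint,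
      coeff_joinSeries]
    simp [hij, hik, hjk]
  · have h0 : euler PartRing k (twoPoint i j k) = 0 := by
      ext1 m
      rw [coeff_euler, twoPoint, coeff_joinSeries]
      by_cases h : m k = 0 <;> simp [h]
    have h := congrArg (MvPowerSeries.coeff n) (euler_lagrange k (twoPoint i j k))
    rw [h0, mul_zero, map_zero, map_zero, coeff_euler] at h
    exact (mul_eq_zero.1 h).resolve_left (Nat.cast_ne_zero.2 hk)

theorem coeff_twoPartSeries_eq {i j k : Fin 3} (hij : i ≠ j) (hik : i ≠ k) (hjk : j ≠ k)
    (n : Fin 3 →₀ ℕ) :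
    MvPowerSeries.coeff n (twoPartSeries i j k) =
      if n k = 0 then twoCoeff (n i) (n j) else 0 := by
  rw [coeff_twoPartSeries, coeff_lagrange_twoPoint hij hik hjk]
  have h : n 0 + n 1 + n 2 = n i + n j + n k := by
    have := Fin.sum_univ_three fun l => n l
    rw [← this, univ_fin_three hij hik hjk, Finset.sum_insert (by simp [hij, hik]),
      Finset.sum_insert (by simp [hjk]), Finset.sum_singleton, add_assoc]
  split_ifs with hk
  · rw [h, hk, add_zero, twoCoeff]
  · rw [smul_zero]

theorem coeff_threePartSeries (n : Fin 3 →₀ ℕ) :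
    MvPowerSeries.coeff n threePartSeries = threeCoeff (n 0) (n 1) (n 2) := by
  rw [threePartSeries, coeff_lagrange_fin_three (i := 0) (j := 1) (k := 2) (by decide) (by decide)
    (by decide), threeCoeff]
  refine Finset.sum_congr rfl fun p _ => Finset.sum_congr rfl fun q _ =>
    Finset.sum_congr rfl fun r _ => ?_
  rw [coeff_threePoint]
  simp

/-- The coefficients of a product of two series that share only the variable `xᵢ`. -/
theorem coeff_mul_of_disjoint {R : Type*} [CommRing R] {i j k : Fin 3} (hij : i ≠ j) (hik : i ≠ k)
    (hjk : j ≠ k) {φ ψ : ℕ → ℕ → R} {F G : MvPowerSeries (Fin 3) R}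
    (hF : ∀ n, MvPowerSeries.coeff n F = if n k = 0 then φ (n i) (n j) else 0)
    (hG : ∀ n, MvPowerSeries.coeff n G = if n j = 0 then ψ (n i) (n k) else 0) (n : Fin 3 →₀ ℕ) :
    MvPowerSeries.coeff n (F * G) = ∑ p ∈ Finset.HasAntidiagonal.antidiagonal (n i),
      φ p.1 (n j) * ψ p.2 (n k) := by
  classical
  rw [MvPowerSeries.coeff_mul]
  symm
  refine Finset.sum_of_injOn (fun p => (((n.update i p.1).update k 0, (n.update i p.2).update j 0) :
    (Fin 3 →₀ ℕ) × (Fin 3 →₀ ℕ))) ?_ ?_ ?_ ?_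
  · rintro ⟨a, b⟩ _ ⟨c, d⟩ _ h
    simp only [Prod.mk.injEq] at h
    have h1 := DFunLike.congr_fun h.1 i
    have h2 := DFunLike.congr_fun h.2 i
    simp only [Finsupp.update_apply, hij, hik, if_false, if_true] at h1 h2
    rw [h1, h2]
  · rintro ⟨a, b⟩ h
    rw [Finset.mem_coe, Finset.HasAntidiagonal.mem_antidiagonal] at h ⊢
    ext l
    rcases forall_fin_three hij hik hjk l with rfl | rfl | rfl
    · simpa [hij, hik] using h
    · simp [hij.symm, hjk]
    · simp [hik.symm, hjk.symm]
  · rintro ⟨p, q⟩ h hn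
    rw [Finset.HasAntidiagonal.mem_antidiagonal] at h
    rw [hF, hG]
    by_cases hk : p k = 0
    · by_cases hj : q j = 0
      · exfalso
        apply hn
        refine ⟨(p i, q i), ?_, ?_⟩
        · rw [Finset.mem_coe, Finset.HasAntidiagonal.mem_antidiagonal, ← h]
          rfl
        · simp only [Prod.mk.injEq]
          constructor
          · ext l
            rcases forall_fin_three hij hik hjk l with rfl | rfl | rfl
            · simp [hik]
            · simp [← h, hij.symm, hjk, hj]
            · simp [hk]
          · ext l
            rcases forall_fin_three hij hik hjk l with rfl | rfl | rfl
            · simp [hij]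
            · simp [hj]
            · simp [← h, hik.symm, hjk.symm, hk]
      · simp [hj]
    · simp [hk]
  · rintro ⟨a, b⟩ _
    rw [hF, hG]
    simp [hij, hik, hij.symm, hik.symm, hjk, hjk.symm]

/-- The generating series over `β` of the numbers of minimal transitive words, divided by `r!`, for a
cycle of length `a`. -/
noncomputable def onePart (a : ℕ) : PartRing := PowerSeries.coeff a serF

/-- The generating series over `β` of the numbers of minimal transitive words, divided by `r!`, for a
permutation with cycles of lengths `a` and `b`. -/
noncomputable def twoPart (a b : ℕ) : PartRing := a * b * twoCoeff a b

/-- The generating series over `β` of the numbers of minimal transitive words, divided by `r!`, for a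
permutation with cycles of lengths `a`, `b` and `c`. -/
noncomputable def threePart (a b c : ℕ) : PartRing := a * b * c * threeCoeff a b c

theorem countDer_natCast_mul (k : ℕ) (F : PartRing) : countDer (k * F) = k * countDer F := by
  rw [← nsmul_eq_mul, map_nsmul, nsmul_eq_mul]

/-- The cut-and-join recursion for one part. -/
theorem countDer_onePart (a : ℕ) :
    2 * (countDer (onePart a) - onePart a) =
      a * ∑ p ∈ Finset.HasAntidiagonal.antidiagonal a, onePart p.1 * onePart p.2 := by
  have h1 := coeffDer_serF ()
  have h2 := euler_serF ()
  have h3 : (2 : MvPowerSeries Unit PartRing) * (coeffDer countDer (inVar () serF) - inVar () serF)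
      = euler PartRing () (inVar () (serF * serF)) := by
    rw [map_mul, Derivation.leibniz, h1, h2, smul_eq_mul]
    ring
  have h4 := congrArg (MvPowerSeries.coeff (Finsupp.single () a)) h3
  rw [← Nat.cast_ofNat, coeff_natCast_mul, map_sub (MvPowerSeries.coeff _), coeff_coeffDer,
    coeff_euler, coeff_single_inVar, coeff_single_inVar, PowerSeries.coeff_mul] at h4
  simpa [onePart] using h4

/-- The cut-and-join recursion for two parts, coefficientwise. -/
theorem countDer_twoPart {a b : ℕ} (ha : a ≠ 0) (hb : b ≠ 0) :
    countDer (twoPart a b) = a * b * onePart (a + b) +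
      a * ∑ p ∈ Finset.HasAntidiagonal.antidiagonal a, onePart p.1 * twoPart p.2 b +
      b * ∑ p ∈ Finset.HasAntidiagonal.antidiagonal b, onePart p.1 * twoPart a p.2 := by
  have h := congrArg (MvPowerSeries.coeff (Finsupp.equivFunOnFinite.symm ![a, b, 0]))
    (coeffDer_twoPartSeries (i := 0) (j := 1) (k := 2) (by decide) (by decide) (by decide))
  rw [coeff_coeffDer, map_add, map_add, coeff_inVar_mul, coeff_inVar_mul, coeff_joinSeries,
    coeff_twoPartSeries_eq (by decide) (by decide) (by decide)] at h
  simp only [coeff_euler, coeff_twoPartSeries_eq (show (0 : Fin 3) ≠ 1 by decide)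
    (show (0 : Fin 3) ≠ 2 by decide) (show (1 : Fin 3) ≠ 2 by decide)] at h
  simp [ha, hb] at h
  rw [twoPart, mul_assoc, countDer_natCast_mul, countDer_natCast_mul, h, Finset.mul_sum,
    Finset.mul_sum, mul_add, mul_add, mul_add, mul_add, Finset.mul_sum, Finset.mul_sum,
    Finset.mul_sum, Finset.mul_sum]
  congr 1
  · congr 1
    · rw [onePart]; ring
    · refine Finset.sum_congr rfl fun p _ => ?_
      rw [onePart, twoPart]; ring
  · refine Finset.sum_congr rfl fun p _ => ?_
    rw [onePart, twoPart]; ring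

theorem headSeries_twoCoeff {i j k : Fin 3} (hij : i ≠ j) (hik : i ≠ k) (hjk : j ≠ k) :
    headSeries i j k (fun m l => m * twoCoeff m l) = euler PartRing i (twoPartSeries i k j) := by
  ext1 n
  rw [coeff_headSeries, coeff_euler, coeff_twoPartSeries_eq hik hij hjk.symm]
  by_cases h0 : n i = 0 <;> by_cases h1 : n j = 0 <;> simp [h0, h1]

theorem sub_mul_joinSeries_twoCoeff {i j k : Fin 3} (hij : i ≠ j) (hik : i ≠ k) (hjk : j ≠ k) :
    (MvPowerSeries.X i - MvPowerSeries.X j) * joinSeries i j k (fun m l => m * twoCoeff m l) =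
      MvPowerSeries.X j * euler PartRing i (twoPartSeries i k j) -
      MvPowerSeries.X i * euler PartRing j (twoPartSeries j k i) := by
  rw [sub_mul_joinSeries hij hik hjk, headSeries_twoCoeff hij hik hjk,
    headSeries_twoCoeff hij.symm hjk hik]

theorem coeff_euler_mul_euler {i j k : Fin 3} (hij : i ≠ j) (hik : i ≠ k) (hjk : j ≠ k)
    (n : Fin 3 →₀ ℕ) :
    MvPowerSeries.coeff n
      (euler PartRing i (twoPartSeries i j k) * euler PartRing i (twoPartSeries i k j)) =
    ∑ p ∈ Finset.HasAntidiagonal.antidiagonal (n i),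
      (p.1 * twoCoeff p.1 (n j)) * (p.2 * twoCoeff p.2 (n k)) := by
  refine coeff_mul_of_disjoint (φ := fun a b => a * twoCoeff a b)
    (ψ := fun a b => a * twoCoeff a b) hij hik hjk (fun m => ?_) (fun m => ?_) n
  · rw [coeff_euler, coeff_twoPartSeries_eq hij hik hjk]; simp
  · rw [coeff_euler, coeff_twoPartSeries_eq hik hij hjk.symm]; simp

/-- The cut-and-join recursion for three parts, coefficientwise. -/
theorem countDer_threePart {a b c : ℕ} (ha : a ≠ 0) (hb : b ≠ 0) (hc : c ≠ 0) :
    countDer (threePart a b c) + threePart a b c =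
      a * b * twoPart (a + b) c + a * c * twoPart (a + c) b + b * c * twoPart (b + c) a +
      a * ∑ p ∈ Finset.HasAntidiagonal.antidiagonal a,
        (onePart p.1 * threePart p.2 b c + twoPart p.1 b * twoPart p.2 c) +
      b * ∑ p ∈ Finset.HasAntidiagonal.antidiagonal b,
        (onePart p.1 * threePart a p.2 c + twoPart p.1 a * twoPart p.2 c) +
      c * ∑ p ∈ Finset.HasAntidiagonal.antidiagonal c,
        (onePart p.1 * threePart a b p.2 + twoPart p.1 a * twoPart p.2 b) := by
  have j01 := sub_mul_joinSeries_twoCoeff (i := 0) (j := 1) (k := 2) (by decide) (by decide)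
    (by decide)
  have j02 := sub_mul_joinSeries_twoCoeff (i := 0) (j := 2) (k := 1) (by decide) (by decide)
    (by decide)
  have j12 := sub_mul_joinSeries_twoCoeff (i := 1) (j := 2) (k := 0) (by decide) (by decide)
    (by decide)
  rw [twoPartSeries_comm 2 1 0] at j02
  rw [twoPartSeries_comm 1 0 2, twoPartSeries_comm 2 0 1] at j12
  have h := coeffDer_threePartSeries j01 j02 j12
  have e1 := coeff_euler_mul_euler (i := 1) (j := 0) (k := 2) (by decide) (by decide) (by decide)
    (Finsupp.equivFunOnFinite.symm ![a, b, c])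
  have e2 := coeff_euler_mul_euler (i := 2) (j := 0) (k := 1) (by decide) (by decide) (by decide)
    (Finsupp.equivFunOnFinite.symm ![a, b, c])
  rw [twoPartSeries_comm 1 0 2] at e1
  rw [twoPartSeries_comm 2 0 1, twoPartSeries_comm 2 1 0] at e2
  replace h := congrArg (MvPowerSeries.coeff (Finsupp.equivFunOnFinite.symm ![a, b, c])) h
  rw [map_add, coeff_coeffDer, map_add, map_add, map_add, map_add, map_add, map_add, e1, e2,
    coeff_euler_mul_euler (by decide) (by decide) (by decide), Fin.sum_univ_three, map_add, map_add,
    coeff_inVar_mul, coeff_inVar_mul, coeff_inVar_mul, coeff_joinSeries, coeff_joinSeries,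
    coeff_joinSeries] at h
  simp only [coeff_euler, coeff_threePartSeries] at h
  simp [ha, hb, hc] at h
  rw [threePart, mul_assoc, mul_assoc, countDer_natCast_mul, countDer_natCast_mul,
    countDer_natCast_mul, ← mul_add, ← mul_add, ← mul_add, h]
  simp only [twoPart, threePart, onePart, Finset.mul_sum, Finset.sum_add_distrib, mul_add]
  push_cast
  ring_nf

theorem coeff_onePart {a : ℕ} (ha : a ≠ 0) (β : ℕ →₀ ℕ) :
    MvPowerSeries.coeff β (onePart a) =
      if partSum β = a ∧ β 0 = 0 then (a : ℚ)⁻¹ * (a ^ partCount β / multFactorial β) else 0 := by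
  have h := congrArg (MvPowerSeries.coeff β) (coeff_serF a)
  rw [if_neg ha, sub_zero, serE_pow, coeff_gradedSeries, ← nsmul_eq_mul, map_nsmul,
    nsmul_eq_mul] at h
  have ha' : (a : ℚ) ≠ 0 := Nat.cast_ne_zero.2 ha
  rw [onePart, ← mul_right_inj' ha', h]
  split_ifs
  · field_simp
  · simp

theorem onePart_zero : onePart 0 = 0 := coeff_zero_serF

theorem coeff_zero_serU_of_ne {k : ℕ} (hk : k ≠ 0) :
    MvPowerSeries.constantCoeff (PowerSeries.coeff k serU) = 0 := by
  rw [← MvPowerSeries.coeff_zero_eq_constantCoeff_apply, serU, coeff_gradedSeries, if_neg]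
  simp [hk.symm]

theorem coeff_zero_twoPart (a b : ℕ) : MvPowerSeries.coeff 0 (twoPart a b) = 0 := by
  rw [MvPowerSeries.coeff_zero_eq_constantCoeff_apply, twoPart, map_mul, twoCoeff,
    MvPowerSeries.constantCoeff_smul, twoPointCoeff, map_sum, Finset.sum_eq_zero, smul_zero,
    mul_zero]
  intro p _
  rw [map_sum, Finset.sum_eq_zero]
  intro q _
  rw [map_mul, map_mul]
  split_ifs with h
  · rw [coeff_zero_serU_of_ne (by omega)]; simp
  · simp

/-! ### Words and shuffles -/

section Words

variable {α : Type*}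

/-- `∑ f(L) / (2^r r!)` over the words `L` of length `r` in the alphabet `E`. -/
def wordSum (E : Finset α) : ℕ → (List α → ℚ) → ℚ
  | 0, f => f []
  | r + 1, f => (∑ e ∈ E, wordSum E r fun L => f (e :: L)) / (2 * (r + 1))

theorem wordSum_succ (E : Finset α) (r : ℕ) (f : List α → ℚ) :
    2 * ((r : ℚ) + 1) * wordSum E (r + 1) f = ∑ e ∈ E, wordSum E r fun L => f (e :: L) := by
  have : (2 * ((r : ℚ) + 1)) ≠ 0 := by positivity
  rw [wordSum]
  field_simp

theorem wordSum_congr (E : Finset α) (r : ℕ) {f g : List α → ℚ}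
    (h : ∀ L : List α, (∀ e ∈ L, e ∈ E) → f L = g L) : wordSum E r f = wordSum E r g := by
  induction r generalizing f g with
  | zero => exact h [] (by simp)
  | succ r ih =>
    rw [wordSum, wordSum]
    congr 1
    refine Finset.sum_congr rfl fun e he => ih fun L hL => h _ ?_
    simpa using ⟨he, hL⟩

theorem wordSum_zero (E : Finset α) (r : ℕ) : wordSum E r (fun _ => 0) = 0 := by
  induction r with
  | zero => rfl
  | succ r ih => rw [wordSum, ih]; simp

theorem wordSum_add (E : Finset α) (r : ℕ) (f g : List α → ℚ) :
    wordSum E r (fun L => f L + g L) = wordSum E r f + wordSum E r g := by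
  induction r generalizing f g with
  | zero => rfl
  | succ r ih => simp only [wordSum, ih, Finset.sum_add_distrib, add_div]

theorem wordSum_sum {ι : Type*} (E : Finset α) (r : ℕ) (s : Finset ι) (f : ι → List α → ℚ) :
    wordSum E r (fun L => ∑ i ∈ s, f i L) = ∑ i ∈ s, wordSum E r (f i) := by
  classical
  induction s using Finset.induction_on with
  | empty => simpa using wordSum_zero E r
  | insert a s ha ih =>
    simp only [Finset.sum_insert ha]
    rw [wordSum_add, ih]

theorem wordSum_subset {E E' : Finset α} (hE : E' ⊆ E) (r : ℕ) {f : List α → ℚ}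
    (h : ∀ L : List α, (∀ e ∈ L, e ∈ E) → (∃ e ∈ L, e ∉ E') → f L = 0) :
    wordSum E r f = wordSum E' r f := by
  classical
  induction r generalizing f with
  | zero => rfl
  | succ r ih =>
    rw [wordSum, wordSum]
    congr 1
    rw [← Finset.sum_subset hE]
    · refine Finset.sum_congr rfl fun e he => ih fun L hL ⟨a, ha, ha'⟩ => h _ ?_ ⟨a, ?_, ha'⟩
      · exact List.forall_mem_cons.2 ⟨hE he, hL⟩
      · exact List.mem_cons_of_mem _ ha
    · intro e he he'
      rw [← wordSum_zero E r]
      exact wordSum_congr _ _ fun L hL =>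
        h _ (List.forall_mem_cons.2 ⟨he, hL⟩) ⟨e, List.mem_cons_self, he'⟩

/-- A word over a disjoint union is a shuffle of two words, so that normalized counts multiply like
exponential generating functions. -/
theorem wordSum_shuffle [DecidableEq α] {E₁ E₂ : Finset α} (hE : Disjoint E₁ E₂) (r : ℕ)
    (g h : List α → ℚ) :
    wordSum (E₁ ∪ E₂) r
      (fun L => g (L.filter (· ∈ E₁)) * h (L.filter (· ∈ E₂))) =
      ∑ p ∈ Finset.HasAntidiagonal.antidiagonal r, wordSum E₁ p.1 g * wordSum E₂ p.2 h := by
  induction r generalizing g h with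
  | zero => simp [wordSum]
  | succ r ih =>
    have hr : (2 * ((r : ℚ) + 1)) ≠ 0 := by positivity
    rw [← mul_right_inj' hr, wordSum_succ, Finset.sum_union hE]
    have h1 : ∀ e ∈ E₁, wordSum (E₁ ∪ E₂) r
        (fun L => g ((e :: L).filter (· ∈ E₁)) * h ((e :: L).filter (· ∈ E₂))) =
        ∑ p ∈ Finset.HasAntidiagonal.antidiagonal r,
          wordSum E₁ p.1 (fun L => g (e :: L)) * wordSum E₂ p.2 h := fun e he => by
      have he' : e ∉ E₂ := Finset.disjoint_left.1 hE he
      rw [← ih]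
      simp [he, he']
    have h2 : ∀ e ∈ E₂, wordSum (E₁ ∪ E₂) r
        (fun L => g ((e :: L).filter (· ∈ E₁)) * h ((e :: L).filter (· ∈ E₂))) =
        ∑ p ∈ Finset.HasAntidiagonal.antidiagonal r,
          wordSum E₁ p.1 g * wordSum E₂ p.2 (fun L => h (e :: L)) := fun e he => by
      have he' : e ∉ E₁ := Finset.disjoint_right.1 hE he
      rw [← ih]
      simp [he, he']
    rw [Finset.sum_congr rfl h1, Finset.sum_congr rfl h2, Finset.sum_comm, Finset.sum_comm (s := E₂)]
    simp only [← Finset.sum_mul, ← Finset.mul_sum, ← wordSum_succ]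
    have h3 : ∑ p ∈ Finset.HasAntidiagonal.antidiagonal (r + 1),
        (p.1 : ℚ) * (wordSum E₁ p.1 g * wordSum E₂ p.2 h) =
        ∑ p ∈ Finset.HasAntidiagonal.antidiagonal r,
          ((p.1 : ℚ) + 1) * (wordSum E₁ (p.1 + 1) g * wordSum E₂ p.2 h) := by
      rw [Finset.Nat.sum_antidiagonal_succ]
      simp
    have h4 : ∑ p ∈ Finset.HasAntidiagonal.antidiagonal (r + 1),
        (p.2 : ℚ) * (wordSum E₁ p.1 g * wordSum E₂ p.2 h) =
        ∑ p ∈ Finset.HasAntidiagonal.antidiagonal r,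
          ((p.2 : ℚ) + 1) * (wordSum E₁ p.1 g * wordSum E₂ (p.2 + 1) h) := by
      rw [Finset.Nat.sum_antidiagonal_succ']
      simp
    have h5 : ∀ p ∈ Finset.HasAntidiagonal.antidiagonal (r + 1),
        2 * ((r : ℚ) + 1) * (wordSum E₁ p.1 g * wordSum E₂ p.2 h) =
        2 * ((p.1 : ℚ) * (wordSum E₁ p.1 g * wordSum E₂ p.2 h)) +
        2 * ((p.2 : ℚ) * (wordSum E₁ p.1 g * wordSum E₂ p.2 h)) := fun p hp => by
      rw [Finset.HasAntidiagonal.mem_antidiagonal] at hp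
      have : (r : ℚ) + 1 = p.1 + p.2 := by exact_mod_cast hp.symm
      rw [this]
      ring
    rw [Finset.mul_sum, Finset.sum_congr rfl h5, Finset.sum_add_distrib, ← Finset.mul_sum,
      ← Finset.mul_sum, h3, h4, Finset.mul_sum, Finset.mul_sum]
    congr 1 <;> refine Finset.sum_congr rfl fun p _ => ?_ <;> ring

end Words

open Classical in
/-- The indicator of a proposition. -/
noncomputable def ind (P : Prop) : ℚ := if P then 1 else 0

theorem ind_true {P : Prop} (h : P) : ind P = 1 := by rw [ind, if_pos h]

theorem ind_false {P : Prop} (h : ¬P) : ind P = 0 := by rw [ind, if_neg h]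

/-! ### Cycles and transitive words -/

section Cycles

open Equiv

set_option linter.unusedSectionVars false

variable {X : Type*} [Fintype X] [DecidableEq X]

/-- The cycle of a permutation through a point, as a set; it is a singleton at a fixed point. -/
def cycleSet (γ : Perm X) (x : X) : Finset X := Finset.univ.filter fun y => γ.SameCycle x y

/-- The cycles of `γ` through the points of `S`. -/
def cyclesOn (γ : Perm X) (S : Finset X) : Finset (Finset X) := S.image (cycleSet γ)

/-- The cycle type of `γ` on `S`, fixed points included, as a function from lengths to
multiplicities. -/
noncomputable def typeOn (γ : Perm X) (S : Finset X) : ℕ →₀ ℕ :=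
  ∑ C ∈ cyclesOn γ S, Finsupp.single C.card 1

/-- `S` is a union of cycles of `γ`. -/
def IsStable (γ : Perm X) (S : Finset X) : Prop := ∀ x, γ x ∈ S ↔ x ∈ S

/-- The product `τ_r ⋯ τ_1 γ` for a word `(τ_1, …, τ_r)` of transpositions, each given by an ordered
pair of points. -/
def act : List (X × X) → Perm X → Perm X
  | [], γ => γ
  | p :: L, γ => act L (swap p.1 p.2 * γ)

/-- The permutation `γ` and the transpositions of the word `L` act transitively on `S`. -/
def IsConnectedOn (S : Finset X) (γ : Perm X) (L : List (X × X)) : Prop :=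
  ∀ S' ⊆ S, S'.Nonempty → IsStable γ S' → (∀ p ∈ L, p.1 ∈ S' ↔ p.2 ∈ S') → S' = S

/-- The normalized number of words `L` of `r` transpositions in `S` that act transitively on `S`
together with `γ`, and for which `act L γ` has cycle type `β` on `S`. Each transposition comes from
two ordered pairs, which the factor `1 / 2^r` in `wordSum` makes up for. -/
noncomputable def transCount (S : Finset X) (γ : Perm X) (β : ℕ →₀ ℕ) (r : ℕ) : ℚ :=
  wordSum S.offDiag r fun L => ind (typeOn (act L γ) S = β) * ind (IsConnectedOn S γ L)

theorem mem_cycleSet {γ : Perm X} {x y : X} : y ∈ cycleSet γ x ↔ γ.SameCycle x y := by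
  simp [cycleSet]

theorem self_mem_cycleSet (γ : Perm X) (x : X) : x ∈ cycleSet γ x :=
  mem_cycleSet.2 (Perm.SameCycle.refl _ _)

theorem cycleSet_eq_iff {γ : Perm X} {x y : X} :
    cycleSet γ x = cycleSet γ y ↔ γ.SameCycle x y := by
  constructor
  · intro h
    rw [← mem_cycleSet, h]
    exact self_mem_cycleSet _ _
  · intro h
    ext z
    rw [mem_cycleSet, mem_cycleSet]
    exact ⟨h.symm.trans, h.trans⟩

theorem IsStable.pow {γ : Perm X} {S : Finset X} (h : IsStable γ S) (k : ℕ) (x : X) :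
    (γ ^ k) x ∈ S ↔ x ∈ S := by
  induction k with
  | zero => simp
  | succ k ih => rw [pow_succ', Perm.mul_apply, h, ih]

theorem IsStable.mem_iff {γ : Perm X} {S : Finset X} (h : IsStable γ S) {x y : X}
    (hxy : γ.SameCycle x y) : x ∈ S ↔ y ∈ S := by
  obtain ⟨k, _, rfl⟩ := hxy.exists_pow_eq'
  rw [h.pow]

theorem isStable_iff {γ : Perm X} {S : Finset X} :
    IsStable γ S ↔ ∀ x y, γ.SameCycle x y → (x ∈ S ↔ y ∈ S) :=
  ⟨fun h _ _ hxy => h.mem_iff hxy,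
    fun h x => (h x (γ x) (Perm.sameCycle_apply_right.2 (Perm.SameCycle.refl _ _))).symm⟩

theorem IsStable.cycleSet_subset {γ : Perm X} {S : Finset X} (h : IsStable γ S) {x : X}
    (hx : x ∈ S) : cycleSet γ x ⊆ S := fun _ hy => (h.mem_iff (mem_cycleSet.1 hy)).1 hx

theorem isStable_cycleSet (γ : Perm X) (x : X) : IsStable γ (cycleSet γ x) :=
  isStable_iff.2 fun y z hyz => by
    rw [mem_cycleSet, mem_cycleSet]
    exact ⟨fun h => h.trans hyz, fun h => h.trans hyz.symm⟩

theorem IsStable.sdiff {γ : Perm X} {S T : Finset X} (hS : IsStable γ S) (hT : IsStable γ T) :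
    IsStable γ (S \ T) := fun x => by
  rw [Finset.mem_sdiff, Finset.mem_sdiff, hS, hT]

theorem IsStable.inter {γ : Perm X} {S T : Finset X} (hS : IsStable γ S) (hT : IsStable γ T) :
    IsStable γ (S ∩ T) := fun x => by
  rw [Finset.mem_inter, Finset.mem_inter, hS, hT]

theorem swap_apply_mem_iff {S : Finset X} {a b : X} (h : a ∈ S ↔ b ∈ S) (x : X) :
    swap a b x ∈ S ↔ x ∈ S := by
  by_cases h1 : x = a
  · rw [h1, swap_apply_left, h]
  · by_cases h2 : x = b
    · rw [h2, swap_apply_right, h]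
    · rw [swap_apply_of_ne_of_ne h1 h2]

theorem isStable_swap_mul {γ : Perm X} {S : Finset X} {a b : X} (h : a ∈ S ↔ b ∈ S) :
    IsStable (swap a b * γ) S ↔ IsStable γ S :=
  forall_congr' fun x => by rw [Perm.mul_apply, swap_apply_mem_iff h]

theorem sameCycle_congr {γ γ' : Perm X} {S : Finset X} (hS : IsStable γ S)
    (h : ∀ x ∈ S, γ x = γ' x) {x y : X} (hx : x ∈ S) (hxy : γ.SameCycle x y) :
    γ'.SameCycle x y := by
  obtain ⟨k, rfl⟩ := hxy.exists_nat_pow_eq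
  refine ⟨k, ?_⟩
  rw [zpow_natCast]
  clear hxy
  induction k with
  | zero => rfl
  | succ k ih =>
    rw [pow_succ', pow_succ', Perm.mul_apply, Perm.mul_apply, ih, h _ ((hS.pow k x).2 hx)]

theorem IsStable.congr {γ γ' : Perm X} {S : Finset X} (hS : IsStable γ S)
    (h : ∀ x ∈ S, γ x = γ' x) : IsStable γ' S := by
  have h1 : ∀ x ∈ S, γ' x ∈ S := fun x hx => by rw [← h x hx, hS]; exact hx
  have h2 : S.image γ' = S :=
    Finset.eq_of_subset_of_card_le (Finset.image_subset_iff.2 h1)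
      (Finset.card_image_of_injective _ γ'.injective).ge
  intro x
  refine ⟨fun hx => ?_, h1 x⟩
  rw [← h2] at hx
  obtain ⟨y, hy, hyx⟩ := Finset.mem_image.1 hx
  rwa [← γ'.injective hyx]

theorem cycleSet_congr {γ γ' : Perm X} {S : Finset X} (hS : IsStable γ S)
    (h : ∀ x ∈ S, γ x = γ' x) {x : X} (hx : x ∈ S) : cycleSet γ x = cycleSet γ' x := by
  ext y
  rw [mem_cycleSet, mem_cycleSet]
  exact ⟨sameCycle_congr hS h hx, sameCycle_congr (hS.congr h) (fun z hz => (h z hz).symm) hx⟩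

theorem cyclesOn_congr {γ γ' : Perm X} {S : Finset X} (hS : IsStable γ S)
    (h : ∀ x ∈ S, γ x = γ' x) : cyclesOn γ S = cyclesOn γ' S :=
  Finset.image_congr fun _ hx => cycleSet_congr hS h hx

theorem disjoint_cyclesOn {γ : Perm X} {S T : Finset X} (hS : IsStable γ S)
    (hd : Disjoint S T) : Disjoint (cyclesOn γ S) (cyclesOn γ T) := by
  rw [Finset.disjoint_left]
  intro C hC hC'
  obtain ⟨x, hx, rfl⟩ := Finset.mem_image.1 hC
  obtain ⟨y, hy, hxy⟩ := Finset.mem_image.1 hC'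
  exact Finset.disjoint_left.1 hd ((hS.mem_iff (cycleSet_eq_iff.1 hxy)).2 hx) hy

theorem cyclesOn_union (γ : Perm X) (S T : Finset X) :
    cyclesOn γ (S ∪ T) = cyclesOn γ S ∪ cyclesOn γ T := Finset.image_union _ _

theorem typeOn_eq_add {γ : Perm X} {S T : Finset X} (hT : T ⊆ S) (hT' : IsStable γ T) :
    typeOn γ S = typeOn γ T + typeOn γ (S \ T) := by
  conv_lhs => rw [typeOn, ← Finset.union_sdiff_of_subset hT, cyclesOn_union,
    Finset.sum_union (disjoint_cyclesOn hT' Finset.disjoint_sdiff)]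
  rfl

theorem card_cyclesOn_eq_add {γ : Perm X} {S T : Finset X} (hT : T ⊆ S)
    (hT' : IsStable γ T) :
    (cyclesOn γ S).card = (cyclesOn γ T).card + (cyclesOn γ (S \ T)).card := by
  conv_lhs => rw [← Finset.union_sdiff_of_subset hT, cyclesOn_union,
    Finset.card_union_of_disjoint (disjoint_cyclesOn hT' Finset.disjoint_sdiff)]

theorem partCount_typeOn (γ : Perm X) (S : Finset X) :
    partCount (typeOn γ S) = (cyclesOn γ S).card := by
  rw [typeOn, map_sum]
  simp

theorem act_eq_on {γ γ' : Perm X} {T : Finset X} (hT : IsStable γ T)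
    (h : ∀ x ∈ T, γ x = γ' x) {L : List (X × X)}
    (hL : ∀ p ∈ L, p ∈ T.offDiag ∨ (p.1 ∉ T ∧ p.2 ∉ T)) :
    IsStable (act L γ) T ∧ ∀ x ∈ T, act L γ x = act (L.filter (· ∈ T.offDiag)) γ' x := by
  induction L generalizing γ γ' with
  | nil => exact ⟨hT, h⟩
  | cons p L ih =>
    have hL' := fun q hq => hL q (List.mem_cons_of_mem _ hq)
    by_cases hp : p ∈ T.offDiag
    · have hp' := Finset.mem_offDiag.1 hp
      rw [List.filter_cons_of_pos (by simpa using hp)]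
      exact ih ((isStable_swap_mul (by simp [hp'.1, hp'.2.1])).2 hT)
        (fun x hx => by rw [Perm.mul_apply, Perm.mul_apply, h x hx]) hL'
    · obtain ⟨h1, h2⟩ := (hL p List.mem_cons_self).resolve_left hp
      rw [List.filter_cons_of_neg (by simpa using hp)]
      refine ih ((isStable_swap_mul (by simp [h1, h2])).2 hT) (fun x hx => ?_) hL'
      have hg := (hT x).2 hx
      rw [Perm.mul_apply, swap_apply_of_ne_of_ne, h x hx]
      · intro h; exact h1 (h ▸ hg)
      · intro h; exact h2 (h ▸ hg)

theorem typeOn_act {γ : Perm X} {T : Finset X} (hT : IsStable γ T) {L : List (X × X)}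
    (hL : ∀ p ∈ L, p ∈ T.offDiag ∨ (p.1 ∉ T ∧ p.2 ∉ T)) :
    typeOn (act L γ) T = typeOn (act (L.filter (· ∈ T.offDiag)) γ) T := by
  obtain ⟨h1, h2⟩ := act_eq_on hT (fun _ _ => rfl) hL
  rw [typeOn, typeOn, cyclesOn_congr h1 h2]

/-- The sets that can be the orbit of `p.1` after the first transposition is dropped from a word that
acts transitively on `S` together with `swap p.1 p.2 * γ'`. -/
noncomputable def splittings (S : Finset X) (γ' : Perm X) (p : X × X) : Finset (Finset X) :=
  open Classical in S.powerset.filter fun T => p.1 ∈ T ∧ p.2 ∉ T ∧ IsStable γ' T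

theorem mem_splittings {S : Finset X} {γ' : Perm X} {p : X × X} {T : Finset X} :
    T ∈ splittings S γ' p ↔ T ⊆ S ∧ p.1 ∈ T ∧ p.2 ∉ T ∧ IsStable γ' T := by
  simp [splittings]

/-- Dropping a transposition from a transitive word leaves a transitive word, or one that has exactly
two orbits, which the transposition links. -/
theorem ind_isConnectedOn_cons {S : Finset X} {γ : Perm X} (hS : IsStable γ S) {p : X × X}
    (hp : p ∈ S.offDiag) (L : List (X × X)) (hLS : ∀ q ∈ L, q ∈ S.offDiag) :
    ind (IsConnectedOn S γ (p :: L)) = ind (IsConnectedOn S (swap p.1 p.2 * γ) L) +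
      ∑ T ∈ splittings S (swap p.1 p.2 * γ) p, ind (∀ q ∈ L, q.1 ∈ T ↔ q.2 ∈ T) *
        (ind (IsConnectedOn T (swap p.1 p.2 * γ) L) *
          ind (IsConnectedOn (S \ T) (swap p.1 p.2 * γ) L)) := by
  obtain ⟨hx, hy, hxy⟩ := Finset.mem_offDiag.1 hp
  have hS' : IsStable (swap p.1 p.2 * γ) S := (isStable_swap_mul (by simp [hx, hy])).2 hS
  set γ' := swap p.1 p.2 * γ with hγ'
  have hst : ∀ T : Finset X, (p.1 ∈ T ↔ p.2 ∈ T) → (IsStable γ' T ↔ IsStable γ T) :=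
    fun T h => isStable_swap_mul h
  have hLS' : ∀ q ∈ L, q.1 ∈ S ∧ q.2 ∈ S := fun q hq =>
    ⟨(Finset.mem_offDiag.1 (hLS q hq)).1, (Finset.mem_offDiag.1 (hLS q hq)).2.1⟩
  by_cases h1 : IsConnectedOn S γ' L
  · rw [ind_true h1, ind_true, Finset.sum_eq_zero, add_zero]
    · intro T hT
      obtain ⟨hTS, hxT, hyT, hTst⟩ := mem_splittings.1 hT
      rw [ind_false, zero_mul]
      intro h
      exact hyT (h1 T hTS ⟨_, hxT⟩ hTst h ▸ hy)
    · intro S' hS'S hne hst' hL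
      have hp' := hL p List.mem_cons_self
      exact h1 S' hS'S hne ((hst S' hp').2 hst') fun q hq => hL q (List.mem_cons_of_mem _ hq)
  · rw [ind_false h1, zero_add]
    by_cases h2 : IsConnectedOn S γ (p :: L)
    · rw [ind_true h2]
      -- a set stable under `γ'` and `L` that misses or contains both points is trivial
      have key : ∀ T ⊆ S, IsStable γ' T → (∀ q ∈ L, q.1 ∈ T ↔ q.2 ∈ T) → T.Nonempty →
          (p.1 ∈ T ↔ p.2 ∈ T) → T = S := fun T hTS hT hL hne hpT =>
        h2 T hTS hne ((hst T hpT).1 hT) (List.forall_mem_cons.2 ⟨hpT, hL⟩)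
      obtain ⟨T, hTs, hTL⟩ : ∃ T ∈ splittings S γ' p, ∀ q ∈ L, q.1 ∈ T ↔ q.2 ∈ T := by
        simp only [IsConnectedOn, not_forall] at h1
        obtain ⟨T, hTS, hne, hT, hL, hTne⟩ := h1
        have hpT : ¬(p.1 ∈ T ↔ p.2 ∈ T) := fun h => hTne (key T hTS hT hL hne h)
        by_cases hxT : p.1 ∈ T
        · exact ⟨T, mem_splittings.2 ⟨hTS, hxT, fun h => hpT (by simp [hxT, h]), hT⟩, hL⟩
        · have hyT : p.2 ∈ T := by
            by_contra h
            exact hpT (by simp [hxT, h])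
          refine ⟨S \ T, mem_splittings.2 ⟨Finset.sdiff_subset, by simp [hx, hxT], by simp [hyT],
            hS'.sdiff hT⟩, fun q hq => ?_⟩
          simp [hLS' q hq, hL q hq]
      obtain ⟨hTS, hxT, hyT, hTst⟩ := mem_splittings.1 hTs
      have hc1 : IsConnectedOn T γ' L := by
        intro T' hT' hne hst' hL
        have hyT' : p.2 ∉ T' := fun h => hyT (hT' h)
        have hxT' : p.1 ∈ T' := by
          by_contra h
          have := key T' (hT'.trans hTS) hst' hL hne (by simp [h, hyT'])
          exact hyT' (this ▸ hy)
        by_contra hTT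
        have hne' : (T \ T').Nonempty := Finset.sdiff_nonempty.2 fun h => hTT (hT'.antisymm h)
        have := key (T \ T') (Finset.sdiff_subset.trans hTS) (hTst.sdiff hst')
          (fun q hq => by simp [hTL q hq, hL q hq]) hne' (by simp [hxT', hyT])
        rw [← this] at hx
        simp [hxT'] at hx
      have hc2 : IsConnectedOn (S \ T) γ' L := by
        intro T' hT' hne hst' hL
        have hT'S := hT'.trans Finset.sdiff_subset
        have hxT' : p.1 ∉ T' := fun h => (Finset.mem_sdiff.1 (hT' h)).2 hxT
        have hyT' : p.2 ∈ T' := by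
          by_contra h
          have := key T' hT'S hst' hL hne (by simp [h, hxT'])
          exact hxT' (this ▸ hx)
        by_contra hTT
        have hne' : ((S \ T) \ T').Nonempty :=
          Finset.sdiff_nonempty.2 fun h => hTT (hT'.antisymm h)
        have := key ((S \ T) \ T') (Finset.sdiff_subset.trans Finset.sdiff_subset)
          ((hS'.sdiff hTst).sdiff hst')
          (fun q hq => by simp [hTL q hq, hL q hq, hLS' q hq]) hne' (by simp [hxT, hyT'])
        rw [← this] at hy
        simp [hyT'] at hy
      rw [Finset.sum_eq_single T]
      · rw [ind_true hTL, ind_true hc1, ind_true hc2]; norm_num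
      · intro T' hT' hne
        obtain ⟨hTS', hxT', hyT', hTst'⟩ := mem_splittings.1 hT'
        by_cases hL' : ∀ q ∈ L, q.1 ∈ T' ↔ q.2 ∈ T'
        · by_cases hc' : IsConnectedOn T' γ' L
          · exfalso
            have hI : ∀ q ∈ L, q.1 ∈ T ∩ T' ↔ q.2 ∈ T ∩ T' := fun q hq => by
              simp [hTL q hq, hL' q hq]
            have e1 := hc1 (T ∩ T') Finset.inter_subset_left ⟨p.1, by simp [hxT, hxT']⟩
              (hTst.inter hTst') hI
            have e2 := hc' (T ∩ T') Finset.inter_subset_right ⟨p.1, by simp [hxT, hxT']⟩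
              (hTst.inter hTst') hI
            exact hne (e2.symm.trans e1)
          · rw [ind_false hc', zero_mul, mul_zero]
        · rw [ind_false hL', zero_mul]
      · exact fun h => absurd hTs h
    · rw [ind_false h2, Finset.sum_eq_zero]
      intro T hT
      obtain ⟨hTS, hxT, hyT, hTst⟩ := mem_splittings.1 hT
      by_contra hne
      apply h2
      have hTL : ∀ q ∈ L, q.1 ∈ T ↔ q.2 ∈ T := by
        by_contra h; exact hne (by rw [ind_false h, zero_mul])
      have hc1 : IsConnectedOn T γ' L := by
        by_contra h; exact hne (by rw [ind_false h, zero_mul, mul_zero])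
      have hc2 : IsConnectedOn (S \ T) γ' L := by
        by_contra h; exact hne (by rw [ind_false h, mul_zero, mul_zero])
      intro S' hS'S hne' hst' hL
      have hpS' := hL p List.mem_cons_self
      have hLL : ∀ q ∈ L, q.1 ∈ S' ↔ q.2 ∈ S' := fun q hq => hL q (List.mem_cons_of_mem _ hq)
      have hst'' := (hst S' hpS').2 hst'
      have e1 : (S' ∩ T).Nonempty → S' ∩ T = T := fun h =>
        hc1 _ Finset.inter_subset_right h (hst''.inter hTst)
          fun q hq => by simp [hLL q hq, hTL q hq]
      have e2 : (S' ∩ (S \ T)).Nonempty → S' ∩ (S \ T) = S \ T := fun h =>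
        hc2 _ Finset.inter_subset_right h (hst''.inter (hS'.sdiff hTst))
          fun q hq => by simp [hLL q hq, hTL q hq, hLS' q hq]
      have hmem : p.1 ∈ S' := by
        obtain ⟨z, hz⟩ := hne'
        by_cases hzT : z ∈ T
        · have := e1 ⟨z, by simp [hz, hzT]⟩
          rw [← this] at hxT
          exact (Finset.mem_inter.1 hxT).1
        · have := e2 ⟨z, by simp [hz, hzT, hS'S hz]⟩
          have h3 : p.2 ∈ S \ T := by simp [hy, hyT]
          rw [← this] at h3
          exact hpS'.2 (Finset.mem_inter.1 h3).1
      have f1 := e1 ⟨p.1, by simp [hmem, hxT]⟩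
      have f2 := e2 ⟨p.2, by simp [hpS'.1 hmem, hyT, hy]⟩
      refine hS'S.antisymm fun z hz => ?_
      by_cases hzT : z ∈ T
      · rw [← f1] at hzT
        exact (Finset.mem_inter.1 hzT).1
      · have h3 : z ∈ S \ T := by simp [hz, hzT]
        rw [← f2] at h3
        exact (Finset.mem_inter.1 h3).1

end Cycles

/-! ### The cut-and-join recursion and the Riemann-Hurwitz inequality -/

section Recursion

open Equiv

set_option linter.unusedSectionVars false

variable {X : Type*} [Fintype X] [DecidableEq X]

theorem isConnectedOn_filter {T : Finset X} {γ : Perm X} {L : List (X × X)}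
    (hL : ∀ p ∈ L, p ∈ T.offDiag ∨ (p.1 ∉ T ∧ p.2 ∉ T)) :
    IsConnectedOn T γ L ↔ IsConnectedOn T γ (L.filter (· ∈ T.offDiag)) := by
  refine forall_congr' fun T' => forall_congr' fun hT' => forall_congr' fun _ =>
    forall_congr' fun _ => ?_
  have h : (∀ p ∈ L, p.1 ∈ T' ↔ p.2 ∈ T') ↔
      ∀ p ∈ L.filter (· ∈ T.offDiag), p.1 ∈ T' ↔ p.2 ∈ T' := by
    constructor
    · exact fun h p hp => h p (List.mem_of_mem_filter hp)
    · intro h p hp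
      rcases hL p hp with h' | ⟨h1, h2⟩
      · exact h p (List.mem_filter.2 ⟨hp, by simpa using h'⟩)
      · exact ⟨fun h3 => absurd (hT' h3) h1, fun h3 => absurd (hT' h3) h2⟩
  rw [h]

theorem ind_add_eq (t₁ t₂ β : ℕ →₀ ℕ) :
    ind (t₁ + t₂ = β) =
      ∑ b ∈ Finset.HasAntidiagonal.antidiagonal β, ind (t₁ = b.1) * ind (t₂ = b.2) := by
  by_cases h : t₁ + t₂ = β
  · rw [ind_true h, Finset.sum_eq_single (t₁, t₂)]
    · rw [ind_true rfl, ind_true rfl, mul_one]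
    · rintro ⟨b₁, b₂⟩ _ hb
      by_cases h1 : t₁ = b₁
      · by_cases h2 : t₂ = b₂
        · exact absurd (by rw [h1, h2]) hb
        · rw [ind_false h2, mul_zero]
      · rw [ind_false h1, zero_mul]
    · exact fun h' => absurd (Finset.HasAntidiagonal.mem_antidiagonal.2 h) h'
  · rw [ind_false h, Finset.sum_eq_zero]
    rintro ⟨b₁, b₂⟩ hb
    rw [Finset.HasAntidiagonal.mem_antidiagonal] at hb
    by_cases h1 : t₁ = b₁
    · by_cases h2 : t₂ = b₂
      · exact absurd (by rw [h1, h2, hb]) h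
      · rw [ind_false h2, mul_zero]
    · rw [ind_false h1, zero_mul]

/-- Words that preserve `T` and act transitively on `T` and on `S \ T` are shuffles of transitive words
on the two sets. -/
theorem wordSum_two_orbits {S T : Finset X} {γ : Perm X} (hS : IsStable γ S) (hTS : T ⊆ S)
    (hT : IsStable γ T) (β : ℕ →₀ ℕ) (r : ℕ) :
    wordSum S.offDiag r (fun L => ind (typeOn (act L γ) S = β) *
      (ind (∀ q ∈ L, q.1 ∈ T ↔ q.2 ∈ T) *
        (ind (IsConnectedOn T γ L) * ind (IsConnectedOn (S \ T) γ L)))) =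
    ∑ b ∈ Finset.HasAntidiagonal.antidiagonal β, ∑ s ∈ Finset.HasAntidiagonal.antidiagonal r,
      transCount T γ b.1 s.1 * transCount (S \ T) γ b.2 s.2 := by
  have hd : Disjoint T (S \ T) := Finset.disjoint_sdiff
  have hE : Disjoint T.offDiag (S \ T).offDiag := by
    rw [Finset.disjoint_left]
    intro p hp hp'
    exact Finset.disjoint_left.1 hd (Finset.mem_offDiag.1 hp).1 (Finset.mem_offDiag.1 hp').1
  have hsub : T.offDiag ∪ (S \ T).offDiag ⊆ S.offDiag :=
    Finset.union_subset (Finset.offDiag_mono hTS) (Finset.offDiag_mono Finset.sdiff_subset)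
  rw [wordSum_subset hsub]
  · rw [wordSum_congr (g := fun L => ∑ b ∈ Finset.HasAntidiagonal.antidiagonal β,
      (fun L => ind (typeOn (act L γ) T = b.1) * ind (IsConnectedOn T γ L))
        (L.filter (· ∈ T.offDiag)) *
      (fun L => ind (typeOn (act L γ) (S \ T) = b.2) * ind (IsConnectedOn (S \ T) γ L))
        (L.filter (· ∈ (S \ T).offDiag)))]
    · rw [wordSum_sum]
      refine Finset.sum_congr rfl fun b _ => ?_
      exact wordSum_shuffle hE r (fun L => ind (typeOn (act L γ) T = b.1) *
        ind (IsConnectedOn T γ L)) fun L => ind (typeOn (act L γ) (S \ T) = b.2) *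
          ind (IsConnectedOn (S \ T) γ L)
    · intro L hL
      have hL1 : ∀ p ∈ L, p ∈ T.offDiag ∨ (p.1 ∉ T ∧ p.2 ∉ T) := fun p hp => by
        rcases Finset.mem_union.1 (hL p hp) with h | h
        · exact Or.inl h
        · have h' := Finset.mem_offDiag.1 h
          exact Or.inr ⟨(Finset.mem_sdiff.1 h'.1).2, (Finset.mem_sdiff.1 h'.2.1).2⟩
      have hL2 : ∀ p ∈ L, p ∈ (S \ T).offDiag ∨ (p.1 ∉ S \ T ∧ p.2 ∉ S \ T) := fun p hp => by
        rcases Finset.mem_union.1 (hL p hp) with h | h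
        · have h' := Finset.mem_offDiag.1 h
          exact Or.inr ⟨by simp [h'.1], by simp [h'.2.1]⟩
        · exact Or.inl h
      have hpres : ∀ q ∈ L, q.1 ∈ T ↔ q.2 ∈ T := fun q hq => by
        rcases hL1 q hq with h | ⟨h1, h2⟩
        · have h' := Finset.mem_offDiag.1 h
          simp [h'.1, h'.2.1]
        · simp [h1, h2]
      rw [ind_true hpres, one_mul, typeOn_eq_add hTS (act_eq_on hT (fun _ _ => rfl) hL1).1,
        ind_add_eq, Finset.sum_mul, isConnectedOn_filter hL1, isConnectedOn_filter hL2,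
        typeOn_act hT hL1, typeOn_act (hS.sdiff hT) hL2]
      refine Finset.sum_congr rfl fun b _ => ?_
      ring
  · rintro L hL ⟨e, he, he'⟩
    rw [ind_false (P := ∀ q ∈ L, q.1 ∈ T ↔ q.2 ∈ T), zero_mul, mul_zero]
    intro h
    apply he'
    obtain ⟨h1, h2, h3⟩ := Finset.mem_offDiag.1 (hL e he)
    by_cases heT : e.1 ∈ T
    · exact Finset.mem_union_left _ (Finset.mem_offDiag.2 ⟨heT, (h e he).1 heT, h3⟩)
    · exact Finset.mem_union_right _ (Finset.mem_offDiag.2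
        ⟨by simp [h1, heT], by simp [h2, ← h e he, heT], h3⟩)

/-- The cut-and-join recursion in all genera: drop the transposition next to `γ`. -/
theorem transCount_succ {S : Finset X} {γ : Perm X} (hS : IsStable γ S) (β : ℕ →₀ ℕ) (r : ℕ) :
    2 * ((r : ℚ) + 1) * transCount S γ β (r + 1) =
      ∑ p ∈ S.offDiag, (transCount S (swap p.1 p.2 * γ) β r +
        ∑ T ∈ splittings S (swap p.1 p.2 * γ) p,
          ∑ b ∈ Finset.HasAntidiagonal.antidiagonal β,
            ∑ s ∈ Finset.HasAntidiagonal.antidiagonal r,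
              transCount T (swap p.1 p.2 * γ) b.1 s.1 *
                transCount (S \ T) (swap p.1 p.2 * γ) b.2 s.2) := by
  rw [transCount, wordSum_succ]
  refine Finset.sum_congr rfl fun p hp => ?_
  obtain ⟨hx, hy, _⟩ := Finset.mem_offDiag.1 hp
  have hS' : IsStable (swap p.1 p.2 * γ) S := (isStable_swap_mul (by simp [hx, hy])).2 hS
  rw [wordSum_congr (g := fun L =>
    ind (typeOn (act L (swap p.1 p.2 * γ)) S = β) * ind (IsConnectedOn S (swap p.1 p.2 * γ) L) +
    ∑ T ∈ splittings S (swap p.1 p.2 * γ) p, ind (typeOn (act L (swap p.1 p.2 * γ)) S = β) *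
      (ind (∀ q ∈ L, q.1 ∈ T ↔ q.2 ∈ T) * (ind (IsConnectedOn T (swap p.1 p.2 * γ) L) *
        ind (IsConnectedOn (S \ T) (swap p.1 p.2 * γ) L))))]
  · rw [wordSum_add, wordSum_sum]
    congr 1
    refine Finset.sum_congr rfl fun T hT => ?_
    obtain ⟨hTS, _, _, hTst⟩ := mem_splittings.1 hT
    exact wordSum_two_orbits hS' hTS hTst β r
  · intro L hL
    rw [ind_isConnectedOn_cons hS hp L hL, mul_add, Finset.mul_sum, act]

theorem transCount_zero (S : Finset X) (γ : Perm X) (β : ℕ →₀ ℕ) :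
    transCount S γ β 0 = ind (typeOn γ S = β) * ind (IsConnectedOn S γ []) := rfl

theorem isStable_of_forall_mem {γ : Perm X} {S : Finset X} (h : ∀ x ∈ S, γ x ∈ S) :
    IsStable γ S := by
  have h2 : S.image γ = S :=
    Finset.eq_of_subset_of_card_le (Finset.image_subset_iff.2 h)
      (Finset.card_image_of_injective _ γ.injective).ge
  intro x
  refine ⟨fun hx => ?_, h x⟩
  rw [← h2] at hx
  obtain ⟨y, hy, hyx⟩ := Finset.mem_image.1 hx
  rwa [← γ.injective hyx]

theorem minimalPeriod_pos (γ : Perm X) (x : X) : 0 < Function.minimalPeriod γ x :=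
  Function.minimalPeriod_pos_of_mem_periodicPts (γ.injective.mem_periodicPts x)

theorem cycleSet_eq_image (γ : Perm X) (x : X) :
    cycleSet γ x = (Finset.range (Function.minimalPeriod γ x)).image fun k => (γ^[k]) x := by
  ext y
  rw [mem_cycleSet, Finset.mem_image]
  constructor
  · intro h
    obtain ⟨k, rfl⟩ := h.exists_nat_pow_eq
    refine ⟨k % Function.minimalPeriod γ x, Finset.mem_range.2
      (Nat.mod_lt _ (minimalPeriod_pos γ x)), ?_⟩
    rw [Function.iterate_mod_minimalPeriod_eq, Perm.iterate_eq_pow]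
  · rintro ⟨k, _, rfl⟩
    exact ⟨k, by rw [zpow_natCast, Perm.iterate_eq_pow]⟩

theorem card_cycleSet (γ : Perm X) (x : X) :
    (cycleSet γ x).card = Function.minimalPeriod γ x := by
  rw [cycleSet_eq_image, Finset.card_image_of_injOn, Finset.card_range]
  intro a ha b hb hab
  exact Function.iterate_injOn_Iio_minimalPeriod (by simpa using ha) (by simpa using hb) hab

/-- Multiplication by `swap x (γ^k x)` cuts off a cycle of length `k`. -/
theorem cycleSet_swap_mul_iterate {γ : Perm X} {x : X} {k : ℕ} (hk : 0 < k)
    (hk' : k < Function.minimalPeriod γ x) :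
    cycleSet (swap x (γ^[k] x) * γ) x = (Finset.range k).image fun j => (γ^[j]) x := by
  have hinj : ∀ a b, a < Function.minimalPeriod γ x → b < Function.minimalPeriod γ x →
      (γ^[a]) x = (γ^[b]) x → a = b := fun a b ha hb hab =>
    Function.iterate_injOn_Iio_minimalPeriod ha hb hab
  have hstep : ∀ j < k, (swap x (γ^[k] x) * γ) ((γ^[j]) x) =
      if j + 1 = k then x else (γ^[j + 1]) x := by
    intro j hj
    rw [Perm.mul_apply, ← Function.iterate_succ_apply' γ, Nat.succ_eq_add_one]
    split_ifs with h
    · rw [h, swap_apply_right]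
    · rw [swap_apply_of_ne_of_ne]
      · intro h'
        exact absurd (hinj (j + 1) 0 (by omega) (by omega) h') (by omega)
      · intro h'
        exact h (hinj (j + 1) k (by omega) hk' h')
  apply Finset.Subset.antisymm
  · refine IsStable.cycleSet_subset (isStable_of_forall_mem ?_)
      (Finset.mem_image.2 ⟨0, Finset.mem_range.2 hk, rfl⟩)
    intro y hy
    obtain ⟨j, hj, rfl⟩ := Finset.mem_image.1 hy
    rw [Finset.mem_range] at hj
    rw [hstep j hj]
    split_ifs with h
    · exact Finset.mem_image.2 ⟨0, Finset.mem_range.2 hk, rfl⟩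
    · exact Finset.mem_image.2 ⟨j + 1, Finset.mem_range.2 (by omega), rfl⟩
  · intro y hy
    obtain ⟨j, hj, rfl⟩ := Finset.mem_image.1 hy
    rw [Finset.mem_range] at hj
    clear hy
    induction j with
    | zero => exact self_mem_cycleSet _ _
    | succ j ih =>
      have h1 := ih (by omega)
      have h2 := hstep j (lt_trans (Nat.lt_succ_self j) hj)
      rw [if_neg (ne_of_lt hj)] at h2
      rw [← isStable_cycleSet (swap x (γ^[k] x) * γ) x ((γ^[j]) x), h2] at h1
      exact h1

theorem exists_iterate_of_sameCycle {γ : Perm X} {x y : X} (h : γ.SameCycle x y) (hxy : x ≠ y) :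
    ∃ k, 0 < k ∧ k < Function.minimalPeriod γ x ∧ γ^[k] x = y := by
  have hy : y ∈ cycleSet γ x := mem_cycleSet.2 h
  rw [cycleSet_eq_image] at hy
  obtain ⟨k, hk, rfl⟩ := Finset.mem_image.1 hy
  refine ⟨k, Nat.pos_of_ne_zero ?_, Finset.mem_range.1 hk, rfl⟩
  rintro rfl
  exact hxy rfl

theorem not_sameCycle_swap_mul {γ : Perm X} {x y : X} (h : γ.SameCycle x y) (hxy : x ≠ y) :
    ¬(swap x y * γ).SameCycle x y := by
  obtain ⟨k, hk, hk', rfl⟩ := exists_iterate_of_sameCycle h hxy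
  rw [← mem_cycleSet, cycleSet_swap_mul_iterate hk hk', Finset.mem_image]
  rintro ⟨j, hj, hjk⟩
  rw [Finset.mem_range] at hj
  have : j = k := Function.iterate_injOn_Iio_minimalPeriod (hj.trans hk') hk' hjk
  omega

theorem sameCycle_swap_mul {γ : Perm X} {x y : X} (h : ¬γ.SameCycle x y) :
    (swap x y * γ).SameCycle x y := by
  set n := Function.minimalPeriod γ x with hn
  have hpos : 0 < n := minimalPeriod_pos γ x
  have key : ∀ j < n, (swap x y * γ).SameCycle x ((γ^[j]) x) := by
    intro j
    induction j with
    | zero => exact fun _ => Perm.SameCycle.refl _ _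
    | succ j ih =>
      intro hj
      have h1 := Perm.sameCycle_apply_right.2 (ih (by omega))
      rw [Perm.mul_apply, ← Function.iterate_succ_apply' γ, swap_apply_of_ne_of_ne] at h1
      · exact h1
      · intro h'
        have h2 : j + 1 = 0 :=
          Function.iterate_injOn_Iio_minimalPeriod (f := γ) (x := x) (by simpa [hn] using hj)
            hpos h'
        omega
      · intro h'
        exact h ⟨(j + 1 : ℕ), by rw [zpow_natCast, ← Perm.iterate_eq_pow, h']⟩
  have h1 := Perm.sameCycle_apply_right.2 (key (n - 1) (by omega))
  rwa [Perm.mul_apply, ← Function.iterate_succ_apply' γ, Nat.succ_eq_add_one,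
    Nat.sub_add_cancel hpos, hn, Function.iterate_minimalPeriod, swap_apply_left] at h1

theorem cycleSet_swap_mul_of_not_sameCycle {γ : Perm X} {x y : X} (h : ¬γ.SameCycle x y) :
    cycleSet (swap x y * γ) x = cycleSet γ x ∪ cycleSet γ y := by
  have hxy : y ∈ cycleSet (swap x y * γ) x := mem_cycleSet.2 (sameCycle_swap_mul h)
  apply Finset.Subset.antisymm
  · refine IsStable.cycleSet_subset ((isStable_swap_mul ?_).2 ?_)
      (Finset.mem_union_left _ (self_mem_cycleSet γ x))
    · simp [self_mem_cycleSet]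
    · intro z
      rw [Finset.mem_union, Finset.mem_union, isStable_cycleSet, isStable_cycleSet]
  · have hst : IsStable γ (cycleSet (swap x y * γ) x) :=
      (isStable_swap_mul (by simp [self_mem_cycleSet, hxy])).1 (isStable_cycleSet _ x)
    exact Finset.union_subset (hst.cycleSet_subset (self_mem_cycleSet _ _))
      (hst.cycleSet_subset hxy)

theorem cycleSet_eq_union_of_sameCycle {γ : Perm X} {x y : X} (h : γ.SameCycle x y) (hxy : x ≠ y) :
    cycleSet γ x = cycleSet (swap x y * γ) x ∪ cycleSet (swap x y * γ) y := by
  have h1 := cycleSet_swap_mul_of_not_sameCycle (not_sameCycle_swap_mul h hxy)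
  rwa [swap_mul_self_mul] at h1

theorem cycleSet_swap_mul_of_notMem {γ : Perm X} {x y z : X} (hx : ¬γ.SameCycle z x)
    (hy : ¬γ.SameCycle z y) : cycleSet (swap x y * γ) z = cycleSet γ z := by
  have hx' : x ∉ cycleSet γ z := mt mem_cycleSet.1 hx
  have hy' : y ∉ cycleSet γ z := mt mem_cycleSet.1 hy
  have h1 : cycleSet (swap x y * γ) z ⊆ cycleSet γ z :=
    ((isStable_swap_mul (by simp [hx', hy'])).2 (isStable_cycleSet γ z)).cycleSet_subset
      (self_mem_cycleSet _ _)
  refine h1.antisymm (IsStable.cycleSet_subset ((isStable_swap_mul ?_).1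
    (isStable_cycleSet (swap x y * γ) z)) (self_mem_cycleSet _ _))
  exact ⟨fun h => absurd (h1 h) hx', fun h => absurd (h1 h) hy'⟩

theorem mem_cyclesOn {γ : Perm X} {S : Finset X} {C : Finset X} :
    C ∈ cyclesOn γ S ↔ ∃ x ∈ S, cycleSet γ x = C := Finset.mem_image

/-- A transposition of points of different cycles joins these cycles. -/
theorem cyclesOn_swap_mul_of_not_sameCycle {γ : Perm X} {S : Finset X} {x y : X} (hx : x ∈ S)
    (h : ¬γ.SameCycle x y) :
    cyclesOn (swap x y * γ) S = insert (cycleSet γ x ∪ cycleSet γ y)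
      (((cyclesOn γ S).erase (cycleSet γ x)).erase (cycleSet γ y)) := by
  have hu := cycleSet_swap_mul_of_not_sameCycle h
  ext C
  rw [mem_cyclesOn, Finset.mem_insert, Finset.mem_erase, Finset.mem_erase, mem_cyclesOn]
  constructor
  · rintro ⟨z, hz, rfl⟩
    by_cases hzx : γ.SameCycle z x ∨ γ.SameCycle z y
    · left
      rw [← hu, cycleSet_eq_iff]
      have : z ∈ cycleSet (swap x y * γ) x := by
        rw [hu, Finset.mem_union, mem_cycleSet, mem_cycleSet]
        exact hzx.imp (fun h => h.symm) fun h => h.symm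
      exact (mem_cycleSet.1 this).symm
    · push Not at hzx
      right
      rw [cycleSet_swap_mul_of_notMem hzx.1 hzx.2, Ne, cycleSet_eq_iff, Ne, cycleSet_eq_iff]
      exact ⟨hzx.2, hzx.1, z, hz, rfl⟩
  · rintro (rfl | ⟨h1, h2, z, hz, rfl⟩)
    · exact ⟨x, hx, hu⟩
    · rw [Ne, cycleSet_eq_iff] at h1 h2
      exact ⟨z, hz, cycleSet_swap_mul_of_notMem h2 h1⟩

/-- A transposition of two points of a cycle cuts this cycle into two. -/
theorem cyclesOn_swap_mul_of_sameCycle {γ : Perm X} {S : Finset X} {x y : X} (hx : x ∈ S)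
    (hy : y ∈ S) (h : γ.SameCycle x y) (hxy : x ≠ y) :
    cyclesOn (swap x y * γ) S = insert (cycleSet (swap x y * γ) x)
      (insert (cycleSet (swap x y * γ) y) ((cyclesOn γ S).erase (cycleSet γ x))) := by
  have hu := cycleSet_eq_union_of_sameCycle h hxy
  ext C
  rw [mem_cyclesOn, Finset.mem_insert, Finset.mem_insert, Finset.mem_erase, mem_cyclesOn]
  constructor
  · rintro ⟨z, hz, rfl⟩
    by_cases hzx : γ.SameCycle x z
    · rw [← mem_cycleSet, hu, Finset.mem_union, mem_cycleSet, mem_cycleSet] at hzx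
      rcases hzx with hz' | hz'
      · exact Or.inl (cycleSet_eq_iff.2 hz'.symm)
      · exact Or.inr (Or.inl (cycleSet_eq_iff.2 hz'.symm))
    · refine Or.inr (Or.inr ?_)
      rw [cycleSet_swap_mul_of_notMem (fun h' => hzx h'.symm)
        (fun h' => hzx (h.trans h'.symm)), Ne, cycleSet_eq_iff]
      exact ⟨fun h' => hzx h'.symm, z, hz, rfl⟩
  · rintro (rfl | rfl | ⟨h1, z, hz, rfl⟩)
    · exact ⟨x, hx, rfl⟩
    · exact ⟨y, hy, rfl⟩
    · rw [Ne, cycleSet_eq_iff] at h1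
      exact ⟨z, hz, cycleSet_swap_mul_of_notMem h1 fun h' => h1 (h'.trans h.symm)⟩

theorem cycleSet_ne_of_not_sameCycle {γ : Perm X} {x y : X} (h : ¬γ.SameCycle x y) :
    cycleSet γ x ≠ cycleSet γ y := mt cycleSet_eq_iff.1 h

theorem cycleSet_swap_mul_notMem {γ : Perm X} {S : Finset X} {x y z : X} (h : γ.SameCycle x y)
    (hxy : x ≠ y) (hz : z = x ∨ z = y) :
    cycleSet (swap x y * γ) z ∉ (cyclesOn γ S).erase (cycleSet γ x) := by
  rw [Finset.mem_erase, mem_cyclesOn]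
  rintro ⟨h1, w, _, h2⟩
  have hu := cycleSet_eq_union_of_sameCycle h hxy
  have hzw : γ.SameCycle w z := by
    rw [← mem_cycleSet, h2]; exact self_mem_cycleSet _ _
  have hzx : γ.SameCycle x z := by
    rcases hz with rfl | rfl
    · exact Perm.SameCycle.refl _ _
    · exact h
  exact h1 (by rw [← h2, cycleSet_eq_iff]; exact hzw.trans hzx.symm)

theorem card_cyclesOn_cut {γ : Perm X} {S : Finset X} {x y : X} (hx : x ∈ S)
    (hy : y ∈ S) (h : γ.SameCycle x y) (hxy : x ≠ y) :
    (cyclesOn (swap x y * γ) S).card = (cyclesOn γ S).card + 1 := by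
  rw [cyclesOn_swap_mul_of_sameCycle hx hy h hxy, Finset.card_insert_of_notMem,
    Finset.card_insert_of_notMem, Finset.card_erase_of_mem (mem_cyclesOn.2 ⟨x, hx, rfl⟩)]
  · have : 0 < (cyclesOn γ S).card := Finset.card_pos.2 ⟨_, mem_cyclesOn.2 ⟨x, hx, rfl⟩⟩
    omega
  · exact cycleSet_swap_mul_notMem h hxy (Or.inr rfl)
  · rw [Finset.mem_insert, not_or]
    exact ⟨cycleSet_ne_of_not_sameCycle (not_sameCycle_swap_mul h hxy),
      cycleSet_swap_mul_notMem h hxy (Or.inl rfl)⟩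

theorem card_cyclesOn_join {γ : Perm X} {S : Finset X} {x y : X} (hx : x ∈ S)
    (h : ¬γ.SameCycle x y) :
    (cyclesOn γ S).card ≤ (cyclesOn (swap x y * γ) S).card + 1 := by
  rw [cyclesOn_swap_mul_of_not_sameCycle hx h, Finset.card_insert_of_notMem]
  · have h1 := Finset.pred_card_le_card_erase (s := cyclesOn γ S) (a := cycleSet γ x)
    have h2 := Finset.pred_card_le_card_erase (s := (cyclesOn γ S).erase (cycleSet γ x))
      (a := cycleSet γ y)
    omega
  · rw [Finset.mem_erase, Finset.mem_erase, mem_cyclesOn]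
    rintro ⟨h1, h2, z, _, h3⟩
    have : x ∈ cycleSet γ z := by rw [h3]; simp [self_mem_cycleSet]
    exact h2 (by rw [← h3, cycleSet_eq_iff]; exact mem_cycleSet.1 this)

theorem isConnectedOn_nil {S : Finset X} {γ : Perm X} (h : IsConnectedOn S γ []) (hS : IsStable γ S)
    {x : X} (hx : x ∈ S) : cycleSet γ x = S :=
  h _ (hS.cycleSet_subset hx) ⟨x, self_mem_cycleSet _ _⟩ (isStable_cycleSet _ _) (by simp)

theorem splittings_eq_empty {S : Finset X} {γ : Perm X} {p : X × X}
    (h : γ.SameCycle p.1 p.2) : splittings S γ p = ∅ := by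
  rw [Finset.eq_empty_iff_forall_notMem]
  intro T hT
  obtain ⟨_, h1, h2, h3⟩ := mem_splittings.1 hT
  exact h2 ((h3.mem_iff h).1 h1)

/-- The Riemann-Hurwitz inequality: with `m` cycles of `γ` and `n` parts of `β`, a transitive word has
at least `m + n - 2` transpositions. -/
theorem transCount_eq_zero {S : Finset X} {γ : Perm X} (hS : IsStable γ S) {β : ℕ →₀ ℕ} {r : ℕ}
    (h : r + 2 < (cyclesOn γ S).card + partCount β) : transCount S γ β r = 0 := by
  induction r using Nat.strong_induction_on generalizing S γ β with
  | _ r ih =>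
    cases r with
    | zero =>
      rw [transCount_zero]
      by_cases h1 : typeOn γ S = β
      · rw [ind_true h1, ind_false, mul_zero]
        intro h2
        have h3 : (cyclesOn γ S).card ≤ 1 := by
          rw [Finset.card_le_one]
          intro C hC D hD
          obtain ⟨x, hx, rfl⟩ := mem_cyclesOn.1 hC
          obtain ⟨y, hy, rfl⟩ := mem_cyclesOn.1 hD
          rw [isConnectedOn_nil h2 hS hx, isConnectedOn_nil h2 hS hy]
        rw [← h1, partCount_typeOn] at h
        omega
      · rw [ind_false h1, zero_mul]
    | succ r =>
      have hr : (2 * ((r : ℚ) + 1)) ≠ 0 := by positivity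
      rw [← mul_right_inj' hr, transCount_succ hS, mul_zero]
      refine Finset.sum_eq_zero fun p hp => ?_
      obtain ⟨hx, hy, hxy⟩ := Finset.mem_offDiag.1 hp
      have hS' : IsStable (swap p.1 p.2 * γ) S := (isStable_swap_mul (by simp [hx, hy])).2 hS
      by_cases hsc : γ.SameCycle p.1 p.2
      · have hc := card_cyclesOn_cut hx hy hsc hxy
        rw [ih r (by omega) hS' (by omega), zero_add]
        refine Finset.sum_eq_zero fun T hT => Finset.sum_eq_zero fun b hb =>
          Finset.sum_eq_zero fun s hs => ?_
        obtain ⟨hTS, _, _, hTst⟩ := mem_splittings.1 hT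
        rw [Finset.HasAntidiagonal.mem_antidiagonal] at hb hs
        have h1 := card_cyclesOn_eq_add hTS hTst
        have h2 : partCount b.1 + partCount b.2 = partCount β := by rw [← map_add, hb]
        by_cases h3 : s.1 + 2 < (cyclesOn (swap p.1 p.2 * γ) T).card + partCount b.1
        · rw [ih s.1 (by omega) hTst h3, zero_mul]
        · rw [ih s.2 (by omega) (hS'.sdiff hTst) (by omega), mul_zero]
      · have hc := card_cyclesOn_join hx hsc
        rw [splittings_eq_empty (sameCycle_swap_mul hsc), Finset.sum_empty, add_zero,
          ih r (by omega) hS' (by omega)]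

end Recursion

/-! ### Sums over cuts and joins -/

section Evaluation

open Equiv

set_option linter.unusedSectionVars false

variable {X : Type*} [Fintype X] [DecidableEq X]

theorem biUnion_cyclesOn {γ : Perm X} {T : Finset X} (hT : IsStable γ T) :
    (cyclesOn γ T).biUnion id = T := by
  ext x
  rw [Finset.mem_biUnion]
  constructor
  · rintro ⟨C, hC, hx⟩
    obtain ⟨y, hy, rfl⟩ := mem_cyclesOn.1 hC
    exact hT.cycleSet_subset hy hx
  · exact fun hx => ⟨_, mem_cyclesOn.2 ⟨x, hx, rfl⟩, self_mem_cycleSet γ x⟩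

theorem cyclesOn_biUnion {γ : Perm X} {S : Finset X} {J : Finset (Finset X)}
    (hJ : J ⊆ cyclesOn γ S) : cyclesOn γ (J.biUnion id) = J := by
  ext C
  rw [mem_cyclesOn]
  constructor
  · rintro ⟨x, hx, rfl⟩
    obtain ⟨D, hD, hxD⟩ := Finset.mem_biUnion.1 hx
    obtain ⟨y, _, rfl⟩ := mem_cyclesOn.1 (hJ hD)
    rwa [← cycleSet_eq_iff.2 (mem_cycleSet.1 hxD)]
  · intro hC
    obtain ⟨y, _, rfl⟩ := mem_cyclesOn.1 (hJ hC)
    exact ⟨y, Finset.mem_biUnion.2 ⟨_, hC, self_mem_cycleSet γ y⟩, rfl⟩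

theorem isStable_biUnion {γ : Perm X} {S : Finset X} {J : Finset (Finset X)}
    (hJ : J ⊆ cyclesOn γ S) : IsStable γ (J.biUnion id) := by
  have h : ∀ C ∈ J, IsStable γ C := fun C hC => by
    obtain ⟨y, _, rfl⟩ := mem_cyclesOn.1 (hJ hC)
    exact isStable_cycleSet γ y
  intro x
  rw [Finset.mem_biUnion, Finset.mem_biUnion]
  exact exists_congr fun C => and_congr_right fun hC => h C hC x

theorem cyclesOn_mono (γ : Perm X) {S T : Finset X} (h : T ⊆ S) : cyclesOn γ T ⊆ cyclesOn γ S :=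
  Finset.image_subset_image h

theorem cyclesOn_sdiff {γ : Perm X} {S T : Finset X} (hT : IsStable γ T) (h : T ⊆ S) :
    cyclesOn γ (S \ T) = cyclesOn γ S \ cyclesOn γ T := by
  conv_rhs => rw [← Finset.union_sdiff_of_subset h, cyclesOn_union,
    Finset.union_sdiff_cancel_left (disjoint_cyclesOn hT Finset.disjoint_sdiff)]

theorem cycleSet_mem_cyclesOn {γ : Perm X} {S : Finset X} (hS : IsStable γ S) {x : X} :
    cycleSet γ x ∈ cyclesOn γ S ↔ x ∈ S := by
  refine ⟨fun h => ?_, fun h => mem_cyclesOn.2 ⟨x, h, rfl⟩⟩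
  obtain ⟨y, hy, hyx⟩ := mem_cyclesOn.1 h
  exact (hS.mem_iff (cycleSet_eq_iff.1 hyx)).1 hy

/-- The splittings after a cut distribute the other cycles over the two new ones. -/
theorem sum_splittings {γ : Perm X} {S : Finset X} (hS : IsStable γ S) {x y : X} (hx : x ∈ S)
    (hy : y ∈ S) (h : γ.SameCycle x y) (hxy : x ≠ y) (g : Finset X → ℚ)
    (v : Finset (Finset X) → ℚ)
    (hv : ∀ I ⊆ (cyclesOn γ S).erase (cycleSet γ x), ∀ T ⊆ S, IsStable (swap x y * γ) T →
      cyclesOn (swap x y * γ) T = insert (cycleSet (swap x y * γ) x) I →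
      cyclesOn (swap x y * γ) (S \ T) = insert (cycleSet (swap x y * γ) y)
        ((cyclesOn γ S).erase (cycleSet γ x) \ I) → g T = v I) :
    ∑ T ∈ splittings S (swap x y * γ) (x, y), g T =
      ∑ I ∈ ((cyclesOn γ S).erase (cycleSet γ x)).powerset, v I := by
  have hS' : IsStable (swap x y * γ) S := (isStable_swap_mul (by simp [hx, hy])).2 hS
  have hc := cyclesOn_swap_mul_of_sameCycle hx hy h hxy
  have h1 := cycleSet_swap_mul_notMem (S := S) h hxy (Or.inl rfl)
  have h2 := cycleSet_swap_mul_notMem (S := S) h hxy (Or.inr rfl)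
  have h12 := cycleSet_ne_of_not_sameCycle (not_sameCycle_swap_mul h hxy)
  set R := (cyclesOn γ S).erase (cycleSet γ x) with hR
  set C₁ := cycleSet (swap x y * γ) x with hC₁
  set C₂ := cycleSet (swap x y * γ) y with hC₂
  have hJ : ∀ I ⊆ R, insert C₁ I ⊆ cyclesOn (swap x y * γ) S := fun I hI => by
    rw [hc]
    exact Finset.insert_subset_insert _ (hI.trans (Finset.subset_insert _ _))
  have hsub : ∀ I ⊆ R, (insert C₁ I).biUnion id ⊆ S := fun I hI => by
    rw [← biUnion_cyclesOn hS']
    exact Finset.biUnion_subset_biUnion_of_subset_left _ (hJ I hI)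
  symm
  refine Finset.sum_bij' (fun I _ => (insert C₁ I).biUnion id)
    (fun T _ => (cyclesOn (swap x y * γ) T).erase C₁) ?_ ?_ ?_ ?_ ?_
  · intro I hI
    rw [Finset.mem_powerset] at hI
    have hst := isStable_biUnion (hJ I hI)
    refine mem_splittings.2 ⟨hsub I hI, ?_, ?_, hst⟩
    · rw [← cycleSet_mem_cyclesOn hst, cyclesOn_biUnion (hJ I hI)]
      exact Finset.mem_insert_self _ _
    · rw [← cycleSet_mem_cyclesOn hst, cyclesOn_biUnion (hJ I hI), Finset.mem_insert, not_or]
      exact ⟨h12.symm, fun h' => h2 (hI h')⟩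
  · intro T hT
    obtain ⟨hTS, _, hyT, hst⟩ := mem_splittings.1 hT
    rw [Finset.mem_powerset]
    intro C hC
    obtain ⟨hC1, hC⟩ := Finset.mem_erase.1 hC
    have h3 := cyclesOn_mono (swap x y * γ) hTS hC
    rw [hc, Finset.mem_insert, Finset.mem_insert] at h3
    rcases h3 with h3 | h3 | h3
    · exact absurd h3 hC1
    · rw [h3, hC₂, cycleSet_mem_cyclesOn hst] at hC
      exact absurd hC hyT
    · exact h3
  · intro I hI
    rw [Finset.mem_powerset] at hI
    rw [cyclesOn_biUnion (hJ I hI), Finset.erase_insert fun h' => h1 (hI h')]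
  · intro T hT
    obtain ⟨_, hxT, _, hst⟩ := mem_splittings.1 hT
    rw [Finset.insert_erase ((cycleSet_mem_cyclesOn hst).2 hxT), biUnion_cyclesOn hst]
  · intro I hI
    rw [Finset.mem_powerset] at hI
    have hst := isStable_biUnion (hJ I hI)
    refine (hv I hI _ (hsub I hI) hst (cyclesOn_biUnion (hJ I hI)) ?_).symm
    rw [cyclesOn_sdiff hst (hsub I hI), cyclesOn_biUnion (hJ I hI), hc]
    ext C
    simp only [Finset.mem_sdiff, Finset.mem_insert]
    constructor
    · tauto
    · rintro (rfl | ⟨h3, h4⟩)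
      · exact ⟨Or.inr (Or.inl rfl), not_or.2 ⟨h12.symm, fun h' => h2 (hI h')⟩⟩
      · exact ⟨Or.inr (Or.inr h3), not_or.2 ⟨fun h' => h1 (h' ▸ h3), h4⟩⟩

/-- Cutting a cycle of length `n` at a given point and each other point gives every ordered
decomposition of `n` into two positive lengths once. -/
theorem sum_cut (γ : Perm X) (x : X) (G : ℕ → ℕ → ℚ) (h0 : ∀ k, G 0 k = 0) (h0' : ∀ k, G k 0 = 0) :
    ∑ y ∈ (cycleSet γ x).erase x,
      G (cycleSet (swap x y * γ) x).card (cycleSet (swap x y * γ) y).card =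
    ∑ p ∈ Finset.HasAntidiagonal.antidiagonal (cycleSet γ x).card, G p.1 p.2 := by
  set n := Function.minimalPeriod γ x with hn
  have hpos : 0 < n := minimalPeriod_pos γ x
  have hinj : ∀ a b, a < n → b < n → (γ^[a]) x = (γ^[b]) x → a = b := fun a b ha hb hab =>
    Function.iterate_injOn_Iio_minimalPeriod ha hb hab
  rw [Finset.Nat.sum_antidiagonal_eq_sum_range_succ G, card_cycleSet, ← hn, Finset.sum_range_succ,
    Nat.sub_self, h0', add_zero]
  have h1 : (cycleSet γ x).erase x = ((Finset.range n).erase 0).image fun k => (γ^[k]) x := by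
    rw [cycleSet_eq_image, ← hn]
    ext y
    simp only [Finset.mem_erase, Finset.mem_image, Finset.mem_range]
    constructor
    · rintro ⟨hne, k, hk, rfl⟩
      exact ⟨k, ⟨fun h => hne (by rw [h]; rfl), hk⟩, rfl⟩
    · rintro ⟨k, ⟨hk0, hk⟩, rfl⟩
      exact ⟨fun h => hk0 (hinj k 0 hk hpos h), k, hk, rfl⟩
  rw [h1, Finset.sum_image,
    ← Finset.sum_erase (f := fun k => G k (n - k)) (Finset.range n) (h0 (n - 0))]
  · refine Finset.sum_congr rfl fun k hk => ?_
    obtain ⟨hk0, hk⟩ := Finset.mem_erase.1 hk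
    rw [Finset.mem_range] at hk
    have hxy : x ≠ (γ^[k]) x := fun h => hk0 (hinj k 0 hk hpos h.symm)
    have hsc : γ.SameCycle x ((γ^[k]) x) := ⟨k, by rw [zpow_natCast, Perm.iterate_eq_pow]⟩
    have h2 : (cycleSet (swap x ((γ^[k]) x) * γ) x).card = k := by
      rw [cycleSet_swap_mul_iterate (Nat.pos_of_ne_zero hk0) hk, Finset.card_image_of_injOn,
        Finset.card_range]
      intro a ha b hb hab
      exact hinj a b ((Finset.mem_range.1 ha).trans hk) ((Finset.mem_range.1 hb).trans hk) hab
    have h3 := congrArg Finset.card (cycleSet_eq_union_of_sameCycle hsc hxy)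
    rw [Finset.card_union_of_disjoint, card_cycleSet, ← hn, h2] at h3
    · rw [h2]
      congr 1
      omega
    · rw [Finset.disjoint_left]
      intro z hz hz'
      exact not_sameCycle_swap_mul hsc hxy ((mem_cycleSet.1 hz).trans (mem_cycleSet.1 hz').symm)
  · intro a ha b hb hab
    exact hinj a b (Finset.mem_range.1 (Finset.mem_of_mem_erase ha))
      (Finset.mem_range.1 (Finset.mem_of_mem_erase hb)) hab

theorem sum_eq_sum_cyclesOn {γ : Perm X} {S : Finset X} (hS : IsStable γ S) (f : X → ℚ) :
    ∑ x ∈ S, f x = ∑ C ∈ cyclesOn γ S, ∑ x ∈ C, f x := by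
  conv_lhs => rw [← biUnion_cyclesOn hS]
  rw [Finset.sum_biUnion]
  · rfl
  · intro C hC D hD hCD
    obtain ⟨x, _, rfl⟩ := mem_cyclesOn.1 hC
    obtain ⟨y, _, rfl⟩ := mem_cyclesOn.1 hD
    rw [Function.onFun, id, id, Finset.disjoint_left]
    intro z hz hz'
    exact hCD (cycleSet_eq_iff.2 ((mem_cycleSet.1 hz).trans (mem_cycleSet.1 hz').symm))

/-- A sum over the transpositions of `S`, arranged by cycles: the pairs in one cycle `C` are cuts, and
those from two cycles `C`, `D` are joins. -/
theorem sum_offDiag {γ : Perm X} {S : Finset X} (hS : IsStable γ S) (F : X × X → ℚ)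
    (G : Finset X → ℕ → ℕ → ℚ) (J : Finset X → Finset X → ℚ)
    (h0 : ∀ C k, G C 0 k = 0) (h0' : ∀ C k, G C k 0 = 0)
    (hG : ∀ x ∈ S, ∀ y ∈ S, γ.SameCycle x y → x ≠ y → F (x, y) = G (cycleSet γ x)
      (cycleSet (swap x y * γ) x).card (cycleSet (swap x y * γ) y).card)
    (hJ : ∀ x ∈ S, ∀ y ∈ S, ¬γ.SameCycle x y → F (x, y) = J (cycleSet γ x) (cycleSet γ y)) :
    ∑ p ∈ S.offDiag, F p = ∑ C ∈ cyclesOn γ S, (C.card : ℚ) *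
      (∑ p ∈ Finset.HasAntidiagonal.antidiagonal C.card, G C p.1 p.2 +
        ∑ D ∈ (cyclesOn γ S).erase C, (D.card : ℚ) * J C D) := by
  have h1 : ∑ p ∈ S.offDiag, F p = ∑ x ∈ S, ∑ y ∈ S.erase x, F (x, y) := by
    rw [Finset.sum_sigma']
    refine Finset.sum_nbij' (fun p => ⟨p.1, p.2⟩) (fun p => (p.1, p.2)) ?_ ?_ ?_ ?_ ?_
    · intro p hp
      obtain ⟨h1, h2, h3⟩ := Finset.mem_offDiag.1 hp
      simp [h1, h2, Ne.symm h3]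
    · intro p hp
      simp only [Finset.mem_sigma, Finset.mem_erase] at hp
      exact Finset.mem_offDiag.2 ⟨hp.1, hp.2.2, Ne.symm hp.2.1⟩
    · exact fun _ _ => rfl
    · exact fun _ _ => rfl
    · exact fun _ _ => rfl
  rw [h1, sum_eq_sum_cyclesOn hS]
  refine Finset.sum_congr rfl fun C hC => ?_
  rw [← nsmul_eq_mul, ← Finset.sum_const]
  refine Finset.sum_congr rfl fun x hx => ?_
  have hCx : C = cycleSet γ x := by
    obtain ⟨w, _, rfl⟩ := mem_cyclesOn.1 hC
    exact cycleSet_eq_iff.2 (mem_cycleSet.1 hx)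
  have hxS : x ∈ S := by rw [hCx] at hC; exact (cycleSet_mem_cyclesOn hS).1 hC
  have h2 : ∑ y ∈ S.erase x, F (x, y) = ∑ y ∈ C.erase x, F (x, y) + ∑ y ∈ S \ C, F (x, y) := by
    rw [← Finset.sum_union]
    · congr 1
      ext y
      have : y ∈ C → y ∈ S := fun h => hS.cycleSet_subset hxS (hCx ▸ h)
      have h3 : y = x → y ∈ C := fun h => h ▸ hx
      simp only [Finset.mem_erase, Finset.mem_union, Finset.mem_sdiff]
      tauto
    · exact Finset.disjoint_of_subset_left (Finset.erase_subset _ _) Finset.disjoint_sdiff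
  rw [h2]
  congr 1
  · subst hCx
    rw [← sum_cut γ x (G (cycleSet γ x)) (h0 _) (h0' _)]
    refine Finset.sum_congr rfl fun y hy => ?_
    obtain ⟨hyx, hy⟩ := Finset.mem_erase.1 hy
    exact hG x hxS y (hS.cycleSet_subset hxS hy) (mem_cycleSet.1 hy) hyx.symm
  · subst hCx
    have hst := isStable_cycleSet γ x
    rw [sum_eq_sum_cyclesOn (hS.sdiff hst), cyclesOn_sdiff hst (hS.cycleSet_subset hxS)]
    have h4 : cyclesOn γ (cycleSet γ x) = {cycleSet γ x} := by
      ext D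
      rw [mem_cyclesOn, Finset.mem_singleton]
      constructor
      · rintro ⟨y, hy, rfl⟩
        exact (cycleSet_eq_iff.2 (mem_cycleSet.1 hy)).symm
      · rintro rfl
        exact ⟨x, self_mem_cycleSet γ x, rfl⟩
    rw [h4, Finset.sdiff_singleton_eq_erase]
    refine Finset.sum_congr rfl fun D hD => ?_
    rw [← nsmul_eq_mul, ← Finset.sum_const]
    refine Finset.sum_congr rfl fun y hy => ?_
    obtain ⟨hne, hD⟩ := Finset.mem_erase.1 hD
    obtain ⟨w, hw, rfl⟩ := mem_cyclesOn.1 hD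
    have hwy := cycleSet_eq_iff.2 (mem_cycleSet.1 hy)
    rw [hwy] at hne ⊢
    exact hJ x hxS y (hS.cycleSet_subset hw hy) fun h => hne (cycleSet_eq_iff.2 h).symm

/-- `A` is the generating series, over all `β`, of the numbers of transitive words on `S` of the
minimal length `m + n - 2`, where `γ` has `m` cycles on `S` and `β` has `n` parts, as long as this
length is at most `r`. The coefficients for which `m + n - 2` is negative vanish. -/
def HasValue (r : ℕ) (S : Finset X) (γ : Perm X) (A : PartRing) : Prop :=
  (∀ β, (cyclesOn γ S).card + partCount β < 2 → MvPowerSeries.coeff β A = 0) ∧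
  ∀ s ≤ r, ∀ β, s + 2 = (cyclesOn γ S).card + partCount β →
    transCount S γ β s = MvPowerSeries.coeff β A

/-- The contribution of a splitting into `T` and `S \ T` in minimal length is the coefficient of a
product of generating series. -/
theorem HasValue.sum_mul {r : ℕ} {S T : Finset X} {γ : Perm X} (hS : IsStable γ S)
    (hT : IsStable γ T) (hTS : T ⊆ S) {A B : PartRing} (hA : HasValue r T γ A)
    (hB : HasValue r (S \ T) γ B) {β : ℕ →₀ ℕ}
    (h : r + 4 = (cyclesOn γ S).card + partCount β) :
    ∑ b ∈ Finset.HasAntidiagonal.antidiagonal β, ∑ s ∈ Finset.HasAntidiagonal.antidiagonal r,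
      transCount T γ b.1 s.1 * transCount (S \ T) γ b.2 s.2 = MvPowerSeries.coeff β (A * B) := by
  rw [MvPowerSeries.coeff_mul]
  refine Finset.sum_congr rfl fun b hb => ?_
  rw [Finset.HasAntidiagonal.mem_antidiagonal] at hb
  have h1 := card_cyclesOn_eq_add hTS hT
  have h2 : partCount b.1 + partCount b.2 = partCount β := by rw [← map_add, hb]
  by_cases hb1 : (cyclesOn γ T).card + partCount b.1 < 2
  · rw [hA.1 _ hb1, zero_mul, Finset.sum_eq_zero]
    intro s hs
    rw [Finset.HasAntidiagonal.mem_antidiagonal] at hs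
    rw [transCount_eq_zero (hS.sdiff hT) (by omega), mul_zero]
  by_cases hb2 : (cyclesOn γ (S \ T)).card + partCount b.2 < 2
  · rw [hB.1 _ hb2, mul_zero, Finset.sum_eq_zero]
    intro s hs
    rw [Finset.HasAntidiagonal.mem_antidiagonal] at hs
    rw [transCount_eq_zero hT (by omega), zero_mul]
  -- By the Riemann-Hurwitz inequality, only one way to divide the word between the orbits is long
  -- enough for both of them.
  rw [Finset.sum_eq_single ((cyclesOn γ T).card + partCount b.1 - 2,
    (cyclesOn γ (S \ T)).card + partCount b.2 - 2)]
  · rw [hA.2 _ (by omega) _ (by omega), hB.2 _ (by omega) _ (by omega)]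
  · rintro ⟨s₁, s₂⟩ hs hne
    rw [Finset.HasAntidiagonal.mem_antidiagonal] at hs
    rcases lt_trichotomy (s₁ + 2) ((cyclesOn γ T).card + partCount b.1) with h3 | h3 | h3
    · rw [transCount_eq_zero hT h3, zero_mul]
    · exact absurd (Prod.ext (by simp; omega) (by simp at hs ⊢; omega)) hne
    · simp only at hs
      rw [transCount_eq_zero (hS.sdiff hT) (by omega), mul_zero]
  · intro h3
    exact absurd (Finset.HasAntidiagonal.mem_antidiagonal.2 (by simp only; omega)) h3

end Evaluation

/-! ### Minimal words for permutations with at most three cycles -/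

section MinimalCounts

open Equiv

set_option linter.unusedSectionVars false

variable {X : Type*} [Fintype X] [DecidableEq X]

theorem coeff_countDer (β : ℕ →₀ ℕ) (A : PartRing) :
    MvPowerSeries.coeff β (countDer A) = partCount β * MvPowerSeries.coeff β A := by
  rw [countDer, coeff_weightDer]

theorem coeff_partRing_natCast_mul (β : ℕ →₀ ℕ) (k : ℕ) (A : PartRing) :
    MvPowerSeries.coeff β ((k : PartRing) * A) = k * MvPowerSeries.coeff β A := by
  rw [← nsmul_eq_mul, map_nsmul, nsmul_eq_mul]

theorem cycleSet_mem (γ : Perm X) {S : Finset X} {x : X} (hx : x ∈ S) :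
    cycleSet γ x ∈ cyclesOn γ S := mem_cyclesOn.2 ⟨x, hx, rfl⟩

theorem card_pos_of_mem_cyclesOn {γ : Perm X} {S C : Finset X} (hC : C ∈ cyclesOn γ S) :
    C.card ≠ 0 := by
  obtain ⟨x, _, rfl⟩ := mem_cyclesOn.1 hC
  exact Finset.card_ne_zero_of_mem (self_mem_cycleSet γ x)

theorem card_union_of_not_sameCycle {γ : Perm X} {x y : X} (h : ¬γ.SameCycle x y) :
    (cycleSet γ x ∪ cycleSet γ y).card = (cycleSet γ x).card + (cycleSet γ y).card := by
  apply Finset.card_union_of_disjoint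
  rw [Finset.disjoint_left]
  intro z hz hz'
  exact h ((mem_cycleSet.1 hz).trans (mem_cycleSet.1 hz').symm)

theorem union_notMem_cyclesOn {γ : Perm X} {S : Finset X} {x y : X} :
    cycleSet γ x ∪ cycleSet γ y ∉
      ((cyclesOn γ S).erase (cycleSet γ x)).erase (cycleSet γ y) := by
  rw [Finset.mem_erase, Finset.mem_erase, mem_cyclesOn]
  rintro ⟨_, h2, z, _, h3⟩
  have : x ∈ cycleSet γ z := by rw [h3]; simp [self_mem_cycleSet]
  exact h2 (by rw [← h3, cycleSet_eq_iff]; exact mem_cycleSet.1 this)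

/-- The summand of `transCount_succ` that belongs to a pair `p`. -/
noncomputable def recTerm (S : Finset X) (γ : Perm X) (β : ℕ →₀ ℕ) (r : ℕ) (p : X × X) : ℚ :=
  transCount S (swap p.1 p.2 * γ) β r +
    ∑ T ∈ splittings S (swap p.1 p.2 * γ) p,
      ∑ b ∈ Finset.HasAntidiagonal.antidiagonal β,
        ∑ s ∈ Finset.HasAntidiagonal.antidiagonal r,
          transCount T (swap p.1 p.2 * γ) b.1 s.1 *
            transCount (S \ T) (swap p.1 p.2 * γ) b.2 s.2

/-- After a cut a transitive rest would be too short, so that all of the summand comes from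
distributing the other cycles over the two new ones. -/
theorem recTerm_cut {γ : Perm X} {S : Finset X} (hS : IsStable γ S) {x y : X} (hx : x ∈ S)
    (hy : y ∈ S) (h : γ.SameCycle x y) (hxy : x ≠ y) {β : ℕ →₀ ℕ} {r : ℕ}
    (hβ : r + 3 = (cyclesOn γ S).card + partCount β) (A B : Finset (Finset X) → PartRing)
    (hA : ∀ I ⊆ (cyclesOn γ S).erase (cycleSet γ x), ∀ T, IsStable (swap x y * γ) T →
      cyclesOn (swap x y * γ) T = insert (cycleSet (swap x y * γ) x) I →
      HasValue r T (swap x y * γ) (A I))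
    (hB : ∀ I ⊆ (cyclesOn γ S).erase (cycleSet γ x), ∀ T, IsStable (swap x y * γ) T →
      cyclesOn (swap x y * γ) T = insert (cycleSet (swap x y * γ) y)
        ((cyclesOn γ S).erase (cycleSet γ x) \ I) →
      HasValue r T (swap x y * γ) (B I)) :
    recTerm S γ β r (x, y) = MvPowerSeries.coeff β
      (∑ I ∈ ((cyclesOn γ S).erase (cycleSet γ x)).powerset, A I * B I) := by
  have hS' : IsStable (swap x y * γ) S := (isStable_swap_mul (by simp [hx, hy])).2 hS
  have hc := card_cyclesOn_cut hx hy h hxy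
  rw [recTerm, transCount_eq_zero hS' (by omega), zero_add, map_sum]
  refine sum_splittings hS hx hy h hxy _ _ fun I hI T hTS hT h1 h2 => ?_
  exact HasValue.sum_mul hS' hT hTS (hA I hI T hT h1) (hB I hI _ (hS'.sdiff hT) h2) (by omega)

/-- After a join the rest is transitive. -/
theorem recTerm_join {γ : Perm X} {S : Finset X} {x y : X} (hx : x ∈ S)
    (hy : y ∈ S) (h : ¬γ.SameCycle x y) {β : ℕ →₀ ℕ} {r : ℕ}
    (hβ : r + 3 = (cyclesOn γ S).card + partCount β) {A : PartRing}
    (hA : HasValue r S (swap x y * γ) A) :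
    recTerm S γ β r (x, y) = MvPowerSeries.coeff β A := by
  rw [recTerm, splittings_eq_empty (sameCycle_swap_mul h), Finset.sum_empty, add_zero]
  refine hA.2 r le_rfl β ?_
  rw [cyclesOn_swap_mul_of_not_sameCycle hx h, Finset.card_insert_of_notMem union_notMem_cyclesOn,
    Finset.card_erase_of_mem, Finset.card_erase_of_mem (mem_cyclesOn.2 ⟨x, hx, rfl⟩)]
  · have h1 : 1 < (cyclesOn γ S).card := Finset.one_lt_card.2 ⟨_, mem_cyclesOn.2 ⟨x, hx, rfl⟩, _,
      mem_cyclesOn.2 ⟨y, hy, rfl⟩, cycleSet_ne_of_not_sameCycle h⟩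
    omega
  · exact Finset.mem_erase.2 ⟨(cycleSet_ne_of_not_sameCycle h).symm, mem_cyclesOn.2 ⟨y, hy, rfl⟩⟩

/-- The minimal numbers of transpositions, as long as they are at most `r`, are counted by
`onePart`, `twoPart` and `threePart` for permutations with up to three cycles. -/
structure MinimalCounts (X : Type*) [Fintype X] [DecidableEq X] (r : ℕ) : Prop where
  one : ∀ (γ : Perm X) (S C : Finset X), IsStable γ S → cyclesOn γ S = {C} →
    HasValue r S γ (onePart C.card)
  two : ∀ (γ : Perm X) (S C D : Finset X), IsStable γ S → C ≠ D → cyclesOn γ S = {C, D} →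
    HasValue r S γ (twoPart C.card D.card)
  three : ∀ (γ : Perm X) (S C D E : Finset X), IsStable γ S → C ≠ D → C ≠ E → D ≠ E →
    cyclesOn γ S = {C, D, E} → HasValue r S γ (threePart C.card D.card E.card)

theorem recTerm_cut_one {r : ℕ} (hr : MinimalCounts X r) {γ : Perm X} {S : Finset X}
    (hS : IsStable γ S) {x y : X} (hx : x ∈ S) (hy : y ∈ S) (h : γ.SameCycle x y) (hxy : x ≠ y)
    {β : ℕ →₀ ℕ} (hβ : r + 3 = (cyclesOn γ S).card + partCount β)
    (hR : (cyclesOn γ S).erase (cycleSet γ x) = ∅) :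
    recTerm S γ β r (x, y) = MvPowerSeries.coeff β
      (onePart (cycleSet (swap x y * γ) x).card * onePart (cycleSet (swap x y * γ) y).card) := by
  rw [recTerm_cut hS hx hy h hxy hβ (fun _ => onePart (cycleSet (swap x y * γ) x).card)
    (fun _ => onePart (cycleSet (swap x y * γ) y).card), hR]
  · simp
  · intro I hI T hT hc
    rw [hR, Finset.subset_empty] at hI
    rw [hI] at hc
    exact hr.one _ _ _ hT hc
  · intro I hI T hT hc
    rw [hR, Finset.empty_sdiff] at hc
    exact hr.one _ _ _ hT hc

theorem recTerm_cut_two {r : ℕ} (hr : MinimalCounts X r) {γ : Perm X} {S : Finset X}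
    (hS : IsStable γ S) {x y : X} (hx : x ∈ S) (hy : y ∈ S) (h : γ.SameCycle x y) (hxy : x ≠ y)
    {β : ℕ →₀ ℕ} (hβ : r + 3 = (cyclesOn γ S).card + partCount β) {D : Finset X}
    (hR : (cyclesOn γ S).erase (cycleSet γ x) = {D}) (W : ℕ → PartRing)
    (hW : ∀ T C, IsStable (swap x y * γ) T → C ≠ D → cyclesOn (swap x y * γ) T = {C, D} →
      HasValue r T (swap x y * γ) (W C.card)) :
    recTerm S γ β r (x, y) = MvPowerSeries.coeff β
      (onePart (cycleSet (swap x y * γ) x).card * W (cycleSet (swap x y * γ) y).card +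
      W (cycleSet (swap x y * γ) x).card * onePart (cycleSet (swap x y * γ) y).card) := by
  have h1 := cycleSet_swap_mul_notMem (S := S) h hxy (Or.inl rfl)
  have h2 := cycleSet_swap_mul_notMem (S := S) h hxy (Or.inr rfl)
  rw [hR, Finset.mem_singleton] at h1 h2
  rw [recTerm_cut hS hx hy h hxy hβ
    (fun I => if D ∈ I then W (cycleSet (swap x y * γ) x).card
      else onePart (cycleSet (swap x y * γ) x).card)
    (fun I => if D ∈ I then onePart (cycleSet (swap x y * γ) y).card
      else W (cycleSet (swap x y * γ) y).card), hR, ← insert_empty_eq D,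
      Finset.sum_powerset_insert (by simp)]
  · simp
  · intro I hI T hT hc
    rw [hR, Finset.subset_singleton_iff] at hI
    rcases hI with rfl | rfl
    · rw [if_neg (by simp)]
      exact hr.one _ _ _ hT hc
    · rw [if_pos (by simp)]
      exact hW _ _ hT h1 hc
  · intro I hI T hT hc
    rw [hR, Finset.subset_singleton_iff] at hI
    rw [hR] at hc
    rcases hI with rfl | rfl
    · rw [if_neg (by simp)]
      exact hW _ _ hT h2 (by simpa using hc)
    · rw [if_pos (by simp)]
      exact hr.one _ _ _ hT (by simpa using hc)

theorem recTerm_cut_three {r : ℕ} (hr : MinimalCounts X r) {γ : Perm X} {S : Finset X}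
    (hS : IsStable γ S) {x y : X} (hx : x ∈ S) (hy : y ∈ S) (h : γ.SameCycle x y) (hxy : x ≠ y)
    {β : ℕ →₀ ℕ} (hβ : r + 3 = (cyclesOn γ S).card + partCount β) {D E : Finset X} (hDE : D ≠ E)
    (hR : (cyclesOn γ S).erase (cycleSet γ x) = {D, E}) (W : ℕ → PartRing)
    (hW : ∀ T C, IsStable (swap x y * γ) T → C ≠ D → C ≠ E →
      cyclesOn (swap x y * γ) T = {C, D, E} → HasValue r T (swap x y * γ) (W C.card)) :
    recTerm S γ β r (x, y) = MvPowerSeries.coeff β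
      (onePart (cycleSet (swap x y * γ) x).card * W (cycleSet (swap x y * γ) y).card +
      W (cycleSet (swap x y * γ) x).card * onePart (cycleSet (swap x y * γ) y).card +
      (twoPart (cycleSet (swap x y * γ) x).card D.card *
        twoPart (cycleSet (swap x y * γ) y).card E.card +
      twoPart (cycleSet (swap x y * γ) x).card E.card *
        twoPart (cycleSet (swap x y * γ) y).card D.card)) := by
  have h1 := cycleSet_swap_mul_notMem (S := S) h hxy (Or.inl rfl)
  have h2 := cycleSet_swap_mul_notMem (S := S) h hxy (Or.inr rfl)
  rw [hR, Finset.mem_insert, Finset.mem_singleton, not_or] at h1 h2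
  have hsub : ∀ I : Finset (Finset X), I ⊆ {D, E} → I = ∅ ∨ I = {D} ∨ I = {E} ∨ I = {D, E} := by
    intro I hI
    rw [← Finset.mem_powerset, Finset.powerset_insert, ← insert_empty_eq E,
      Finset.powerset_insert] at hI
    simp at hI
    tauto
  have e1 : ({D, E} : Finset (Finset X)) \ {D} = {E} := by
    ext; simp; grind
  have e2 : ({D, E} : Finset (Finset X)) \ {E} = {D} := by
    ext; simp; grind
  rw [recTerm_cut hS hx hy h hxy hβ
    (fun I => if D ∈ I then if E ∈ I then W (cycleSet (swap x y * γ) x).card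
        else twoPart (cycleSet (swap x y * γ) x).card D.card
      else if E ∈ I then twoPart (cycleSet (swap x y * γ) x).card E.card
        else onePart (cycleSet (swap x y * γ) x).card)
    (fun I => if D ∈ I then if E ∈ I then onePart (cycleSet (swap x y * γ) y).card
        else twoPart (cycleSet (swap x y * γ) y).card E.card
      else if E ∈ I then twoPart (cycleSet (swap x y * γ) y).card D.card
        else W (cycleSet (swap x y * γ) y).card), hR,
      Finset.sum_powerset_insert (by simpa using hDE), ← insert_empty_eq E,
      Finset.sum_powerset_insert (by simp), Finset.sum_powerset_insert (by simp)]
  · simp [hDE, hDE.symm]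
    ring
  · intro I hI T hT hc
    rw [hR] at hI
    rcases hsub I hI with rfl | rfl | rfl | rfl
    · simpa using hr.one _ _ _ hT hc
    · simpa [hDE.symm] using hr.two _ _ _ _ hT h1.1 hc
    · simpa [hDE] using hr.two _ _ _ _ hT h1.2 hc
    · simpa using hW _ _ hT h1.1 h1.2 hc
  · intro I hI T hT hc
    rw [hR] at hI hc
    rcases hsub I hI with rfl | rfl | rfl | rfl
    · rw [Finset.sdiff_empty] at hc
      simpa using hW _ _ hT h2.1 h2.2 hc
    · rw [e1] at hc
      simpa [hDE.symm] using hr.two _ _ _ _ hT h2.2 hc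
    · rw [e2] at hc
      simpa [hDE] using hr.two _ _ _ _ hT h2.1 hc
    · rw [Finset.sdiff_self] at hc
      simpa using hr.one _ _ _ hT hc

theorem sum_antidiagonal_mul_comm (n : ℕ) (A B : ℕ → PartRing) :
    ∑ p ∈ Finset.HasAntidiagonal.antidiagonal n, A p.1 * B p.2 =
      ∑ p ∈ Finset.HasAntidiagonal.antidiagonal n, B p.1 * A p.2 := by
  rw [← Finset.Nat.sum_antidiagonal_swap]
  exact Finset.sum_congr rfl fun p _ => mul_comm _ _

theorem twoPart_zero_left (b : ℕ) : twoPart 0 b = 0 := by simp [twoPart]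

theorem twoPart_zero_right (a : ℕ) : twoPart a 0 = 0 := by simp [twoPart]

theorem transCount_one_succ {r : ℕ} (hr : MinimalCounts X r) {γ : Perm X} {S C : Finset X}
    (hS : IsStable γ S) (hC : cyclesOn γ S = {C}) {β : ℕ →₀ ℕ}
    (hβ : r + 3 = (cyclesOn γ S).card + partCount β) :
    transCount S γ β (r + 1) = MvPowerSeries.coeff β (onePart C.card) := by
  have hr0 : (2 * ((r : ℚ) + 1)) ≠ 0 := by positivity
  have hmem : ∀ x ∈ S, cycleSet γ x = C := fun x hx => by
    have := cycleSet_mem γ hx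
    rwa [hC, Finset.mem_singleton] at this
  rw [← mul_right_inj' hr0, transCount_succ hS]
  refine (sum_offDiag hS (recTerm S γ β r)
    (fun _ k l => MvPowerSeries.coeff β (onePart k * onePart l)) (fun _ _ => 0)
    (by simp [onePart_zero]) (by simp [onePart_zero]) ?_ ?_).trans ?_
  · intro x hx y hy h hxy
    exact recTerm_cut_one hr hS hx hy h hxy hβ (by rw [hC, hmem x hx]; simp)
  · intro x hx y hy h
    exact absurd (cycleSet_eq_iff.1 ((hmem x hx).trans (hmem y hy).symm)) h
  -- The factor `2 (r + 1)` of `transCount_succ` is `2 (n - 1)`, where `n` is the number of parts of `β`;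
  -- for two and three cycles it is `2 n` and `2 (n + 1)`.
  · have h1 := congrArg (MvPowerSeries.coeff β) (countDer_onePart C.card)
    rw [← nsmul_eq_mul, map_nsmul, two_mul, map_add, map_sub (MvPowerSeries.coeff β),
      coeff_countDer, map_sum] at h1
    rw [hC] at hβ ⊢
    rw [Finset.card_singleton] at hβ
    have hb : (partCount β : ℚ) = r + 2 := by
      have : partCount β = r + 2 := by omega
      rw [this]; push_cast; ring
    rw [Finset.sum_singleton]
    simp only [mul_zero, Finset.sum_const_zero, add_zero]
    rw [← nsmul_eq_mul, ← h1, hb]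
    ring

theorem transCount_two_succ {r : ℕ} (hr : MinimalCounts X r) {γ : Perm X} {S C D : Finset X}
    (hS : IsStable γ S) (hCD : C ≠ D) (hC : cyclesOn γ S = {C, D}) {β : ℕ →₀ ℕ}
    (hβ : r + 3 = (cyclesOn γ S).card + partCount β) :
    transCount S γ β (r + 1) = MvPowerSeries.coeff β (twoPart C.card D.card) := by
  have hr0 : (2 * ((r : ℚ) + 1)) ≠ 0 := by positivity
  have hmem : ∀ x ∈ S, cycleSet γ x = C ∨ cycleSet γ x = D := fun x hx => by
    have := cycleSet_mem γ hx
    rwa [hC, Finset.mem_insert, Finset.mem_singleton] at this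
  have e1 : ({C, D} : Finset (Finset X)).erase C = {D} := by ext; simp; grind
  have e2 : ({C, D} : Finset (Finset X)).erase D = {C} := by ext; simp; grind
  have hC0 : C.card ≠ 0 := card_pos_of_mem_cyclesOn (γ := γ) (S := S) (by simp [hC])
  have hD0 : D.card ≠ 0 := card_pos_of_mem_cyclesOn (γ := γ) (S := S) (by simp [hC])
  rw [← mul_right_inj' hr0, transCount_succ hS]
  refine (sum_offDiag hS (recTerm S γ β r)
    (fun Z k l => MvPowerSeries.coeff β (if Z = C then
      onePart k * twoPart l D.card + twoPart k D.card * onePart l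
      else onePart k * twoPart C.card l + twoPart C.card k * onePart l))
    (fun Z W => MvPowerSeries.coeff β (onePart (Z.card + W.card))) ?_ ?_ ?_ ?_).trans ?_
  · intro Z k
    split_ifs <;> simp [onePart_zero, twoPart_zero_left, twoPart_zero_right]
  · intro Z k
    split_ifs <;> simp [onePart_zero, twoPart_zero_left, twoPart_zero_right]
  · intro x hx y hy h hxy
    rcases hmem x hx with h1 | h1
    · rw [h1, if_pos rfl]
      exact recTerm_cut_two hr hS hx hy h hxy hβ (by rw [hC, h1, e1]) (fun k => twoPart k D.card)
        fun T C' hT hne hc => hr.two _ _ _ _ hT hne hc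
    · rw [h1, if_neg hCD.symm]
      exact recTerm_cut_two hr hS hx hy h hxy hβ (by rw [hC, h1, e2]) (fun k => twoPart C.card k)
        fun T C' hT hne hc => hr.two _ _ _ _ hT hne.symm (by rw [hc, Finset.pair_comm])
  · intro x hx y hy h
    have hS' : IsStable (swap x y * γ) S := (isStable_swap_mul (by simp [hx, hy])).2 hS
    have h1 := cyclesOn_swap_mul_of_not_sameCycle (S := S) hx h
    have h2 : ((cyclesOn γ S).erase (cycleSet γ x)).erase (cycleSet γ y) = ∅ := by
      have := cycleSet_ne_of_not_sameCycle h
      rw [hC]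
      rcases hmem x hx with h3 | h3 <;> rcases hmem y hy with h4 | h4
      · exact absurd (h3.trans h4.symm) this
      · rw [h3, h4, e1]; simp
      · rw [h3, h4, e2]; simp
      · exact absurd (h3.trans h4.symm) this
    rw [h2, insert_empty_eq] at h1
    have h3 := recTerm_join hx hy h hβ (hr.one _ _ _ hS' h1)
    rwa [card_union_of_not_sameCycle h] at h3
  · have h1 := congrArg (MvPowerSeries.coeff β) (countDer_twoPart hC0 hD0)
    rw [coeff_countDer] at h1
    rw [hC] at hβ ⊢
    rw [Finset.card_pair hCD] at hβ
    have hb : (partCount β : ℚ) = r + 1 := by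
      have : partCount β = r + 1 := by omega
      rw [this]; push_cast; ring
    have s1 := congrArg (MvPowerSeries.coeff β)
      (sum_antidiagonal_mul_comm C.card (fun k => twoPart k D.card) onePart)
    have s2 := congrArg (MvPowerSeries.coeff β)
      (sum_antidiagonal_mul_comm D.card (fun k => twoPart C.card k) onePart)
    simp only [map_add, mul_assoc, coeff_partRing_natCast_mul, map_sum] at h1 s1 s2
    rw [Finset.sum_pair hCD, e1, e2, Finset.sum_singleton, Finset.sum_singleton]
    simp only [if_pos, if_neg hCD.symm, map_add, Finset.sum_add_distrib, add_comm D.card]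
    rw [hb] at h1
    linear_combination (C.card : ℚ) * s1 + (D.card : ℚ) * s2 - 2 * h1

theorem transCount_three_succ {r : ℕ} (hr : MinimalCounts X r) {γ : Perm X} {S C D E : Finset X}
    (hS : IsStable γ S) (hCD : C ≠ D) (hCE : C ≠ E) (hDE : D ≠ E) (hC : cyclesOn γ S = {C, D, E})
    {β : ℕ →₀ ℕ} (hβ : r + 3 = (cyclesOn γ S).card + partCount β) :
    transCount S γ β (r + 1) = MvPowerSeries.coeff β (threePart C.card D.card E.card) := by
  have hr0 : (2 * ((r : ℚ) + 1)) ≠ 0 := by positivity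
  have hmem : ∀ x ∈ S, cycleSet γ x = C ∨ cycleSet γ x = D ∨ cycleSet γ x = E := fun x hx => by
    have := cycleSet_mem γ hx
    rwa [hC, Finset.mem_insert, Finset.mem_insert, Finset.mem_singleton] at this
  have e1 : ({C, D, E} : Finset (Finset X)).erase C = {D, E} := by ext; simp; grind
  have e2 : ({C, D, E} : Finset (Finset X)).erase D = {C, E} := by ext; simp; grind
  have e3 : ({C, D, E} : Finset (Finset X)).erase E = {C, D} := by ext; simp; grind
  have hC0 : C.card ≠ 0 := card_pos_of_mem_cyclesOn (γ := γ) (S := S) (by simp [hC])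
  have hD0 : D.card ≠ 0 := card_pos_of_mem_cyclesOn (γ := γ) (S := S) (by simp [hC])
  have hE0 : E.card ≠ 0 := card_pos_of_mem_cyclesOn (γ := γ) (S := S) (by simp [hC])
  rw [← mul_right_inj' hr0, transCount_succ hS]
  refine (sum_offDiag hS (recTerm S γ β r)
    (fun Z k l => MvPowerSeries.coeff β (if Z = C then
      onePart k * threePart l D.card E.card + threePart k D.card E.card * onePart l +
        (twoPart k D.card * twoPart l E.card + twoPart k E.card * twoPart l D.card)
      else if Z = D then
      onePart k * threePart C.card l E.card + threePart C.card k E.card * onePart l +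
        (twoPart k C.card * twoPart l E.card + twoPart k E.card * twoPart l C.card)
      else
      onePart k * threePart C.card D.card l + threePart C.card D.card k * onePart l +
        (twoPart k C.card * twoPart l D.card + twoPart k D.card * twoPart l C.card)))
    (fun Z W => MvPowerSeries.coeff β (twoPart (Z.card + W.card)
      (C.card + D.card + E.card - (Z.card + W.card)))) ?_ ?_ ?_ ?_).trans ?_
  · intro Z k
    split_ifs <;> simp [onePart_zero, twoPart_zero_left, threePart]
  · intro Z k
    split_ifs <;> simp [onePart_zero, twoPart_zero_left, threePart]
  · intro x hx y hy h hxy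
    rcases hmem x hx with h1 | h1 | h1
    · rw [h1, if_pos rfl]
      exact recTerm_cut_three hr hS hx hy h hxy hβ hDE (by rw [hC, h1, e1])
        (fun k => threePart k D.card E.card)
        fun T C' hT n1 n2 hc => hr.three _ _ _ _ _ hT n1 n2 hDE hc
    · rw [h1, if_neg hCD.symm, if_pos rfl]
      exact recTerm_cut_three hr hS hx hy h hxy hβ hCE (by rw [hC, h1, e2])
        (fun k => threePart C.card k E.card)
        fun T C' hT n1 n2 hc => hr.three _ _ _ _ _ hT n1.symm hCE n2
          (by rw [hc, Finset.insert_comm])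
    · rw [h1, if_neg hCE.symm, if_neg hDE.symm]
      exact recTerm_cut_three hr hS hx hy h hxy hβ hCD (by rw [hC, h1, e3])
        (fun k => threePart C.card D.card k)
        fun T C' hT n1 n2 hc => hr.three _ _ _ _ _ hT hCD n1.symm n2.symm
          (by rw [hc, Finset.insert_comm, Finset.pair_comm])
  · intro x hx y hy h
    have hS' : IsStable (swap x y * γ) S := (isStable_swap_mul (by simp [hx, hy])).2 hS
    have h1 := cyclesOn_swap_mul_of_not_sameCycle (S := S) hx h
    have hne := cycleSet_ne_of_not_sameCycle h
    have hcu := card_union_of_not_sameCycle h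
    have hnm := union_notMem_cyclesOn (γ := γ) (S := S) (x := x) (y := y)
    obtain ⟨Z, hZ, hZc⟩ : ∃ Z, ((cyclesOn γ S).erase (cycleSet γ x)).erase (cycleSet γ y) = {Z} ∧
        C.card + D.card + E.card - ((cycleSet γ x).card + (cycleSet γ y).card) = Z.card := by
      rw [hC]
      rcases hmem x hx with h3 | h3 | h3 <;> rcases hmem y hy with h4 | h4 | h4 <;>
        rw [h3, h4] at hne ⊢
      · exact absurd rfl hne
      · exact ⟨E, by ext; simp; grind, by omega⟩
      · exact ⟨D, by ext; simp; grind, by omega⟩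
      · exact ⟨E, by ext; simp; grind, by omega⟩
      · exact absurd rfl hne
      · exact ⟨C, by ext; simp; grind, by omega⟩
      · exact ⟨D, by ext; simp; grind, by omega⟩
      · exact ⟨C, by ext; simp; grind, by omega⟩
      · exact absurd rfl hne
    rw [hZ] at h1 hnm
    rw [hZc, ← hcu]
    exact recTerm_join hx hy h hβ (hr.two _ _ _ _ hS' (by simpa using hnm) h1)
  · have h1 := congrArg (MvPowerSeries.coeff β) (countDer_threePart hC0 hD0 hE0)
    rw [map_add, coeff_countDer] at h1
    rw [hC] at hβ ⊢
    rw [Finset.card_eq_three.2 ⟨C, D, E, hCD, hCE, hDE, rfl⟩] at hβ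
    have hb : (partCount β : ℚ) = r := by
      have : partCount β = r := by omega
      rw [this]
    have s1 := congrArg (MvPowerSeries.coeff β)
      (sum_antidiagonal_mul_comm C.card (fun k => threePart k D.card E.card) onePart)
    have s2 := congrArg (MvPowerSeries.coeff β)
      (sum_antidiagonal_mul_comm D.card (fun k => threePart C.card k E.card) onePart)
    have s3 := congrArg (MvPowerSeries.coeff β)
      (sum_antidiagonal_mul_comm E.card (fun k => threePart C.card D.card k) onePart)
    have t1 := congrArg (MvPowerSeries.coeff β) (sum_antidiagonal_mul_comm C.card
      (fun k => twoPart k E.card) fun k => twoPart k D.card)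
    have t2 := congrArg (MvPowerSeries.coeff β) (sum_antidiagonal_mul_comm D.card
      (fun k => twoPart k E.card) fun k => twoPart k C.card)
    have t3 := congrArg (MvPowerSeries.coeff β) (sum_antidiagonal_mul_comm E.card
      (fun k => twoPart k D.card) fun k => twoPart k C.card)
    simp only [map_add, mul_assoc, coeff_partRing_natCast_mul, map_sum, Finset.sum_add_distrib]
      at h1 s1 s2 s3 t1 t2 t3
    rw [Finset.sum_insert (by simp [hCD, hCE]), Finset.sum_pair hDE, e1, e2, e3,
      Finset.sum_pair hDE, Finset.sum_pair hCE, Finset.sum_pair hCD]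
    have n1 : C.card + D.card + E.card - (C.card + D.card) = E.card := by omega
    have n2 : C.card + D.card + E.card - (C.card + E.card) = D.card := by omega
    have n3 : C.card + D.card + E.card - (D.card + E.card) = C.card := by omega
    simp only [if_pos, if_neg hCD.symm, if_neg hCE.symm, if_neg hDE.symm, map_add,
      Finset.sum_add_distrib, add_comm D.card C.card, add_comm E.card C.card,
      add_comm E.card D.card, n1, n2, n3]
    rw [hb] at h1
    linear_combination (C.card : ℚ) * (s1 + t1) + (D.card : ℚ) * (s2 + t2) +
      (E.card : ℚ) * (s3 + t3) - 2 * h1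

theorem HasValue.succ {r : ℕ} {S : Finset X} {γ : Perm X} {A : PartRing} (h : HasValue r S γ A)
    (h' : ∀ β, r + 3 = (cyclesOn γ S).card + partCount β →
      transCount S γ β (r + 1) = MvPowerSeries.coeff β A) : HasValue (r + 1) S γ A := by
  refine ⟨h.1, fun s hs β hβ => ?_⟩
  rcases Nat.le_succ_iff.1 hs with hs | rfl
  · exact h.2 s hs β hβ
  · exact h' β (by omega)

theorem coeff_zero_onePart {a : ℕ} (ha : a ≠ 0) : MvPowerSeries.coeff 0 (onePart a) = 0 := by
  rw [coeff_onePart ha, if_neg]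
  rintro ⟨h, _⟩
  exact ha (by simpa using h.symm)

theorem hasValue_one_zero {γ : Perm X} {S C : Finset X} (hS : IsStable γ S)
    (hC : cyclesOn γ S = {C}) : HasValue 0 S γ (onePart C.card) := by
  have hC0 : C.card ≠ 0 := card_pos_of_mem_cyclesOn (γ := γ) (S := S) (by simp [hC])
  have hSC : S = C := by rw [← biUnion_cyclesOn hS, hC]; simp
  rw [HasValue, hC, Finset.card_singleton]
  refine ⟨fun β hβ => ?_, fun s hs β hβ => ?_⟩
  · rw [partCount_eq_zero.1 (show partCount β = 0 by omega), coeff_zero_onePart hC0]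
  · obtain rfl : s = 0 := by omega
    have hconn : IsConnectedOn S γ [] := by
      rintro S' hS'S ⟨x, hx⟩ hst _
      have h1 := cycleSet_mem γ (hS'S hx)
      rw [hC, Finset.mem_singleton, ← hSC] at h1
      exact hS'S.antisymm (h1 ▸ hst.cycleSet_subset hx)
    obtain ⟨k, rfl⟩ : ∃ k, β = Finsupp.single k 1 := by
      obtain ⟨k, hk⟩ := Finsupp.ne_iff.1 (show β ≠ 0 by rintro rfl; simp at hβ)
      have h1 := Finsupp.single_le_iff.2 (Nat.one_le_iff_ne_zero.2 hk)
      have h2 := congrArg partCount (tsub_add_cancel_of_le h1)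
      rw [map_add, partCount_single] at h2
      refine ⟨k, ?_⟩
      rw [← tsub_add_cancel_of_le h1, partCount_eq_zero.1 (show partCount (β - _) = 0 by omega),
        zero_add]
    rw [transCount_zero, ind_true hconn, mul_one, coeff_onePart hC0, typeOn, hC,
      Finset.sum_singleton]
    by_cases hk : k = C.card
    · subst hk
      rw [ind_true rfl, if_pos]
      · simp [multFactorial, hC0]
      · simp [Ne.symm hC0]
    · rw [ind_false, if_neg]
      · rintro ⟨h, _⟩
        exact hk (by simpa using h)
      · intro h
        exact hk (by simpa using (Finsupp.single_left_injective one_ne_zero h).symm)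

theorem hasValue_two_zero {γ : Perm X} {S C D : Finset X} (hCD : C ≠ D)
    (hC : cyclesOn γ S = {C, D}) : HasValue 0 S γ (twoPart C.card D.card) := by
  refine ⟨fun β hβ => ?_, fun s hs β hβ => ?_⟩ <;> rw [hC, Finset.card_pair hCD] at hβ
  · omega
  · obtain rfl : s = 0 := by omega
    rw [partCount_eq_zero.1 (show partCount β = 0 by omega), coeff_zero_twoPart, transCount_zero,
      ind_false, zero_mul]
    intro h
    have := partCount_typeOn γ S
    rw [h, map_zero, hC, Finset.card_pair hCD] at this
    omega

/-- A permutation with one, two or three cycles on `S` has as many genus `0` factorizations as the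
coefficients of `onePart`, `twoPart` and `threePart` say, since both sides obey the cut-and-join
recursion. -/
theorem minimalCounts (r : ℕ) : MinimalCounts X r := by
  induction r with
  | zero =>
    refine ⟨fun γ S C hS hC => hasValue_one_zero hS hC,
      fun γ S C D hS h hC => hasValue_two_zero h hC, fun γ S C D E hS h1 h2 h3 hC => ?_⟩
    have h4 : (cyclesOn γ S).card = 3 := by
      rw [hC]; exact Finset.card_eq_three.2 ⟨C, D, E, h1, h2, h3, rfl⟩
    exact ⟨fun β hβ => by omega, fun s hs β hβ => by omega⟩
  | succ r ih =>
    exact ⟨fun γ S C hS hC => (ih.one γ S C hS hC).succ fun β hβ =>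
        transCount_one_succ ih hS hC hβ,
      fun γ S C D hS h hC => (ih.two γ S C D hS h hC).succ fun β hβ =>
        transCount_two_succ ih hS h hC hβ,
      fun γ S C D E hS h1 h2 h3 hC => (ih.three γ S C D E hS h1 h2 h3 hC).succ fun β hβ =>
        transCount_three_succ ih hS h1 h2 h3 hC hβ⟩

end MinimalCounts

/-! ### Permutations of given cycle type and monodromy groups -/

section Monodromy

open Equiv

theorem autOrder_eq_prod {s : Multiset ℕ} {F : Finset ℕ} (h : s.toFinset ⊆ F) :
    autOrder s = ∏ i ∈ F, (s.count i).factorial := by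
  rw [autOrder]
  refine Finset.prod_subset h fun i _ hi => ?_
  rw [Multiset.count_eq_zero_of_notMem (by simpa using hi), Nat.factorial_zero]

theorem eq_filter_add_replicate {s : Multiset ℕ} (hs : ∀ i ∈ s, 0 < i) :
    s = s.filter (2 ≤ ·) + Multiset.replicate (s.sum - (s.filter (2 ≤ ·)).sum) 1 := by
  have h1 : s.filter (fun i => ¬ 2 ≤ i) =
      Multiset.replicate (Multiset.card (s.filter (fun i => ¬ 2 ≤ i))) 1 := by
    rw [Multiset.eq_replicate_card]
    intro i hi
    obtain ⟨hi, h2⟩ := Multiset.mem_filter.1 hi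
    have := hs i hi
    omega
  have h2 := Multiset.filter_add_not (fun i => 2 ≤ i) s
  have h3 := congrArg Multiset.sum h2
  rw [Multiset.sum_add] at h3
  have h4 := congrArg Multiset.sum h1
  rw [Multiset.sum_replicate, smul_eq_mul, mul_one] at h4
  have h5 : s.sum - (s.filter (2 ≤ ·)).sum = Multiset.card (s.filter (fun i => ¬ 2 ≤ i)) := by
    omega
  rw [h5, ← h1, h2]

/-- The number of permutations with given lengths of cycles, from Mathlib's count by the lengths of the
nontrivial cycles. -/
theorem card_filter_partition {d : ℕ} (α : Nat.Partition d) :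
    (Finset.univ.filter fun γ : Perm (Fin d) => γ.partition.parts = α.parts).card *
      (α.parts.prod * autOrder α.parts) = d.factorial := by
  set m := α.parts.filter (2 ≤ ·) with hm
  have hα := eq_filter_add_replicate (s := α.parts) fun i hi => α.parts_pos hi
  rw [α.parts_sum, ← hm] at hα
  have hsum : m.sum ≤ d := by
    have := congrArg Multiset.sum hα
    rw [α.parts_sum, Multiset.sum_add] at this
    omega
  have h1m : 1 ∉ m := by simp [hm]
  have h1 : ∀ γ : Perm (Fin d), γ.partition.parts = α.parts ↔ γ.cycleType = m := by
    intro γ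
    constructor
    · intro h
      rw [← Perm.filter_parts_partition_eq_cycleType, h]
    · intro h
      rw [Perm.parts_partition, ← Perm.sum_cycleType, h, Fintype.card_fin, ← hα]
  have h2 : autOrder α.parts = (d - m.sum).factorial * ∏ n ∈ m.toFinset, (m.count n).factorial := by
    rw [autOrder_eq_prod (F := insert 1 m.toFinset), Finset.prod_insert (by simpa using h1m)]
    · congr 1
      · conv_lhs => rw [hα]
        rw [Multiset.count_add, Multiset.count_eq_zero_of_notMem h1m, zero_add,
          Multiset.count_replicate_self]
      · refine Finset.prod_congr rfl fun n hn => ?_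
        have hn1 : n ≠ 1 := fun h => h1m (by simpa [h] using hn)
        conv_lhs => rw [hα]
        rw [Multiset.count_add, Multiset.count_replicate, if_neg hn1.symm, add_zero]
    · intro n hn
      rw [Multiset.mem_toFinset, hα, Multiset.mem_add, Multiset.mem_replicate] at hn
      rw [Finset.mem_insert, Multiset.mem_toFinset]
      tauto
  have h3 : α.parts.prod = m.prod := by
    conv_lhs => rw [hα]
    rw [Multiset.prod_add, Multiset.prod_replicate, one_pow, mul_one]
  have h4 := Perm.card_of_cycleType_mul_eq (Fin d) m
  rw [Fintype.card_fin, if_pos ⟨hsum, fun a ha => (Multiset.mem_filter.1 ha).2⟩] at h4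
  simp only [h1]
  rw [h2, h3, ← h4]
  ring

theorem cyclesOn_univ {X : Type*} [Fintype X] [DecidableEq X] (γ : Perm X) :
    cyclesOn γ Finset.univ = γ.cycleFactorsFinset.image Perm.support ∪
      (Finset.univ \ γ.support).image fun x => {x} := by
  have h1 : ∀ x ∈ γ.support, (γ.cycleOf x).support = cycleSet γ x := fun x hx => by
    ext y
    rw [Perm.mem_support_cycleOf_iff, mem_cycleSet, and_iff_left hx]
  have h2 : ∀ x ∉ γ.support, cycleSet γ x = {x} := fun x hx => by
    have hx' : γ x = x := by simpa using hx
    ext y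
    rw [mem_cycleSet, Finset.mem_singleton]
    constructor
    · rintro ⟨k, rfl⟩
      exact Perm.zpow_apply_eq_self_of_apply_eq_self hx' k
    · rintro rfl
      exact Perm.SameCycle.refl _ _
  ext C
  rw [mem_cyclesOn, Finset.mem_union, Finset.mem_image, Finset.mem_image]
  constructor
  · rintro ⟨x, _, rfl⟩
    by_cases hx : x ∈ γ.support
    · exact Or.inl ⟨_, Perm.cycleOf_mem_cycleFactorsFinset_iff.2 hx, h1 x hx⟩
    · exact Or.inr ⟨x, by simpa using hx, (h2 x hx).symm⟩
  · rintro (⟨c, hc, rfl⟩ | ⟨x, hx, rfl⟩)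
    · obtain ⟨x, hx⟩ := (Perm.mem_cycleFactorsFinset_iff.1 hc).1.nonempty_support
      have h3 := Perm.cycle_is_cycleOf hx hc
      refine ⟨x, Finset.mem_univ x, ?_⟩
      rw [← h1 x (Perm.mem_cycleFactorsFinset_support_le hc hx), ← h3]
    · exact ⟨x, Finset.mem_univ x, h2 x (Finset.mem_sdiff.1 hx).2⟩

theorem parts_partition_eq_map {X : Type*} [Fintype X] [DecidableEq X] (γ : Perm X) :
    γ.partition.parts = (cyclesOn γ Finset.univ).val.map Finset.card := by
  have h : (cyclesOn γ Finset.univ).val = γ.cycleFactorsFinset.val.map Perm.support +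
      (Finset.univ \ γ.support).val.map fun x => {x} := by
    rw [cyclesOn_univ, ← Finset.disjUnion_eq_union _ _, Finset.disjUnion_val,
      Finset.image_val_of_injOn, Finset.image_val_of_injOn]
    · exact fun a _ b _ hab => Finset.singleton_injective hab
    · intro c hc c' hc' h
      obtain ⟨x, hx⟩ := (Perm.mem_cycleFactorsFinset_iff.1 hc).1.nonempty_support
      rw [Perm.cycle_is_cycleOf hx hc]
      rw [h] at hx
      rw [← Perm.cycle_is_cycleOf hx hc']
    · rw [Finset.disjoint_left]
      intro C hC hC'
      obtain ⟨c, hc, rfl⟩ := Finset.mem_image.1 hC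
      obtain ⟨x, _, hx⟩ := Finset.mem_image.1 hC'
      have := (Perm.mem_cycleFactorsFinset_iff.1 hc).1.two_le_card_support
      rw [← hx] at this
      simp at this
  rw [h, Multiset.map_add, Multiset.map_map, Multiset.map_map, Perm.parts_partition,
    Perm.cycleType_def]
  congr 1
  symm
  rw [Multiset.eq_replicate]
  simp only [Function.comp_def, Finset.card_singleton, Multiset.card_map, Finset.card_val,
    Finset.card_univ_sdiff, Multiset.mem_map, true_and]
  rintro b ⟨_, _, rfl⟩
  rfl

theorem toFinsupp_parts_partition {X : Type*} [Fintype X] [DecidableEq X] (γ : Perm X) :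
    Multiset.toFinsupp γ.partition.parts = typeOn γ Finset.univ := by
  rw [parts_partition_eq_map, typeOn]
  have h : ∀ s : Multiset (Finset X), Multiset.toFinsupp (s.map Finset.card) =
      (s.map fun C => Finsupp.single C.card 1).sum := by
    intro s
    induction s using Multiset.induction_on with
    | empty => simp
    | cons C s ih =>
      rw [Multiset.map_cons, Multiset.map_cons, Multiset.sum_cons, ← ih, ← Multiset.singleton_add,
        map_add, Multiset.toFinsupp_singleton]
  exact h _

theorem act_eq_prod {X : Type*} [DecidableEq X] (L : List (X × X)) (γ : Perm X) :
    act L γ = (L.map fun p => swap p.1 p.2).reverse.prod * γ := by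
  induction L generalizing γ with
  | nil => simp [act]
  | cons p L ih => rw [act, ih]; simp [mul_assoc]

/-- Transitivity in terms of stable sets. -/
theorem isConnectedOn_iff {X : Type*} [Fintype X] [DecidableEq X] [Nonempty X] (γ : Perm X)
    (L : List (X × X)) :
    IsConnectedOn Finset.univ γ L ↔ MulAction.IsPretransitive
      (Subgroup.closure (insert γ {t | t ∈ L.map fun p => swap p.1 p.2})) X := by
  set H := Subgroup.closure (insert γ {t | t ∈ L.map fun p => swap p.1 p.2}) with hH
  have hγ : γ ∈ H := Subgroup.subset_closure (Set.mem_insert _ _)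
  have hL : ∀ p ∈ L, swap p.1 p.2 ∈ H := fun p hp =>
    Subgroup.subset_closure (Set.mem_insert_of_mem _ (List.mem_map.2 ⟨p, hp, rfl⟩))
  constructor
  · intro h
    refine ⟨fun x y => ?_⟩
    classical
    have h1 := h (Finset.univ.filter fun z => ∃ g ∈ H, g x = z) (Finset.subset_univ _)
      ⟨x, by simpa using ⟨1, H.one_mem, rfl⟩⟩ (isStable_of_forall_mem fun z hz => ?_) fun p hp => ?_
    · have h2 := Finset.mem_univ y
      rw [← h1] at h2
      obtain ⟨g, hg, hgx⟩ := (Finset.mem_filter.1 h2).2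
      exact ⟨⟨g, hg⟩, hgx⟩
    · obtain ⟨g, hg, rfl⟩ := (Finset.mem_filter.1 hz).2
      exact Finset.mem_filter.2 ⟨Finset.mem_univ _, γ * g, H.mul_mem hγ hg, rfl⟩
    · rw [Finset.mem_filter, Finset.mem_filter]
      constructor
      · rintro ⟨_, g, hg, h⟩
        exact ⟨Finset.mem_univ _, _, H.mul_mem (hL p hp) hg, by rw [Perm.mul_apply, h]; simp⟩
      · rintro ⟨_, g, hg, h⟩
        exact ⟨Finset.mem_univ _, _, H.mul_mem (hL p hp) hg, by rw [Perm.mul_apply, h]; simp⟩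
  · rintro h S' - ⟨x, hx⟩ hst hLS
    have h1 : ∀ g ∈ H, ∀ z, g z ∈ S' ↔ z ∈ S' := by
      intro g hg
      induction hg using Subgroup.closure_induction with
      | mem g hg =>
        rcases hg with rfl | hg
        · exact hst
        · obtain ⟨p, hp, rfl⟩ := List.mem_map.1 hg
          exact swap_apply_mem_iff (hLS p hp)
      | one => simp
      | mul g g' _ _ ih ih' => intro z; rw [Perm.mul_apply, ih, ih']
      | inv g _ ih => intro z; rw [← ih]; simp
    refine Finset.eq_univ_iff_forall.2 fun y => ?_
    obtain ⟨⟨g, hg⟩, rfl⟩ := h.exists_smul_eq x y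
    exact (h1 g hg x).2 hx

open Classical in
theorem sum_offDiag_swap {X : Type*} [Fintype X] [DecidableEq X] (f : Perm X → ℚ) :
    ∑ p ∈ (Finset.univ : Finset X).offDiag, f (swap p.1 p.2) =
      2 * ∑ t ∈ Finset.univ.filter fun t : Perm X => t.IsSwap, f t := by
  rw [← Finset.sum_fiberwise_of_maps_to
    (g := fun p : X × X => swap p.1 p.2)
    (t := Finset.univ.filter fun t : Perm X => t.IsSwap), Finset.mul_sum]
  · refine Finset.sum_congr rfl fun t ht => ?_
    obtain ⟨x, y, hxy, rfl⟩ := (Finset.mem_filter.1 ht).2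
    have : (Finset.univ : Finset X).offDiag.filter (fun p => swap p.1 p.2 = swap x y) =
        {(x, y), (y, x)} := by
      ext ⟨a, b⟩
      rw [Finset.mem_filter, Finset.mem_offDiag, Finset.mem_insert, Finset.mem_singleton,
        Prod.mk.injEq, Prod.mk.injEq]
      constructor
      · rintro ⟨⟨_, _, hab⟩, h⟩
        dsimp only at hab h
        have h1 := congrArg (fun g : Perm X => g a) h
        have h2 := congrArg (fun g : Perm X => g x) h
        simp only [swap_apply_left] at h1 h2
        by_cases hax : a = x
        · subst hax
          rw [swap_apply_left] at h1
          exact Or.inl ⟨rfl, h1⟩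
        · by_cases hay : a = y
          · subst hay
            rw [swap_apply_right] at h1
            exact Or.inr ⟨rfl, h1⟩
          · rw [swap_apply_of_ne_of_ne hax hay] at h1
            exact absurd h1.symm hab
      · rintro (⟨rfl, rfl⟩ | ⟨rfl, rfl⟩)
        · simp [hxy]
        · simp [hxy.symm, swap_comm]
    rw [Finset.sum_congr rfl (g := fun _ => f (swap x y)), Finset.sum_const, this,
      Finset.card_pair (by simp [hxy]), nsmul_eq_mul]
    · norm_num
    · intro p hp
      rw [(Finset.mem_filter.1 hp).2]
  · intro p hp
    obtain ⟨_, _, h⟩ := Finset.mem_offDiag.1 hp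
    exact Finset.mem_filter.2 ⟨Finset.mem_univ _, p.1, p.2, h, rfl⟩

/-- The normalization of `wordSum` turns words of ordered pairs into sequences of transpositions. -/
theorem factorial_mul_wordSum {X : Type*} [Fintype X] [DecidableEq X] (r : ℕ)
    (f : List (Perm X) → ℚ) :
    (r.factorial : ℚ) * wordSum (Finset.univ : Finset X).offDiag r
      (fun L => f (L.map fun p => swap p.1 p.2)) =
    ∑ τ : Fin r → Perm X, ind (∀ i, (τ i).IsSwap) * f (List.ofFn τ) := by
  classical
  induction r generalizing f with
  | zero =>
    rw [Fintype.sum_unique, ind_true (fun i => i.elim0)]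
    simp [wordSum]
  | succ r ih =>
    have h1 := wordSum_succ (Finset.univ : Finset X).offDiag r
      (fun L => f (L.map fun p => swap p.1 p.2))
    simp only [List.map_cons] at h1
    have h2 : (r.factorial : ℚ) * ∑ e ∈ (Finset.univ : Finset X).offDiag,
        wordSum (Finset.univ : Finset X).offDiag r
          (fun L => f (swap e.1 e.2 :: L.map fun p => swap p.1 p.2)) =
        2 * ∑ t ∈ Finset.univ.filter fun t : Perm X => t.IsSwap,
          ∑ τ : Fin r → Perm X, ind (∀ i, (τ i).IsSwap) * f (t :: List.ofFn τ) := by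
      rw [← sum_offDiag_swap (fun t => ∑ τ : Fin r → Perm X,
        ind (∀ i, (τ i).IsSwap) * f (t :: List.ofFn τ)), Finset.mul_sum]
      exact Finset.sum_congr rfl fun e _ => ih fun L => f (swap e.1 e.2 :: L)
    have h3 : ∑ τ : Fin (r + 1) → Perm X, ind (∀ i, (τ i).IsSwap) * f (List.ofFn τ) =
        ∑ t ∈ Finset.univ.filter fun t : Perm X => t.IsSwap,
          ∑ τ : Fin r → Perm X, ind (∀ i, (τ i).IsSwap) * f (t :: List.ofFn τ) := by
      rw [← (Fin.consEquiv fun _ => Perm X).sum_comp, Fintype.sum_prod_type, Finset.sum_filter]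
      refine Finset.sum_congr rfl fun t _ => ?_
      split_ifs with ht
      · refine Finset.sum_congr rfl fun τ _ => ?_
        have : (∀ i, ((Fin.consEquiv fun _ => Perm X) (t, τ) i).IsSwap) ↔
            ∀ i, (τ i).IsSwap := by
          rw [Fin.forall_fin_succ]
          simp [Fin.consEquiv, ht]
        rw [this, List.ofFn_succ]
        simp [Fin.consEquiv]
      · refine Finset.sum_eq_zero fun τ _ => ?_
        rw [ind_false, zero_mul]
        intro h
        exact ht (by simpa [Fin.consEquiv] using h 0)
    rw [h3, ← mul_right_inj' (two_ne_zero (α := ℚ)), ← h2, ← h1, Nat.factorial_succ]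
    push_cast
    ring

end Monodromy

/-! ### Hurwitz numbers as coefficients -/

section HurwitzNumbers

open Equiv

theorem ind_and (P Q : Prop) : ind (P ∧ Q) = ind P * ind Q := by
  by_cases hP : P <;> by_cases hQ : Q <;> simp [ind, hP, hQ]

theorem ind_eq_ite (P : Prop) [Decidable P] : ind P = if P then 1 else 0 := by
  by_cases h : P <;> simp [ind, h]

theorem reverse_prod_mul_prod {X : Type*} [DecidableEq X] {M : List (Perm X)}
    (hM : ∀ t ∈ M, t.IsSwap) : M.reverse.prod * M.prod = 1 := by
  induction M with
  | nil => simp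
  | cons t M ih =>
    obtain ⟨x, y, _, rfl⟩ := hM t List.mem_cons_self
    have h1 := ih fun t ht => hM t (List.mem_cons_of_mem _ ht)
    rw [List.reverse_cons, List.prod_append, List.prod_cons, List.prod_cons, List.prod_nil, mul_one,
      mul_assoc, ← mul_assoc (swap x y), swap_mul_self, one_mul, h1]

theorem closure_insert_mul {G : Type*} [Group G] {R : Set G} {g σ : G}
    (hg : g ∈ Subgroup.closure R) :
    Subgroup.closure (insert (g * σ) R) = Subgroup.closure (insert σ R) := by
  have h1 : ∀ τ, Subgroup.closure R ≤ Subgroup.closure (insert τ R) := fun τ =>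
    Subgroup.closure_mono (Set.subset_insert _ _)
  have h2 : ∀ τ, τ ∈ Subgroup.closure (insert τ R) := fun τ =>
    Subgroup.subset_closure (Set.mem_insert _ _)
  apply le_antisymm <;> rw [Subgroup.closure_le] <;> rintro x (rfl | hx)
  · exact Subgroup.mul_mem _ (h1 _ hg) (h2 _)
  · exact h1 _ (Subgroup.subset_closure hx)
  · have := Subgroup.mul_mem _ (Subgroup.inv_mem _ (h1 (g * x) hg)) (h2 (g * x))
    rwa [inv_mul_cancel_left] at this
  · exact h1 _ (Subgroup.subset_closure hx)

/-- The factorizations, seen from the permutation `γ`: the transpositions are listed backwards and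
`σ` is expressed by the rest. -/
def backwardFactorizations {d : ℕ} (r : ℕ) (α β : Nat.Partition d) :
    Set (Perm (Fin d) × (Fin r → Perm (Fin d))) :=
  {q | q.1.partition.parts = α.parts ∧ (∀ i, (q.2 i).IsSwap) ∧
    ((List.ofFn q.2).reverse.prod * q.1).partition.parts = β.parts ∧
    MulAction.IsPretransitive
      (Subgroup.closure (insert q.1 {t | t ∈ List.ofFn q.2})) (Fin d)}

theorem ofFn_comp_rev {X : Type*} {r : ℕ} (τ : Fin r → X) :
    List.ofFn (τ ∘ Fin.rev) = (List.ofFn τ).reverse := by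
  apply List.ext_getElem
  · simp
  · intro i h1 h2
    simp only [List.getElem_ofFn, List.getElem_reverse, List.length_ofFn, Function.comp_apply]
    congr 1
    ext
    simp [Fin.rev]
    omega

/-- The transpositions are involutions, so that reversing their order inverts their product. -/
theorem natCard_transitiveFactorizations_eq {d : ℕ} (r : ℕ) (α β : Nat.Partition d) :
    Nat.card (transitiveFactorizations r α β) = Nat.card (backwardFactorizations r α β) := by
  have hsw : ∀ τ : Fin r → Perm (Fin d), (∀ i, (τ i).IsSwap) →
      (List.ofFn τ).reverse.prod * (List.ofFn τ).prod = 1 := fun τ h =>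
    reverse_prod_mul_prod fun t ht => by
      obtain ⟨i, rfl⟩ := (List.mem_ofFn' _ _).1 ht
      exact h i
  have hmem : ∀ L : List (Perm (Fin d)), L.prod ∈ Subgroup.closure {t | t ∈ L} := fun L =>
    Subgroup.list_prod_mem _ fun t ht => Subgroup.subset_closure ht
  refine Nat.card_congr
    { toFun := fun p => ⟨(p.1.2.2, p.1.2.1 ∘ Fin.rev), ?_⟩
      invFun := fun q => ⟨((List.ofFn q.1.2).reverse.prod * q.1.1, q.1.2 ∘ Fin.rev, q.1.1), ?_⟩
      left_inv := ?_
      right_inv := ?_ }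
  · obtain ⟨⟨σ, τ, γ⟩, h1, h2, h3, h4, h5⟩ := p
    dsimp only at h1 h2 h3 h4 h5 ⊢
    have h6 : (List.ofFn τ).prod * γ = σ := by
      rw [← h4, ← mul_assoc, mul_eq_one_comm.1 (hsw τ h3), one_mul]
    refine ⟨h2, fun i => h3 _, ?_, ?_⟩
    · dsimp only
      rw [ofFn_comp_rev, List.reverse_reverse, h6, h1]
    · dsimp only
      have h7 : {t | t ∈ List.ofFn (τ ∘ Fin.rev)} = Set.range τ := by
        ext t
        rw [ofFn_comp_rev]
        simp [List.mem_ofFn']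
      rw [h7, ← h4, closure_insert_mul]
      · exact h5
      · have := hmem (List.ofFn τ).reverse
        rwa [← ofFn_comp_rev, h7, ofFn_comp_rev] at this
  · obtain ⟨⟨γ, τ⟩, h1, h2, h3, h4⟩ := q
    dsimp only at h1 h2 h3 h4 ⊢
    have h7 : {t | t ∈ List.ofFn τ} = Set.range τ := by
      ext t; simp [List.mem_ofFn']
    refine ⟨h3, h1, fun i => h2 _, ?_, ?_⟩
    · dsimp only
      rw [ofFn_comp_rev, List.reverse_reverse, ← mul_assoc, mul_eq_one_comm.1 (hsw τ h2), one_mul]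
    · dsimp only
      have h8 : Set.range (τ ∘ Fin.rev) = Set.range τ := Fin.rev_surjective.range_comp τ
      rw [h8, ← h7, closure_insert_mul]
      · exact h4
      · have := hmem (List.ofFn τ).reverse
        simpa using this
  · rintro ⟨⟨σ, τ, γ⟩, h1, h2, h3, h4, h5⟩
    dsimp only at h3 h4
    apply Subtype.ext
    dsimp only
    rw [ofFn_comp_rev, List.reverse_reverse, ← h4, ← mul_assoc, mul_eq_one_comm.1 (hsw τ h3),
      one_mul, Function.comp_assoc, Fin.rev_involutive.comp_self, Function.comp_id]
  · rintro ⟨⟨γ, τ⟩, h1, h2, h3, h4⟩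
    apply Subtype.ext
    dsimp only
    rw [Function.comp_assoc, Fin.rev_involutive.comp_self, Function.comp_id]

/-- The number of factorizations in terms of the normalized numbers of transitive words. -/
theorem natCard_transitiveFactorizations {d : ℕ} (hd : d ≠ 0) (r : ℕ) (α β : Nat.Partition d) :
    (Nat.card (transitiveFactorizations r α β) : ℚ) =
      ∑ γ ∈ Finset.univ.filter fun γ : Perm (Fin d) => γ.partition.parts = α.parts,
        (r.factorial : ℚ) *
          transCount Finset.univ γ (Multiset.toFinsupp β.parts) r := by
  classical
  have : Nonempty (Fin d) := ⟨⟨0, Nat.pos_of_ne_zero hd⟩⟩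
  have h1 : ∀ γ : Perm (Fin d), (r.factorial : ℚ) *
      transCount Finset.univ γ (Multiset.toFinsupp β.parts) r =
      ∑ τ : Fin r → Perm (Fin d), ind (∀ i, (τ i).IsSwap) *
        (ind (((List.ofFn τ).reverse.prod * γ).partition.parts = β.parts) *
          ind (MulAction.IsPretransitive
            (Subgroup.closure (insert γ {t | t ∈ List.ofFn τ})) (Fin d))) := by
    intro γ
    rw [← factorial_mul_wordSum r fun M =>
      ind ((M.reverse.prod * γ).partition.parts = β.parts) *
        ind (MulAction.IsPretransitive (Subgroup.closure (insert γ {t | t ∈ M})) (Fin d)),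
      transCount]
    congr 1
    refine wordSum_congr _ _ fun L _ => ?_
    rw [act_eq_prod, ← toFinsupp_parts_partition, Multiset.toFinsupp.injective.eq_iff,
      isConnectedOn_iff]
  rw [Finset.sum_congr rfl fun γ _ => h1 γ, natCard_transitiveFactorizations_eq,
    Nat.card_eq_fintype_card, Fintype.card_subtype, Finset.card_filter, Fintype.sum_prod_type,
    Finset.sum_filter]
  push_cast
  refine Finset.sum_congr rfl fun γ _ => ?_
  split_ifs with hγ
  · refine Finset.sum_congr rfl fun τ _ => ?_
    rw [← ind_and, ← ind_and, ind_eq_ite]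
    simp only [backwardFactorizations, Set.mem_ofPred_eq, hγ, true_and]
  · refine Finset.sum_eq_zero fun τ _ => ?_
    rw [if_neg]
    exact fun h => hγ h.1

theorem partCount_toFinsupp (s : Multiset ℕ) :
    partCount (Multiset.toFinsupp s) = Multiset.card s := Multiset.toFinsupp_sum_eq s

theorem exists_cyclesOn_eq_pair {X : Type*} [Fintype X] [DecidableEq X] {γ : Perm X} {a b : ℕ}
    (h : γ.partition.parts = {a, b}) : ∃ C D, C ≠ D ∧ cyclesOn γ Finset.univ = {C, D} ∧
      C.card = a ∧ D.card = b := by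
  rw [parts_partition_eq_map, Multiset.insert_eq_cons, ← Multiset.map_eq_cons] at h
  obtain ⟨C, hC, hCa, h⟩ := h
  rw [Multiset.map_eq_singleton] at h
  obtain ⟨D, hD, hDb⟩ := h
  rw [← Finset.erase_val, ← Finset.singleton_val, Finset.val_inj] at hD
  have hDC : D ∈ (cyclesOn γ Finset.univ).erase C := by rw [hD]; exact Finset.mem_singleton_self _
  exact ⟨C, D, (Finset.ne_of_mem_erase hDC).symm, by rw [← hD, Finset.insert_erase hC], hCa, hDb⟩

theorem exists_cyclesOn_eq_triple {X : Type*} [Fintype X] [DecidableEq X] {γ : Perm X}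
    {a b c : ℕ} (h : γ.partition.parts = {a, b, c}) : ∃ C D E, C ≠ D ∧ C ≠ E ∧ D ≠ E ∧
      cyclesOn γ Finset.univ = {C, D, E} ∧ C.card = a ∧ D.card = b ∧ E.card = c := by
  rw [parts_partition_eq_map, Multiset.insert_eq_cons, ← Multiset.map_eq_cons] at h
  obtain ⟨C, hC, hCa, h⟩ := h
  rw [Multiset.insert_eq_cons, ← Multiset.map_eq_cons] at h
  obtain ⟨D, hD, hDb, h⟩ := h
  rw [Multiset.map_eq_singleton] at h
  obtain ⟨E, hE, hEc⟩ := h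
  rw [← Finset.erase_val] at hD
  rw [← Finset.erase_val, ← Finset.erase_val, ← Finset.singleton_val, Finset.val_inj] at hE
  have hEC : E ∈ ((cyclesOn γ Finset.univ).erase C).erase D := by
    rw [hE]; exact Finset.mem_singleton_self _
  have h1 := Finset.mem_erase.1 hEC
  exact ⟨C, D, E, (Finset.ne_of_mem_erase hD).symm, (Finset.ne_of_mem_erase h1.2).symm, h1.1.symm,
    by rw [← hE, Finset.insert_erase hD, Finset.insert_erase hC], hCa, hDb, hEc⟩

theorem isStable_univ {X : Type*} [Fintype X] [DecidableEq X] (γ : Perm X) :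
    IsStable γ Finset.univ := fun x => by simp

/-- If the normalized number of words is the same for every `γ` of cycle type `α`, the number of
choices of `γ` cancels the normalization of the Hurwitz number. -/
theorem doubleHurwitz_eq {d : ℕ} (hd : d ≠ 0) (g : ℕ) (α β : Nat.Partition d) (t : ℚ)
    (h : ∀ γ : Perm (Fin d), γ.partition.parts = α.parts → transCount Finset.univ γ
      (Multiset.toFinsupp β.parts) (simpleBranchCount g α β) = α.parts.prod * t) :
    doubleHurwitz g α β =
      autOrder β.parts * (simpleBranchCount g α β).factorial * t := by
  have h1 : ((Finset.univ.filter fun γ : Perm (Fin d) => γ.partition.parts = α.parts).card : ℚ) *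
      (α.parts.prod * autOrder α.parts) = d.factorial := by
    exact_mod_cast card_filter_partition α
  have h2 : (d.factorial : ℚ) ≠ 0 := by positivity
  rw [doubleHurwitz, natCard_transitiveFactorizations hd,
    Finset.sum_congr rfl (g := fun _ => ((simpleBranchCount g α β).factorial : ℚ) *
      (α.parts.prod * t)), Finset.sum_const, nsmul_eq_mul, div_mul_eq_mul_div, div_eq_iff h2, ← h1]
  · ring
  · intro γ hγ
    rw [h γ (Finset.mem_filter.1 hγ).2]

theorem doubleHurwitz_two {d : ℕ} (α β : Nat.Partition d) {a b : ℕ} (hα : α.parts = {a, b}) :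
    doubleHurwitz 0 α β = autOrder β.parts * (simpleBranchCount 0 α β).factorial *
      MvPowerSeries.coeff (Multiset.toFinsupp β.parts) (twoCoeff a b) := by
  have hd : a + b = d := by rw [← α.parts_sum, hα]; simp
  have ha : 0 < a := α.parts_pos (by rw [hα]; simp)
  refine doubleHurwitz_eq (by omega) 0 α β _ fun γ hγ => ?_
  rw [hα] at hγ ⊢
  obtain ⟨C, D, hCD, hc, rfl, rfl⟩ := exists_cyclesOn_eq_pair hγ
  rw [((minimalCounts _).two γ _ C D (isStable_univ γ) hCD hc).2 _ le_rfl, twoPart]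
  · rw [mul_assoc, coeff_partRing_natCast_mul, coeff_partRing_natCast_mul]
    simp [mul_assoc]
  · rw [hc, Finset.card_pair hCD, partCount_toFinsupp, simpleBranchCount, hα, Multiset.card_pair]
    omega

theorem doubleHurwitz_three {d : ℕ} (α β : Nat.Partition d) {a b c : ℕ}
    (hα : α.parts = {a, b, c}) :
    doubleHurwitz 0 α β = autOrder β.parts * (simpleBranchCount 0 α β).factorial *
      MvPowerSeries.coeff (Multiset.toFinsupp β.parts) (threeCoeff a b c) := by
  have hd : a + (b + c) = d := by rw [← α.parts_sum, hα]; simp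
  have ha : 0 < a := α.parts_pos (by rw [hα]; simp)
  refine doubleHurwitz_eq (by omega) 0 α β _ fun γ hγ => ?_
  rw [hα] at hγ ⊢
  obtain ⟨C, D, E, hCD, hCE, hDE, hc, rfl, rfl, rfl⟩ := exists_cyclesOn_eq_triple hγ
  rw [((minimalCounts _).three γ _ C D E (isStable_univ γ) hCD hCE hDE hc).2 _ le_rfl, threePart]
  · rw [mul_assoc, mul_assoc, coeff_partRing_natCast_mul, coeff_partRing_natCast_mul,
      coeff_partRing_natCast_mul]
    simp [mul_assoc]
  · rw [hc, Finset.card_eq_three.2 ⟨C, D, E, hCD, hCE, hDE, rfl⟩, partCount_toFinsupp,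
      simpleBranchCount, hα]
    simp only [Multiset.insert_eq_cons, Multiset.card_cons, Multiset.card_singleton]
    omega

end HurwitzNumbers

/-! ### Explicit formulas for the coefficients -/

section ExplicitFormulas

theorem coeff_serQ_mul_serE_pow (a p : ℕ) :
    (a : PartRing) * PowerSeries.coeff p (serQ * serE ^ a) = p * PowerSeries.coeff p (serE ^ a) := by
  have hder : ∀ f : PowerSeries PartRing, ∀ k,
      PowerSeries.coeff k (PowerSeries.X * PowerSeries.derivative PartRing f) =
        k * PowerSeries.coeff k f := by
    intro f k
    cases k with
    | zero => simp
    | succ k =>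
      rw [PowerSeries.coeff_succ_X_mul, PowerSeries.coeff_derivative]
      push_cast
      ring
  have h1 : PowerSeries.X * PowerSeries.derivative PartRing serE = serQ * serE := by
    ext1 k
    rw [hder, coeff_serQ_mul_serE]
  rw [← hder, ← nsmul_eq_mul, ← map_nsmul, nsmul_eq_mul]
  congr 1
  cases a with
  | zero => simp
  | succ a =>
    rw [PowerSeries.derivative_pow, Nat.add_sub_cancel, pow_succ]
    linear_combination -((a + 1 : ℕ) : PowerSeries PartRing) * serE ^ a * h1

/-- The weight `(a - |γ|) a^{l(γ) - 1} / |Aut γ|` of a partition `γ` that is attached to a part `a`. -/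
noncomputable def treeWeight (a : ℕ) (β : ℕ →₀ ℕ) : ℚ :=
  ((a : ℚ) - partSum β) * (a : ℚ) ^ ((partCount β : ℤ) - 1) / multFactorial β

theorem coeff_invCoeff {a : ℕ} (ha : a ≠ 0) (p : ℕ) (β : ℕ →₀ ℕ) :
    MvPowerSeries.coeff β (invCoeff a p) =
      if partSum β = p ∧ β 0 = 0 then treeWeight a β else 0 := by
  have ha' : (a : ℚ) ≠ 0 := Nat.cast_ne_zero.2 ha
  have h1 := congrArg (MvPowerSeries.coeff β) (coeff_serQ_mul_serE_pow a p)
  rw [coeff_partRing_natCast_mul, coeff_partRing_natCast_mul] at h1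
  have h2 : MvPowerSeries.coeff β (PowerSeries.coeff p (serQ * serE ^ a)) =
      p / a * MvPowerSeries.coeff β (PowerSeries.coeff p (serE ^ a)) := by
    rw [div_mul_eq_mul_div, eq_div_iff ha', ← h1, mul_comm]
  rw [invCoeff, sub_mul, one_mul, map_sub (PowerSeries.coeff p), map_sub (MvPowerSeries.coeff β), h2,
    serE_pow, coeff_gradedSeries]
  split_ifs with h
  · rw [treeWeight, zpow_sub_one₀ ha', zpow_natCast, h.1]
    field_simp
  · simp

theorem apply_zero_of_mem_antidiagonal {β : ℕ →₀ ℕ} (hβ : β 0 = 0) {x : (ℕ →₀ ℕ) × (ℕ →₀ ℕ)}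
    (hx : x ∈ Finset.HasAntidiagonal.antidiagonal β) : x.1 0 = 0 ∧ x.2 0 = 0 := by
  rw [Finset.HasAntidiagonal.mem_antidiagonal] at hx
  have := DFunLike.congr_fun hx 0
  rw [Finsupp.add_apply, hβ] at this
  omega

/-- Attaching one part `a`: the sum over the size of `γ` turns into a sum over `γ` itself. -/
theorem coeff_sum_invCoeff_mul {a : ℕ} (ha : a ≠ 0) (G : ℕ → PartRing) {β : ℕ →₀ ℕ}
    (hβ : β 0 = 0) :
    MvPowerSeries.coeff β (∑ p ∈ Finset.HasAntidiagonal.antidiagonal a,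
      invCoeff a p.1 * if p.2 ≠ 0 then G p.2 else 0) =
    ∑ x ∈ Finset.HasAntidiagonal.antidiagonal β, if partSum x.1 < a then
      treeWeight a x.1 * MvPowerSeries.coeff x.2 (G (a - partSum x.1)) else 0 := by
  simp only [map_sum, MvPowerSeries.coeff_mul]
  rw [Finset.sum_comm]
  refine Finset.sum_congr rfl fun x hx => ?_
  have hx0 := (apply_zero_of_mem_antidiagonal hβ hx).1
  split_ifs with h
  · rw [Finset.sum_eq_single (partSum x.1, a - partSum x.1)]
    · rw [coeff_invCoeff ha, if_pos ⟨rfl, hx0⟩, if_pos (by simp only; omega)]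
    · rintro ⟨p₁, p₂⟩ hp hne
      rw [Finset.HasAntidiagonal.mem_antidiagonal] at hp
      rw [coeff_invCoeff ha, if_neg, zero_mul]
      rintro ⟨h1, _⟩
      dsimp only at h1 hp
      exact hne (by rw [h1, ← hp, Nat.add_sub_cancel_left])
    · intro h'
      exact absurd (Finset.HasAntidiagonal.mem_antidiagonal.2 (by simp only; omega)) h'
  · refine Finset.sum_eq_zero fun p hp => ?_
    rw [Finset.HasAntidiagonal.mem_antidiagonal] at hp
    by_cases hp2 : p.2 = 0
    · rw [if_neg (by simpa using hp2), map_zero, mul_zero]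
    · rw [coeff_invCoeff ha, if_neg, zero_mul]
      rintro ⟨h1, _⟩
      omega

/-- The weight `l(ρ)! ∏ ρ_j / |Aut ρ|`. -/
noncomputable def joinWeight (β : ℕ →₀ ℕ) : ℚ :=
  (partCount β).factorial * partProd β / multFactorial β

theorem coeff_twoPointCoeff {a b : ℕ} (ha : a ≠ 0) (hb : b ≠ 0) {β : ℕ →₀ ℕ} (hβ : β 0 = 0)
    (hs : partSum β = a + b) :
    MvPowerSeries.coeff β (twoPointCoeff a b) =
      ∑ x ∈ Finset.HasAntidiagonal.antidiagonal β, ∑ y ∈ Finset.HasAntidiagonal.antidiagonal x.2,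
        if partSum x.1 < a ∧ partSum y.1 < b then
          treeWeight a x.1 * treeWeight b y.1 * joinWeight y.2 else 0 := by
  have h1 : twoPointCoeff a b = ∑ p ∈ Finset.HasAntidiagonal.antidiagonal a,
      invCoeff a p.1 * if p.2 ≠ 0 then ∑ q ∈ Finset.HasAntidiagonal.antidiagonal b,
        invCoeff b q.1 * if q.2 ≠ 0 then PowerSeries.coeff (p.2 + q.2) serU else 0 else 0 := by
    rw [twoPointCoeff]
    refine Finset.sum_congr rfl fun p _ => ?_
    rw [← Finset.mul_sum]
    congr 1
    split_ifs with h
    · simp [h]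
    · exact Finset.sum_eq_zero fun q _ => by rw [if_neg (fun h' => h h'.1), mul_zero]
  rw [h1, coeff_sum_invCoeff_mul ha (fun k => ∑ q ∈ Finset.HasAntidiagonal.antidiagonal b,
        invCoeff b q.1 * if q.2 ≠ 0 then PowerSeries.coeff (k + q.2) serU else 0) hβ]
  refine Finset.sum_congr rfl fun x hx => ?_
  have hx0 := (apply_zero_of_mem_antidiagonal hβ hx).2
  split_ifs with hxa
  · rw [coeff_sum_invCoeff_mul hb (fun l => PowerSeries.coeff (a - partSum x.1 + l) serU) hx0,
      Finset.mul_sum]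
    refine Finset.sum_congr rfl fun y hy => ?_
    have hy0 := (apply_zero_of_mem_antidiagonal hx0 hy).2
    rw [Finset.HasAntidiagonal.mem_antidiagonal] at hx hy
    have e1 := congrArg partSum hx
    have e2 := congrArg partSum hy
    rw [map_add] at e1 e2
    by_cases hyb : partSum y.1 < b
    · rw [if_pos hyb, if_pos ⟨hxa, hyb⟩, serU, coeff_gradedSeries, if_pos ⟨by omega, hy0⟩,
        joinWeight]
      ring
    · rw [if_neg hyb, if_neg (fun h => hyb h.2), mul_zero]
  · exact (Finset.sum_eq_zero fun y _ => if_neg fun h => hxa h.1).symm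

theorem coeff_threeCoeff {a b c : ℕ} (ha : a ≠ 0) (hb : b ≠ 0) (hc : c ≠ 0) {β : ℕ →₀ ℕ}
    (hβ : β 0 = 0) (hs : partSum β = a + b + c) :
    MvPowerSeries.coeff β (threeCoeff a b c) =
      ∑ x ∈ Finset.HasAntidiagonal.antidiagonal β, ∑ y ∈ Finset.HasAntidiagonal.antidiagonal x.2,
        ∑ z ∈ Finset.HasAntidiagonal.antidiagonal y.2,
        if partSum x.1 < a ∧ partSum y.1 < b ∧ partSum z.1 < c then
          treeWeight a x.1 * treeWeight b y.1 * treeWeight c z.1 * joinWeight z.2 else 0 := by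
  have h1 : threeCoeff a b c = ∑ p ∈ Finset.HasAntidiagonal.antidiagonal a,
      invCoeff a p.1 * if p.2 ≠ 0 then ∑ q ∈ Finset.HasAntidiagonal.antidiagonal b,
        invCoeff b q.1 * if q.2 ≠ 0 then ∑ r ∈ Finset.HasAntidiagonal.antidiagonal c,
          invCoeff c r.1 * if r.2 ≠ 0 then PowerSeries.coeff (p.2 + q.2 + r.2) serU else 0
        else 0 else 0 := by
    rw [threeCoeff]
    refine Finset.sum_congr rfl fun p _ => ?_
    simp only [← Finset.mul_sum]
    congr 1
    split_ifs with h
    · refine Finset.sum_congr rfl fun q _ => ?_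
      congr 1
      split_ifs with h'
      · simp [h, h']
      · exact Finset.sum_eq_zero fun r _ => by rw [if_neg (fun h'' => h' h''.2.1), mul_zero]
    · refine Finset.sum_eq_zero fun q _ => ?_
      rw [Finset.sum_eq_zero, mul_zero]
      exact fun r _ => by rw [if_neg (fun h' => h h'.1), mul_zero]
  rw [h1, coeff_sum_invCoeff_mul ha (fun k => ∑ q ∈ Finset.HasAntidiagonal.antidiagonal b,
        invCoeff b q.1 * if q.2 ≠ 0 then ∑ r ∈ Finset.HasAntidiagonal.antidiagonal c,
          invCoeff c r.1 * if r.2 ≠ 0 then PowerSeries.coeff (k + q.2 + r.2) serU else 0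
        else 0) hβ]
  refine Finset.sum_congr rfl fun x hx => ?_
  have hx0 := (apply_zero_of_mem_antidiagonal hβ hx).2
  split_ifs with hxa
  · rw [coeff_sum_invCoeff_mul hb (fun l => ∑ r ∈ Finset.HasAntidiagonal.antidiagonal c,
      invCoeff c r.1 * if r.2 ≠ 0 then PowerSeries.coeff (a - partSum x.1 + l + r.2) serU else 0)
      hx0, Finset.mul_sum]
    refine Finset.sum_congr rfl fun y hy => ?_
    have hy0 := (apply_zero_of_mem_antidiagonal hx0 hy).2
    split_ifs with hyb
    · rw [coeff_sum_invCoeff_mul hc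
        (fun l => PowerSeries.coeff (a - partSum x.1 + (b - partSum y.1) + l) serU) hy0,
        Finset.mul_sum, Finset.mul_sum]
      refine Finset.sum_congr rfl fun z hz => ?_
      have hz0 := (apply_zero_of_mem_antidiagonal hy0 hz).2
      rw [Finset.HasAntidiagonal.mem_antidiagonal] at hx hy hz
      have e1 := congrArg partSum hx
      have e2 := congrArg partSum hy
      have e3 := congrArg partSum hz
      rw [map_add] at e1 e2 e3
      by_cases hzc : partSum z.1 < c
      · rw [if_pos hzc, if_pos ⟨hxa, hyb, hzc⟩, serU, coeff_gradedSeries,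
          if_pos ⟨by omega, hz0⟩, joinWeight]
        ring
      · rw [if_neg hzc, if_neg (fun h => hzc h.2.2), mul_zero, mul_zero]
    · rw [mul_zero]
      exact (Finset.sum_eq_zero fun z _ => if_neg fun h => hyb h.2.1).symm
  · exact (Finset.sum_eq_zero fun y _ => Finset.sum_eq_zero fun z _ => if_neg fun h => hxa h.1).symm

theorem multFactorial_toFinsupp (s : Multiset ℕ) :
    multFactorial (Multiset.toFinsupp s) = autOrder s := rfl

theorem partProd_toFinsupp (s : Multiset ℕ) : partProd (Multiset.toFinsupp s) = s.prod := by
  rw [Finset.prod_multiset_count]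
  rfl

theorem partSum_toFinsupp (s : Multiset ℕ) : partSum (Multiset.toFinsupp s) = s.sum := by
  rw [Finset.sum_multiset_count, partSum_eq_sum]
  rfl

/-- Decompositions into three partitions as pairs of binary decompositions. -/
theorem sum_decompositions_two (a : Fin 2 → ℕ) (s : Multiset ℕ)
    (F : (ℕ →₀ ℕ) → (ℕ →₀ ℕ) → (ℕ →₀ ℕ) → ℚ) :
    ∑ x ∈ Finset.HasAntidiagonal.antidiagonal (Multiset.toFinsupp s),
      ∑ y ∈ Finset.HasAntidiagonal.antidiagonal x.2,
        (if partSum x.1 < a 0 ∧ partSum y.1 < a 1 then F x.1 y.1 y.2 else 0) =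
    ∑ p ∈ decompositions a s, F (Multiset.toFinsupp (p.2 0)) (Multiset.toFinsupp (p.2 1))
      (Multiset.toFinsupp p.1) := by
  rw [Finset.sum_sigma', ← Finset.sum_filter]
  symm
  refine Finset.sum_bij'
    (fun p _ => ⟨(Multiset.toFinsupp (p.2 0), Multiset.toFinsupp (p.2 1 + p.1)),
      (Multiset.toFinsupp (p.2 1), Multiset.toFinsupp p.1)⟩)
    (fun x _ => (Multiset.toFinsupp.symm x.2.2,
      ![Multiset.toFinsupp.symm x.1.1, Multiset.toFinsupp.symm x.2.1])) ?_ ?_ ?_ ?_ ?_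
  · intro p hp
    obtain ⟨-, hp1, hp2⟩ := Finset.mem_filter.1 hp
    rw [Fin.sum_univ_two] at hp1
    rw [Finset.mem_filter, Finset.mem_sigma, Finset.HasAntidiagonal.mem_antidiagonal,
      Finset.HasAntidiagonal.mem_antidiagonal]
    refine ⟨⟨?_, ?_⟩, ?_, ?_⟩
    · rw [← map_add, ← hp1]
      congr 1
      abel
    · rw [← map_add]
    · rw [partSum_toFinsupp]; exact hp2 0
    · rw [partSum_toFinsupp]; exact hp2 1
  · rintro ⟨⟨x₁, x₂⟩, ⟨y₁, y₂⟩⟩ hx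
    rw [Finset.mem_filter, Finset.mem_sigma, Finset.HasAntidiagonal.mem_antidiagonal,
      Finset.HasAntidiagonal.mem_antidiagonal] at hx
    obtain ⟨⟨h1, h2⟩, h3, h4⟩ := hx
    dsimp only at h1 h2 h3 h4
    subst h2
    have hs : Multiset.toFinsupp.symm y₂ +
        (Multiset.toFinsupp.symm x₁ + Multiset.toFinsupp.symm y₁) = s := by
      rw [← map_add, ← map_add, AddEquiv.symm_apply_eq, ← h1]
      abel
    rw [← Multiset.toFinsupp.apply_symm_apply x₁, partSum_toFinsupp] at h3
    rw [← Multiset.toFinsupp.apply_symm_apply y₁, partSum_toFinsupp] at h4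
    rw [decompositions, Finset.mem_filter, Finset.mem_product, Fintype.mem_piFinset,
      Fin.forall_fin_two, Fin.forall_fin_two, Fin.sum_univ_two, Finset.mem_Iic, Finset.mem_Iic,
      Finset.mem_Iic]
    refine ⟨⟨?_, ?_, ?_⟩, hs, h3, h4⟩ <;> rw [← hs]
    · exact Multiset.le_add_right _ _
    · exact (Multiset.le_add_right _ _).trans (Multiset.le_add_left _ _)
    · exact (Multiset.le_add_left _ _).trans (Multiset.le_add_left _ _)
  · rintro ⟨p, q⟩ _
    refine Prod.ext ?_ (funext fun i => ?_)
    · simp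
    · fin_cases i <;> simp
  · rintro ⟨⟨x₁, x₂⟩, ⟨y₁, y₂⟩⟩ hx
    rw [Finset.mem_filter, Finset.mem_sigma, Finset.HasAntidiagonal.mem_antidiagonal,
      Finset.HasAntidiagonal.mem_antidiagonal] at hx
    obtain ⟨⟨_, h2⟩, _⟩ := hx
    dsimp only at h2
    subst h2
    simp
  · exact fun _ _ => rfl

theorem sum_decompositions_three (a : Fin 3 → ℕ) (s : Multiset ℕ)
    (F : (ℕ →₀ ℕ) → (ℕ →₀ ℕ) → (ℕ →₀ ℕ) → (ℕ →₀ ℕ) → ℚ) :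
    ∑ x ∈ Finset.HasAntidiagonal.antidiagonal (Multiset.toFinsupp s),
      ∑ y ∈ Finset.HasAntidiagonal.antidiagonal x.2,
        ∑ z ∈ Finset.HasAntidiagonal.antidiagonal y.2,
        (if partSum x.1 < a 0 ∧ partSum y.1 < a 1 ∧ partSum z.1 < a 2 then
          F x.1 y.1 z.1 z.2 else 0) =
    ∑ p ∈ decompositions a s, F (Multiset.toFinsupp (p.2 0)) (Multiset.toFinsupp (p.2 1))
      (Multiset.toFinsupp (p.2 2)) (Multiset.toFinsupp p.1) := by
  rw [Finset.sum_congr rfl fun x _ => Finset.sum_sigma' _ _ _, Finset.sum_sigma',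
    ← Finset.sum_filter]
  symm
  refine Finset.sum_bij'
    (fun p _ => ⟨(Multiset.toFinsupp (p.2 0), Multiset.toFinsupp (p.2 1 + (p.2 2 + p.1))),
      ⟨(Multiset.toFinsupp (p.2 1), Multiset.toFinsupp (p.2 2 + p.1)),
      (Multiset.toFinsupp (p.2 2), Multiset.toFinsupp p.1)⟩⟩)
    (fun x _ => (Multiset.toFinsupp.symm x.2.2.2,
      ![Multiset.toFinsupp.symm x.1.1, Multiset.toFinsupp.symm x.2.1.1,
        Multiset.toFinsupp.symm x.2.2.1])) ?_ ?_ ?_ ?_ ?_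
  · intro p hp
    obtain ⟨-, hp1, hp2⟩ := Finset.mem_filter.1 hp
    rw [Fin.sum_univ_three] at hp1
    rw [Finset.mem_filter, Finset.mem_sigma, Finset.mem_sigma,
      Finset.HasAntidiagonal.mem_antidiagonal, Finset.HasAntidiagonal.mem_antidiagonal,
      Finset.HasAntidiagonal.mem_antidiagonal]
    refine ⟨⟨?_, ?_, ?_⟩, ?_, ?_, ?_⟩
    · rw [← map_add, ← hp1]
      congr 1
      abel
    · rw [← map_add]
    · rw [← map_add]
    · rw [partSum_toFinsupp]; exact hp2 0
    · rw [partSum_toFinsupp]; exact hp2 1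
    · rw [partSum_toFinsupp]; exact hp2 2
  · rintro ⟨⟨x₁, x₂⟩, ⟨⟨y₁, y₂⟩, ⟨z₁, z₂⟩⟩⟩ hx
    rw [Finset.mem_filter, Finset.mem_sigma, Finset.mem_sigma,
      Finset.HasAntidiagonal.mem_antidiagonal, Finset.HasAntidiagonal.mem_antidiagonal,
      Finset.HasAntidiagonal.mem_antidiagonal] at hx
    obtain ⟨⟨h1, h2, h3⟩, h4, h5, h6⟩ := hx
    dsimp only at h1 h2 h3 h4 h5 h6
    subst h3
    subst h2
    have hs : Multiset.toFinsupp.symm z₂ + (Multiset.toFinsupp.symm x₁ +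
        Multiset.toFinsupp.symm y₁ + Multiset.toFinsupp.symm z₁) = s := by
      rw [← map_add, ← map_add, ← map_add, AddEquiv.symm_apply_eq, ← h1]
      abel
    rw [← Multiset.toFinsupp.apply_symm_apply x₁, partSum_toFinsupp] at h4
    rw [← Multiset.toFinsupp.apply_symm_apply y₁, partSum_toFinsupp] at h5
    rw [← Multiset.toFinsupp.apply_symm_apply z₁, partSum_toFinsupp] at h6
    rw [decompositions, Finset.mem_filter, Finset.mem_product, Fintype.mem_piFinset,
      Fin.forall_fin_succ, Fin.forall_fin_two, Fin.forall_fin_succ, Fin.forall_fin_two,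
      Fin.sum_univ_three, Finset.mem_Iic, Finset.mem_Iic, Finset.mem_Iic, Finset.mem_Iic]
    refine ⟨⟨?_, ?_, ?_, ?_⟩, hs, h4, h5, h6⟩ <;> rw [← hs]
    · exact Multiset.le_add_right _ _
    · exact ((Multiset.le_add_right _ _).trans (Multiset.le_add_right _ _)).trans
        (Multiset.le_add_left _ _)
    · exact ((Multiset.le_add_left _ _).trans (Multiset.le_add_right _ _)).trans
        (Multiset.le_add_left _ _)
    · exact (Multiset.le_add_left _ _).trans (Multiset.le_add_left _ _)
  · rintro ⟨p, q⟩ _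
    refine Prod.ext ?_ (funext fun i => ?_)
    · simp
    · fin_cases i <;> simp
  · rintro ⟨⟨x₁, x₂⟩, ⟨⟨y₁, y₂⟩, ⟨z₁, z₂⟩⟩⟩ hx
    rw [Finset.mem_filter, Finset.mem_sigma, Finset.mem_sigma,
      Finset.HasAntidiagonal.mem_antidiagonal, Finset.HasAntidiagonal.mem_antidiagonal,
      Finset.HasAntidiagonal.mem_antidiagonal] at hx
    obtain ⟨⟨_, h2, h3⟩, _⟩ := hx
    dsimp only at h2 h3
    subst h3
    subst h2
    simp
  · exact fun _ _ => rfl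

end ExplicitFormulas

theorem corollary5p9 {d : ℕ} (α β : Nat.Partition d) :
    (∀ a : Fin 2 → ℕ, α.parts = {a 0, a 1} →
      doubleHurwitz 0 α β =
        (autOrder β.parts : ℚ) * (simpleBranchCount 0 α β).factorial / d *
          ∑ p ∈ decompositions a β.parts,
            ((Multiset.card p.1).factorial : ℚ) * (p.1.prod : ℚ) /
                ((autOrder p.1 : ℚ) * autOrder (p.2 0) * autOrder (p.2 1)) *
              ((a 0 : ℚ) - ((p.2 0).sum : ℚ)) * ((a 1 : ℚ) - ((p.2 1).sum : ℚ)) *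
              (a 0 : ℚ) ^ ((Multiset.card (p.2 0) : ℤ) - 1) *
              (a 1 : ℚ) ^ ((Multiset.card (p.2 1) : ℤ) - 1)) ∧
    (∀ a : Fin 3 → ℕ, α.parts = {a 0, a 1, a 2} →
      doubleHurwitz 0 α β =
        (autOrder β.parts : ℚ) * (simpleBranchCount 0 α β).factorial *
          ∑ p ∈ decompositions a β.parts,
            ((Multiset.card p.1).factorial : ℚ) * (p.1.prod : ℚ) / (autOrder p.1 : ℚ) *
              ∏ j, (((a j : ℚ) - ((p.2 j).sum : ℚ)) *
                (a j : ℚ) ^ ((Multiset.card (p.2 j) : ℤ) - 1) / (autOrder (p.2 j) : ℚ))) := by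
  have hβ : Multiset.toFinsupp β.parts 0 = 0 := by
    rw [Multiset.toFinsupp_apply, Multiset.count_eq_zero]
    exact fun h => absurd (β.parts_pos h) (lt_irrefl 0)
  have hpos : ∀ i ∈ α.parts, i ≠ 0 := fun i hi => (α.parts_pos hi).ne'
  constructor
  · intro a hα
    rw [hα] at hpos
    have hd : a 0 + a 1 = d := by rw [← α.parts_sum, hα]; simp
    rw [doubleHurwitz_two α β hα, twoCoeff, MvPowerSeries.coeff_smul, hd,
      coeff_twoPointCoeff (hpos _ (by simp)) (hpos _ (by simp)) hβ
        (by rw [partSum_toFinsupp, β.parts_sum, hd]),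
      sum_decompositions_two a β.parts
        fun x y w => treeWeight (a 0) x * treeWeight (a 1) y * joinWeight w,
      div_eq_mul_inv, mul_assoc _ (d : ℚ)⁻¹]
    congr 2
    refine Finset.sum_congr rfl fun p _ => ?_
    simp only [treeWeight, joinWeight, partSum_toFinsupp, partCount_toFinsupp, partProd_toFinsupp,
      multFactorial_toFinsupp]
    ring
  · intro a hα
    rw [hα] at hpos
    have hd : a 0 + a 1 + a 2 = d := by rw [← α.parts_sum, hα]; simp [add_assoc]
    rw [doubleHurwitz_three α β hα,
      coeff_threeCoeff (hpos _ (by simp)) (hpos _ (by simp)) (hpos _ (by simp)) hβ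
        (by rw [partSum_toFinsupp, β.parts_sum, hd]),
      sum_decompositions_three a β.parts
        fun x y z w => treeWeight (a 0) x * treeWeight (a 1) y * treeWeight (a 2) z * joinWeight w]
    congr 1
    refine Finset.sum_congr rfl fun p _ => ?_
    rw [Fin.prod_univ_three]
    simp only [treeWeight, joinWeight, partSum_toFinsupp, partCount_toFinsupp, partProd_toFinsupp,
      multFactorial_toFinsupp]
    ring
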